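/- For $\lambda\in\mathbb R^n$ let $\sigma_k(\lambda)=\sum_{i_1<\dots<i_k}\lambda_{i_1}\cdots\lambda_{i_k}$ and $\Gamma_k=\{\lambda\in\mathbb R^n:\sigma_i(\lambda)>0 \text{ for } 1\le i\le k\}$. Let $(g_{p\bar q})$ be a Hermitian metric and $W=(\omega_{p\bar q})$ a Hermitian tensor (real $(1,1)$-form) defined near a point $z_0\in\mathbb C^n$ (local holomorphic coordinates $z^1,\dots,z^n$ of an $n$-dimensional complex manifold), both differentiable at $z_0$. Let $D$ be the Chern connection of $g$, and write $\omega_{p\bar q j}=D_j\omega_{p\bar q}$, $\omega_{p\bar q\bar j}=D_{\bar j}\omega_{p\bar q}$. Let $\sigma_k(W)$ be the $k$-th elementary symmetric function of the eigenvalues of $W$ with respect to $g$; thus $D_j\sigma_k=\partial_{z^j}\sigma_k(W)$. Regarding $\sigma_k(W)$ as a polynomial in the entries $\omega_{p\bar q}$ (taken as independent variables), put $\sigma_k^{p\bar q}=\partial\sigma_k/\partial\omega_{p\bar q}$ and $\sigma_k^{p\bar q,r\bar s}=\partial^2\sigma_k/\partial\omega_{p\bar q}\partial\omega_{r\bar s}$.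 **Lemma (modified concavity inequality).** For every integer $k\ge 1$ there is a constant $K>0$ depending only on $k$ such that the following holds. Let $n\ge k$, $A>0$, $0<s_0\le s_1$ and $\varepsilon_0\in(0,1)$. Then there is a constant $L>0$ depending only on $n,k,A,s_0,s_1,\varepsilon_0$ such that, whenever the coordinates are chosen so that at $z_0$ one has $g_{p\bar q}=\delta_{pq}$ and $W=\mathrm{diag}(\lambda_1,\dots,\lambda_n)$, where $$\lambda=(\lambda_1,\dots,\lambda_n)\in\Gamma_k,\qquad \lambda_1\ge\dots\ge\lambda_n>-A,\qquad s_0\le\sigma_k(\lambda)\le s_1,\qquad \lambda_1\ge L,$$ then, at $z_0$, for every $j=1,\dots,n$, $$-\sum_{p\ne q}\frac{\sigma_k^{p\bar p,q\bar q}\,\omega_{p\bar pj}\,\omega_{q\bar q\bar j}}{\sigma_k}+K\frac{|D_j\sigma_k|^2}{\sigma_k^2}+(1-\varepsilon_0)\sum_{i>1}\frac{\sigma_k^{i\bar i}|\omega_{i\bar ij}|^2}{\lambda_1\sigma_k}\ \ge\ (1-\varepsilon_0)\frac{\sigma_k^{1\bar 1}|\omega_{1\bar 1j}|^2}{\lambda_1\sigma_k}.$$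 -/

import Mathlib

open scoped ComplexOrder ComplexConjugate Topology

noncomputable section

namespace HessianConcavity

/-- The `k`-th elementary symmetric function of `lam : ℝⁿ`. -/
def sigma {n : ℕ} (k : ℕ) (lam : Fin n → ℝ) : ℝ :=
  ∑ s ∈ Finset.powersetCard k (Finset.univ : Finset (Fin n)), ∏ i ∈ s, lam i

/-- The Gårding cone `Γ_k` in `ℝⁿ`. -/
def gardingCone (n k : ℕ) : Set (Fin n → ℝ) :=
  {lam | ∀ i : ℕ, 1 ≤ i → i ≤ k → 0 < sigma i lam}

/-- `σ_k(χ)` with respect to the metric `g`: the `k`-th elementary symmetric function of the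
eigenvalues (counted with algebraic multiplicity) of the matrix `M = (χ_{p q̄})` relative to
`g = (g_{p q̄})`, that is, of the roots of the characteristic polynomial of `g⁻¹ M`. It is defined
for every complex matrix `M` and is a polynomial in its entries `M p q`, which are independent
variables in the partial derivatives below. -/
def sigmaMat {n : ℕ} (k : ℕ) (g M : Matrix (Fin n) (Fin n) ℂ) : ℂ :=
  (g⁻¹ * M).charpoly.roots.esymm k

/-- `σ_k^{p q̄} = ∂σ_k / ∂χ_{p q̄}`. -/
def sigmaD {n : ℕ} (k : ℕ) (g M : Matrix (Fin n) (Fin n) ℂ) (p q : Fin n) : ℂ :=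
  deriv (fun t : ℂ => sigmaMat k g (M + t • Matrix.single p q (1 : ℂ))) 0

/-- `σ_k^{p q̄, r s̄} = ∂²σ_k / ∂χ_{p q̄} ∂χ_{r s̄}`. -/
def sigmaDD {n : ℕ} (k : ℕ) (g M : Matrix (Fin n) (Fin n) ℂ) (p q r s : Fin n) : ℂ :=
  deriv (fun t : ℂ => sigmaD k g (M + t • Matrix.single r s (1 : ℂ)) p q) 0

/-- The Wirtinger derivative `∂f/∂z^j = (∂f/∂x^j - √-1 ∂f/∂y^j) / 2` at `z`. -/
def dz {n : ℕ} (j : Fin n) (f : (Fin n → ℂ) → ℂ) (z : Fin n → ℂ) : ℂ :=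
  (fderiv ℝ f z (Pi.single j 1) - Complex.I * fderiv ℝ f z (Pi.single j Complex.I)) / 2

/-- The Wirtinger derivative `∂f/∂z̄^j = (∂f/∂x^j + √-1 ∂f/∂y^j) / 2` at `z`. -/
def dzbar {n : ℕ} (j : Fin n) (f : (Fin n → ℂ) → ℂ) (z : Fin n → ℂ) : ℂ :=
  (fderiv ℝ f z (Pi.single j 1) + Complex.I * fderiv ℝ f z (Pi.single j Complex.I)) / 2

/-- The Christoffel symbol `Γ^r_{j p} = ∑_s g^{r s̄} ∂_j g_{p s̄}` of the Chern connection of the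
Hermitian metric `g = (g_{p q̄})`, where `∑_s g_{p s̄} g^{r s̄} = δ_{pr}`. -/
def chernGamma {n : ℕ} (g : (Fin n → ℂ) → Matrix (Fin n) (Fin n) ℂ) (r j p : Fin n)
    (z : Fin n → ℂ) : ℂ :=
  ∑ s, dz j (fun w => g w p s) z * (g z)⁻¹ s r

/-- `ω_{p q̄ j} = D_j ω_{p q̄} = ∂_j ω_{p q̄} - Γ^r_{j p} ω_{r q̄}`, with `D` the Chern connection
of `g`. -/
def covD {n : ℕ} (g W : (Fin n → ℂ) → Matrix (Fin n) (Fin n) ℂ) (p q j : Fin n)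
    (z : Fin n → ℂ) : ℂ :=
  dz j (fun w => W w p q) z - ∑ r, chernGamma g r j p z * W z r q

/-- `ω_{p q̄ j̄} = D_{j̄} ω_{p q̄} = ∂_{j̄} ω_{p q̄} - conj(Γ^s_{j q}) ω_{p s̄}`, with `D` the Chern
connection of `g`. -/
def covDbar {n : ℕ} (g W : (Fin n → ℂ) → Matrix (Fin n) (Fin n) ℂ) (p q j : Fin n)
    (z : Fin n → ℂ) : ℂ :=
  dzbar j (fun w => W w p q) z - ∑ s, conj (chernGamma g s j q z) * W z p s

end HessianConcavity

end

/-! Reduction to real vectors. At z₀ the metric is the identity and W is diagonal, so only the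
diagonal derivatives ξ_p = D_j ω_{p p̄} enter, and D_j σ_k is the differential of σ_k(λ) applied to
ξ. All coefficients are real, so the real and imaginary parts of ξ separate. For k = 1 the
hypotheses are contradictory once L is large. For k = κ + 2 the claim is an inequality for real ξ,
and K = 2 suffices. By homogeneity one may divide λ by λ_1 and get a vector x with leading entry x_o
= 1.

Logarithmic splitting. Let T be the set of the other indices, P and R the symmetric functions of T
of degrees κ + 1 and κ + 2, and q = R / P. Then f = σ_k = P (x_o + q). On the Gårding cone q is
concave (Marcus and Lopes, `elem_quotient_superadditive`), and so is log P. Put u = f'/f - P'/P, y =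
q'(ξ) and M = -q''(ξ, ξ) ≥ 0. Then -f'' + f'²/f ≥ f u² + P M (`elem_log_form_ge`), while ξ_o = (1 +
q) u - y (`direction_eq`). It remains to control y by M and by the form F = ∑_{i ∈ T} f_i ξ_i²
(`restForm`).

Spectral gap. Since λ > -A, σ_k ≤ s₁ and λ_1 is large, at most κ entries of x on T stay away from
zero. By pigeonhole along a finite decreasing sequence of thresholds, T splits into B, with entries
at least D, and S, with entries at most δ in absolute value, where δ is as small as needed in terms
of D. With |B| + m = κ, the identity ∑_{i ∈ S} x_i² P_i = P ∑_{i ∈ S} x_i - (m + 2) R - ∑_{j ∈ B}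
R_j has small first and last terms on the right (P_i is P's partial derivative, R_j the degree κ + 2
function without x_j). So q cannot be large and positive, and ∑_{i ∈ S} x_i² P_i / P is close to -(m
+ 2) q.

Two cases. If |q| ≤ η, the gradient of R is small relative to F and Young's inequality concludes
(`leading_sq_le_of_abs_le`). If q = -Q with Q ≥ η, convexity gives ξ_o² ≤ (1 - Q) u² + y²/Q, so (1 -
ε) y² ≤ Q (M + (1 - ε) F/P) is enough. This follows by differentiating the identity above and
eliminating the derivatives of P_i / P with the Cauchy-Schwarz inequality for the form -q'' against
coordinate vectors. Up to small errors the outcome is |y| ≤ √(Q/2) (√M + √(F/P)), where m + 2 ≥ 2 is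
essential (`weighted_sum_bound`). -/

set_option linter.unusedSectionVars false

namespace HessianConcavity

variable {ι : Type*} [DecidableEq ι]

/-! ### Elementary symmetric functions over a finite index set and their directional derivatives. -/

section Algebra

variable {R : Type*} [CommRing R]

/-- The elementary symmetric function of degree `k` of the variables `x i`, `i ∈ T`. -/
def elem (T : Finset ι) (k : ℕ) (x : ι → R) : R :=
  ∑ s ∈ T.powersetCard k, ∏ i ∈ s, x i

@[simp] lemma elem_zero (T : Finset ι) (x : ι → R) : elem T 0 x = 1 := by
  simp [elem]

lemma elem_insert {T : Finset ι} {i : ι} (hi : i ∉ T) (k : ℕ) (x : ι → R) :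
    elem (insert i T) (k + 1) x = elem T (k + 1) x + x i * elem T k x := by
  unfold elem
  rw [Finset.powersetCard_succ_insert hi, Finset.sum_union, Finset.sum_image, Finset.mul_sum]
  · congr 1
    refine Finset.sum_congr rfl fun s hs => ?_
    rw [Finset.prod_insert]
    exact fun h => hi ((Finset.mem_powersetCard.1 hs).1 h)
  · intro s hs t ht hst
    have h1 : i ∉ s := fun h => hi ((Finset.mem_powersetCard.1 hs).1 h)
    have h2 : i ∉ t := fun h => hi ((Finset.mem_powersetCard.1 ht).1 h)
    rw [← Finset.erase_insert h1, hst, Finset.erase_insert h2]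
  · rw [Finset.disjoint_left]
    intro s hs hs'
    obtain ⟨t, -, rfl⟩ := Finset.mem_image.1 hs'
    exact hi ((Finset.mem_powersetCard.1 hs).1 (Finset.mem_insert_self _ _))

lemma elem_erase {T : Finset ι} {i : ι} (hi : i ∈ T) (k : ℕ) (x : ι → R) :
    elem T (k + 1) x = elem (T.erase i) (k + 1) x + x i * elem (T.erase i) k x := by
  conv_lhs => rw [← Finset.insert_erase hi]
  exact elem_insert (Finset.notMem_erase i T) k x

lemma elem_eq_zero {T : Finset ι} {k : ℕ} (h : T.card < k) (x : ι → R) : elem T k x = 0 := by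
  simp [elem, Finset.powersetCard_eq_empty.2 h]

lemma elem_one (T : Finset ι) (x : ι → R) : elem T 1 x = ∑ i ∈ T, x i := by
  simp [elem, Finset.powersetCard_one]

lemma elem_congr {T : Finset ι} {x y : ι → R} (h : ∀ i ∈ T, x i = y i) (k : ℕ) :
    elem T k x = elem T k y :=
  Finset.sum_congr rfl fun _ hs =>
    Finset.prod_congr rfl fun i hi => h i ((Finset.mem_powersetCard.1 hs).1 hi)

lemma elem_smul (T : Finset ι) (k : ℕ) (c : R) (x : ι → R) :
    elem T k (c • x) = c ^ k * elem T k x := by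
  unfold elem
  rw [Finset.mul_sum]
  refine Finset.sum_congr rfl fun s hs => ?_
  simp [Finset.prod_mul_distrib, (Finset.mem_powersetCard.1 hs).2]

lemma sum_elem_erase (T : Finset ι) (k : ℕ) (x : ι → R) :
    ∑ i ∈ T, elem (T.erase i) k x = ((T.card : R) - k) * elem T k x := by
  induction T using Finset.induction_on generalizing k with
  | empty =>
    rcases k with _ | k
    · simp
    · simp [elem_eq_zero (T := (∅ : Finset ι)) (k := k + 1) (by simp)]
  | insert a T ha ih =>
    rw [Finset.sum_insert ha, Finset.erase_insert ha, Finset.card_insert_of_notMem ha]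
    rcases k with _ | k
    · simp; ring
    · have : ∀ i ∈ T, elem ((insert a T).erase i) (k + 1) x =
          elem (T.erase i) (k + 1) x + x a * elem (T.erase i) k x := by
        intro i hi
        have hai : a ≠ i := fun h => ha (h ▸ hi)
        rw [Finset.erase_insert_of_ne hai, elem_insert]
        exact fun h => ha (Finset.mem_of_mem_erase h)
      rw [Finset.sum_congr rfl this, Finset.sum_add_distrib, ← Finset.mul_sum, ih, ih,
        elem_insert ha]
      push_cast
      ring

/-- Euler's relation for a homogeneous polynomial of degree `k + 1`. -/
lemma sum_mul_elem_erase (T : Finset ι) (k : ℕ) (x : ι → R) :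
    ∑ i ∈ T, x i * elem (T.erase i) k x = (k + 1) * elem T (k + 1) x := by
  have h : ∀ i ∈ T, x i * elem (T.erase i) k x = elem T (k + 1) x - elem (T.erase i) (k + 1) x :=
    fun i hi => by rw [elem_erase hi]; ring
  rw [Finset.sum_congr rfl h, Finset.sum_sub_distrib, sum_elem_erase]
  simp
  ring

lemma elem_union {S T : Finset ι} (h : Disjoint S T) (k : ℕ) (x : ι → R) :
    elem (S ∪ T) k x = ∑ p ∈ Finset.HasAntidiagonal.antidiagonal k, elem S p.1 x * elem T p.2 x := by
  induction S using Finset.induction_on generalizing k with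
  | empty =>
    rw [Finset.empty_union, Finset.sum_eq_single (0, k)]
    · simp
    · rintro ⟨a, b⟩ hp hne
      have : a ≠ 0 := by
        rintro rfl
        simp at hp
        exact hne (by simp [hp])
      rw [elem_eq_zero (T := (∅ : Finset ι)) (by simpa using Nat.pos_of_ne_zero this), zero_mul]
    · simp
  | insert a S ha ih =>
    rw [Finset.disjoint_insert_left] at h
    rw [Finset.insert_union]
    have haT : a ∉ S ∪ T := by simp [ha, h.1]
    rcases k with _ | k
    · simp
    · rw [elem_insert haT, ih h.2, ih h.2, Finset.Nat.sum_antidiagonal_succ,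
        Finset.Nat.sum_antidiagonal_succ]
      simp only [elem_zero, elem_insert ha, add_mul, Finset.sum_add_distrib, Finset.mul_sum]
      rw [add_assoc]
      congr 2
      exact Finset.sum_congr rfl fun p _ => by ring

/-- The first derivative of `elem T k` at `x` in the direction `y`. -/
def elemD (T : Finset ι) : ℕ → (ι → R) → (ι → R) → R
  | 0, _, _ => 0
  | k + 1, x, y => ∑ i ∈ T, y i * elem (T.erase i) k x

/-- The second derivative of `elem T k` at `x` in the direction `(y, y)`. -/
def elemDD (T : Finset ι) : ℕ → (ι → R) → (ι → R) → R
  | 0, _, _ => 0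
  | k + 1, x, y => ∑ i ∈ T, y i * elemD (T.erase i) k x y

@[simp] lemma elemD_zero (T : Finset ι) (x y : ι → R) : elemD T 0 x y = 0 := rfl

lemma elemD_succ (T : Finset ι) (k : ℕ) (x y : ι → R) :
    elemD T (k + 1) x y = ∑ i ∈ T, y i * elem (T.erase i) k x := rfl

@[simp] lemma elemDD_zero (T : Finset ι) (x y : ι → R) : elemDD T 0 x y = 0 := rfl

lemma elemDD_succ (T : Finset ι) (k : ℕ) (x y : ι → R) :
    elemDD T (k + 1) x y = ∑ i ∈ T, y i * elemD (T.erase i) k x y := rfl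

lemma elemD_erase {T : Finset ι} {i : ι} (hi : i ∈ T) (k : ℕ) (x y : ι → R) :
    elemD T (k + 1) x y = elemD (T.erase i) (k + 1) x y + x i * elemD (T.erase i) k x y
      + y i * elem (T.erase i) k x := by
  rw [elemD_succ, elemD_succ, ← Finset.add_sum_erase _ _ hi]
  rcases k with _ | k
  · simp; ring
  · have : ∀ j ∈ T.erase i, y j * elem (T.erase j) (k + 1) x =
        y j * elem ((T.erase i).erase j) (k + 1) x
          + x i * (y j * elem ((T.erase i).erase j) k x) := by
      intro j hj
      have : i ∈ T.erase j := Finset.mem_erase.2 ⟨(Finset.ne_of_mem_erase hj).symm, hi⟩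
      rw [elem_erase this, Finset.erase_right_comm]
      ring
    rw [Finset.sum_congr rfl this, Finset.sum_add_distrib, ← Finset.mul_sum, elemD_succ]
    ring

lemma elemDD_erase {T : Finset ι} {i : ι} (hi : i ∈ T) (k : ℕ) (x y : ι → R) :
    elemDD T (k + 1) x y = elemDD (T.erase i) (k + 1) x y + x i * elemDD (T.erase i) k x y
      + 2 * y i * elemD (T.erase i) k x y := by
  rw [elemDD_succ, elemDD_succ, ← Finset.add_sum_erase _ _ hi]
  rcases k with _ | k
  · simp
  · have : ∀ j ∈ T.erase i, y j * elemD (T.erase j) (k + 1) x y =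
        y j * elemD ((T.erase i).erase j) (k + 1) x y
          + x i * (y j * elemD ((T.erase i).erase j) k x y)
          + y i * (y j * elem ((T.erase i).erase j) k x) := by
      intro j hj
      have : i ∈ T.erase j := Finset.mem_erase.2 ⟨(Finset.ne_of_mem_erase hj).symm, hi⟩
      rw [elemD_erase this, Finset.erase_right_comm]
      ring
    rw [Finset.sum_congr rfl this, Finset.sum_add_distrib, Finset.sum_add_distrib,
      ← Finset.mul_sum, ← Finset.mul_sum, ← elemDD_succ, ← elemDD_succ, ← elemD_succ]
    ring

lemma elemD_congr {T : Finset ι} {x y y' : ι → R} (h : ∀ i ∈ T, y i = y' i) (k : ℕ) :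
    elemD T k x y = elemD T k x y' := by
  rcases k with _ | k
  · rfl
  · exact Finset.sum_congr rfl fun i hi => by rw [h i hi]

lemma elemDD_congr {T : Finset ι} {x y y' : ι → R} (h : ∀ i ∈ T, y i = y' i) (k : ℕ) :
    elemDD T k x y = elemDD T k x y' := by
  rcases k with _ | k
  · rfl
  · refine Finset.sum_congr rfl fun i hi => ?_
    rw [h i hi, elemD_congr fun j hj => h j (Finset.mem_of_mem_erase hj)]

end Algebra

/-! ### Newton's inequality from real-rootedness. -/

section Newton

open Polynomial

/-- Rolle's theorem: the derivative has at least (number of roots) - 1 real roots, counted with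
multiplicity, and its degree allows no more. -/
lemma splits_derivative_real {p : ℝ[X]} (hp : p.Splits) : (derivative p).Splits := by
  by_cases h0 : derivative p = 0
  · simp [h0]
  rw [splits_iff_card_roots]
  have h1 := card_roots_le_derivative p
  rw [splits_iff_card_roots.1 hp] at h1
  have h2 := card_roots' (derivative p)
  have h3 := natDegree_derivative_le p
  have h4 : p.natDegree ≠ 0 := fun h => h0 (derivative_of_natDegree_zero h)
  omega

/-- Induction on the roots: for q = (X - a) r one has q'² - q q'' = r² + (x - a)² (r'² - r r''). -/
lemma laguerre_inequality {p : ℝ[X]} (hp : p.Splits) (x : ℝ) :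
    0 ≤ (derivative p).eval x ^ 2 - p.eval x * (derivative (derivative p)).eval x := by
  have key : ∀ s : Multiset ℝ, ∀ c : ℝ, ∀ q : ℝ[X], q = C c * (s.map fun a => X - C a).prod →
      0 ≤ (derivative q).eval x ^ 2 - q.eval x * (derivative (derivative q)).eval x := by
    intro s c
    induction s using Multiset.induction_on with
    | empty => rintro q rfl; simp
    | cons a s ih =>
      rintro q rfl
      have := ih _ rfl
      set r := C c * (s.map fun a => X - C a).prod with hr
      have h : C c * ((a ::ₘ s).map fun a => X - C a).prod = (X - C a) * r := by
        rw [hr]; simp; ring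
      rw [h]
      simp only [derivative_mul, derivative_sub, derivative_X, derivative_C, eval_add, eval_mul,
        eval_sub, eval_X, eval_C, map_add, sub_zero, one_mul]
      nlinarith [sq_nonneg (eval x r), mul_nonneg (sq_nonneg (x - a)) this]
  exact key p.roots p.leadingCoeff p hp.eq_prod_roots

lemma coeff_prod_one_add (T : Finset ι) (x : ι → ℝ) (k : ℕ) :
    (∏ i ∈ T, (1 + C (x i) * X)).coeff k = elem T k x := by
  induction T using Finset.induction_on generalizing k with
  | empty =>
    rcases k with _ | k
    · simp
    · rw [elem_eq_zero (by simp)]; simp [coeff_one]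
  | insert a T ha ih =>
    rw [Finset.prod_insert ha, add_mul, one_mul, coeff_add, ih, mul_assoc, coeff_C_mul]
    rcases k with _ | k
    · simp
    · rw [coeff_X_mul, ih, elem_insert ha]

/-- The product of the factors 1 + x_i X has only real roots, and so have all its derivatives.
Laguerre's inequality for the k-th derivative at 0 compares three consecutive coefficients. -/
lemma elem_newton (T : Finset ι) (x : ι → ℝ) (k : ℕ) :
    elem T k x * elem T (k + 2) x ≤ elem T (k + 1) x ^ 2 := by
  set p : ℝ[X] := ∏ i ∈ T, (1 + C (x i) * X) with hp
  have hs : p.Splits := by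
    refine Splits.prod fun i _ => ?_
    refine Splits.of_natDegree_le_one ?_
    compute_degree
  have hk : ∀ j, (derivative^[j] p).Splits := by
    intro j
    induction j with
    | zero => exact hs
    | succ j ih => rw [Function.iterate_succ_apply']; exact splits_derivative_real ih
  have h := laguerre_inequality (hk k) 0
  rw [← Function.iterate_succ_apply' derivative, ← Function.iterate_succ_apply' derivative,
    ← coeff_zero_eq_eval_zero, ← coeff_zero_eq_eval_zero, ← coeff_zero_eq_eval_zero,
    coeff_iterate_derivative, coeff_iterate_derivative, coeff_iterate_derivative] at h
  simp only [zero_add, Nat.descFactorial_self, coeff_prod_one_add, nsmul_eq_mul, hp,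
    Nat.factorial_succ] at h
  push_cast at h
  have hf : (0 : ℝ) < k.factorial := by exact_mod_cast k.factorial_pos
  have hk0 : (0 : ℝ) ≤ k := k.cast_nonneg
  -- Dividing by k!² (k + 1) leaves a slightly sharper inequality, with weights k + 1 and k + 2; the
  -- unweighted form is enough below.
  have h2 : 0 ≤ ((k : ℝ) + 1) * elem T (k + 1) x ^ 2
      - (k + 2) * (elem T k x * elem T (k + 2) x) := by
    have : (0 : ℝ) < (k.factorial : ℝ) ^ 2 * (k + 1) := by positivity
    refine nonneg_of_mul_nonneg_right (a := (k.factorial : ℝ) ^ 2 * (k + 1)) ?_ this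
    calc (0 : ℝ) ≤ _ := h
      _ = _ := by ring
  rcases le_or_gt (elem T k x * elem T (k + 2) x) 0 with h3 | h3
  · exact h3.trans (sq_nonneg _)
  · nlinarith

end Newton

/-! ### The Gårding cone and concavity of quotients of symmetric functions. -/

/-- The Gårding cone of degree `k` in the variables `x i`, `i ∈ T`. -/
def InGarding (T : Finset ι) (k : ℕ) (x : ι → ℝ) : Prop :=
  ∀ j ≤ k, 0 < elem T j x

lemma InGarding.mono {T : Finset ι} {k l : ℕ} {x : ι → ℝ} (h : InGarding T k x) (hl : l ≤ k) :
    InGarding T l x := fun j hj => h j (hj.trans hl)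

lemma inGarding_zero (T : Finset ι) (x : ι → ℝ) : InGarding T 0 x := by
  intro j hj
  obtain rfl : j = 0 := by omega
  simp

/-- Write e_j for the functions without x_i. If e_{j+1} ≤ 0 < e_j, positivity on `T` in degrees j +
1 and j + 2 gives x_i e_j > -e_{j+1} and e_{j+2} > -x_i e_{j+1}. Hence e_j e_{j+2} > e_{j+1}²,
against Newton. -/
lemma InGarding.erase {T : Finset ι} {k : ℕ} {x : ι → ℝ} (h : InGarding T (k + 1) x) {i : ι}
    (hi : i ∈ T) : InGarding (T.erase i) k x := by
  intro j
  induction j with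
  | zero => intro _; simp
  | succ j ih =>
    intro hj
    have h0 := ih (by omega)
    have h1 := h (j + 1) (by omega)
    have h2 := h (j + 2) (by omega)
    rw [elem_erase hi] at h1 h2
    have hn := elem_newton (T.erase i) x j
    by_contra hc
    push Not at hc
    have h2' : 0 < elem (T.erase i) (j + 2) x + x i * elem (T.erase i) (j + 1) x := h2
    nlinarith [mul_nonneg_of_nonpos_of_nonpos hc (le_refl (0 : ℝ)), mul_pos h0 h2',
      mul_nonneg (neg_nonneg.2 hc) h1.le]

lemma elem_erase_pos {T : Finset ι} {k : ℕ} {x : ι → ℝ} (h : InGarding T (k + 1) x) {i : ι}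
    (hi : i ∈ T) : 0 < elem (T.erase i) k x := h.erase hi k le_rfl

lemma add_sq_div_add_le {a b c d : ℝ} (hc : 0 < c) (hd : 0 < d) :
    (a + b) ^ 2 / (c + d) ≤ a ^ 2 / c + b ^ 2 / d := by
  rw [div_add_div _ _ hc.ne' hd.ne', div_le_div_iff₀ (by positivity) (by positivity)]
  nlinarith [mul_nonneg hc.le hd.le, sq_nonneg (a * d - b * c)]

/-- Marcus and Lopes: `elem (k + 1) / elem k` in terms of the same quotients with one variable
removed. -/
lemma elem_quotient_eq {T : Finset ι} {k : ℕ} {x : ι → ℝ} (h : InGarding T (k + 1) x) :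
    ((k : ℝ) + 2) * (elem T (k + 2) x / elem T (k + 1) x) =
      ∑ i ∈ T, (x i - x i ^ 2 / (x i + elem (T.erase i) (k + 1) x / elem (T.erase i) k x)) := by
  have hP := h (k + 1) le_rfl
  have key : ∀ i ∈ T,
      x i - x i ^ 2 / (x i + elem (T.erase i) (k + 1) x / elem (T.erase i) k x) =
        x i * elem (T.erase i) (k + 1) x / elem T (k + 1) x := by
    intro i hi
    have h1 := elem_erase_pos h hi
    have h2 := elem_erase hi k x
    have h3 : x i + elem (T.erase i) (k + 1) x / elem (T.erase i) k x =
        elem T (k + 1) x / elem (T.erase i) k x := by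
      rw [h2]; field_simp; ring
    rw [h3]
    field_simp
    rw [h2]; ring
  rw [Finset.sum_congr rfl key, ← Finset.sum_div, sum_mul_elem_erase]
  push_cast
  ring

/-- Superadditivity of `elem (k + 1) / elem k` on the Gårding cone of degree `k`. -/
lemma elem_quotient_superadditive (k : ℕ) : ∀ (T : Finset ι) (x y : ι → ℝ),
    InGarding T k x → InGarding T k y → InGarding T k (x + y) ∧
      elem T (k + 1) x / elem T k x + elem T (k + 1) y / elem T k y ≤
        elem T (k + 1) (x + y) / elem T k (x + y) := by
  induction k with
  | zero =>
    intro T x y _ _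
    refine ⟨inGarding_zero T _, ?_⟩
    simp [elem_one, Finset.sum_add_distrib]
  | succ k ih =>
    intro T x y hx hy
    have hxy : InGarding T (k + 1) (x + y) := by
      obtain ⟨h1, h2⟩ := ih T x y (hx.mono (by omega)) (hy.mono (by omega))
      intro j hj
      rcases Nat.lt_or_ge j (k + 1) with hj' | hj'
      · exact h1 j (by omega)
      · obtain rfl : j = k + 1 := by omega
        -- Convexity of the cone comes along with the induction: superadditivity one degree lower
        -- gives positivity in the top degree.
        have h3 : 0 < elem T (k + 1) (x + y) / elem T k (x + y) :=
          lt_of_lt_of_le (add_pos (div_pos (hx _ le_rfl) (hx k (by omega)))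
            (div_pos (hy _ le_rfl) (hy k (by omega)))) h2
        exact (div_pos_iff_of_pos_right (h1 k le_rfl)).1 h3
    refine ⟨hxy, ?_⟩
    have hk : (0 : ℝ) < (k : ℝ) + 2 := by positivity
    refine le_of_mul_le_mul_left ?_ hk
    -- The quotient is now a sum of terms x_i - x_i² / (x_i + q_i), with q_i of one degree less. The
    -- function a²/c is subadditive in (a, c) and decreasing in c, and q_i is superadditive by
    -- induction.
    rw [mul_add, elem_quotient_eq hx, elem_quotient_eq hy, elem_quotient_eq hxy,
      ← Finset.sum_add_distrib]
    refine Finset.sum_le_sum fun i hi => ?_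
    have hm : ∀ z : ι → ℝ, InGarding T (k + 1) z →
        0 < z i + elem (T.erase i) (k + 1) z / elem (T.erase i) k z := by
      intro z hz
      have h1 := elem_erase_pos hz hi
      have h2 := hz (k + 1) le_rfl
      rw [elem_erase hi] at h2
      have : z i + elem (T.erase i) (k + 1) z / elem (T.erase i) k z =
        (elem (T.erase i) (k + 1) z + z i * elem (T.erase i) k z) / elem (T.erase i) k z := by
          field_simp; ring
      rw [this]
      positivity
    have hsup := (ih (T.erase i) x y (hx.erase hi) (hy.erase hi)).2
    have h1 := add_sq_div_add_le (a := x i) (b := y i) (hm x hx) (hm y hy)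
    have h2 : (x i + y i) ^ 2 / (x i + y i + elem (T.erase i) (k + 1) (x + y) /
          elem (T.erase i) k (x + y)) ≤
        (x i + y i) ^ 2 / (x i + elem (T.erase i) (k + 1) x / elem (T.erase i) k x +
          (y i + elem (T.erase i) (k + 1) y / elem (T.erase i) k y)) :=
      div_le_div_of_nonneg_left (sq_nonneg _) (add_pos (hm x hx) (hm y hy)) (by linarith)
    simp only [Pi.add_apply]
    linarith

/-! ### Second-order consequences: concavity of the quotient and of the logarithm. -/

lemma hasDerivAt_elem (T : Finset ι) (k : ℕ) (x y : ι → ℝ) (t : ℝ) :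
    HasDerivAt (fun t => elem T k (x + t • y)) (elemD T k (x + t • y) y) t := by
  induction T using Finset.induction_on generalizing k with
  | empty =>
    rcases k with _ | k
    · simpa using hasDerivAt_const t (1 : ℝ)
    · have : (fun t : ℝ => elem (∅ : Finset ι) (k + 1) (x + t • y)) = fun _ => 0 := by
        funext t; exact elem_eq_zero (by simp) _
      rw [this]
      simpa [elemD_succ] using hasDerivAt_const t (0 : ℝ)
  | insert a T ha ih =>
    rcases k with _ | k
    · simpa using hasDerivAt_const t (1 : ℝ)
    · have h : HasDerivAt (fun t : ℝ => x a + t * y a) (y a) t := by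
        simpa using ((hasDerivAt_id t).mul_const (y a)).const_add (x a)
      have h2 := (ih (k + 1)).add (h.mul (ih k))
      refine (h2.congr_deriv ?_).congr_of_eventuallyEq (Filter.Eventually.of_forall fun s => ?_)
      · rw [elemD_erase (Finset.mem_insert_self a T), Finset.erase_insert ha]
        simp
        ring
      · simp [elem_insert ha]

lemma hasDerivAt_elemD (T : Finset ι) (k : ℕ) (x y : ι → ℝ) (t : ℝ) :
    HasDerivAt (fun t => elemD T k (x + t • y) y) (elemDD T k (x + t • y) y) t := by
  rcases k with _ | k
  · simpa using hasDerivAt_const t (0 : ℝ)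
  · simp only [elemD_succ, elemDD_succ]
    exact HasDerivAt.fun_sum fun i _ => (hasDerivAt_elem (T.erase i) k x y t).const_mul (y i)

lemma eventually_inGarding {T : Finset ι} {k : ℕ} {x : ι → ℝ} (h : InGarding T k x) (y : ι → ℝ) :
    ∀ᶠ t in 𝓝 (0 : ℝ), InGarding T k (x + t • y) := by
  have : ∀ᶠ t in 𝓝 (0 : ℝ), ∀ j ∈ Finset.range (k + 1), 0 < elem T j (x + t • y) := by
    rw [Filter.eventually_all_finset]
    intro j hj
    have hc := (hasDerivAt_elem T j x y 0).continuousAt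
    refine hc.eventually (lt_mem_nhds ?_)
    simpa using h j (by simpa [Nat.lt_succ_iff] using hj)
  filter_upwards [this] with t ht j hj
  exact ht j (by simp; omega)

/-- Were φ'' positive, the even function φ(t) + φ(-t) would have a local minimum at 0 by the second
derivative test. The hypothesis makes 0 a local maximum as well, so the function is locally
constant, which contradicts 2 φ'' > 0. -/
lemma deriv_deriv_nonpos_of_isLocalMax_zero {φ φ' : ℝ → ℝ} {φ'' : ℝ}
    (h1 : ∀ᶠ t in 𝓝 0, HasDerivAt φ (φ' t) t) (h2 : HasDerivAt φ' φ'' 0)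
    (h : ∀ᶠ t in 𝓝 0, φ t + φ (-t) ≤ 2 * φ 0) : φ'' ≤ 0 := by
  by_contra hpos
  push Not at hpos
  set ψ : ℝ → ℝ := fun t => φ t + φ (-t) with hψ
  have hneg : Filter.Tendsto (fun t : ℝ => -t) (𝓝 0) (𝓝 0) := by
    simpa using (continuous_neg (G := ℝ)).tendsto 0
  have d1 : ∀ᶠ t in 𝓝 0, HasDerivAt ψ (φ' t - φ' (-t)) t := by
    filter_upwards [h1, hneg.eventually h1] with t ht ht'
    have := ht.add (ht'.comp t (hasDerivAt_neg t))
    exact this.congr_deriv (by ring)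
  have d2 : HasDerivAt (fun t => φ' t - φ' (-t)) (2 * φ'') 0 := by
    have h2' : HasDerivAt φ' φ'' (-0) := by simpa using h2
    have := h2.sub (h2'.comp 0 (hasDerivAt_neg 0))
    exact this.congr_deriv (by ring)
  have e1 : deriv ψ =ᶠ[𝓝 0] fun t => φ' t - φ' (-t) := by
    filter_upwards [d1] with t ht using ht.deriv
  have hmin : IsLocalMin ψ 0 := by
    refine isLocalMin_of_deriv_deriv_pos ?_ ?_ d1.self_of_nhds.continuousAt
    · rw [(d2.congr_of_eventuallyEq e1).deriv]; linarith
    · rw [e1.self_of_nhds]; simp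
  have hconst : ψ =ᶠ[𝓝 0] fun _ => ψ 0 := by
    filter_upwards [hmin, h] with t ht ht'
    refine le_antisymm ?_ ht
    simp only [hψ, neg_zero]; linarith
  have e3 : deriv ψ =ᶠ[𝓝 0] fun _ => 0 := by
    have := hconst.deriv
    simpa using this
  have : HasDerivAt (fun _ : ℝ => (0 : ℝ)) (2 * φ'') 0 := d2.congr_of_eventuallyEq (e3.symm.trans e1)
  have := this.unique (hasDerivAt_const 0 0)
  linarith

/-- The negative of the second derivative of `elem (k + 1) / elem k` in the direction `(y, y)`. -/
noncomputable def quotientForm (T : Finset ι) (k : ℕ) (x y : ι → ℝ) : ℝ :=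
  -(elemDD T (k + 1) x y / elem T k x
    - 2 * elemD T (k + 1) x y * elemD T k x y / elem T k x ^ 2
    - elem T (k + 1) x * elemDD T k x y / elem T k x ^ 2
    + 2 * elem T (k + 1) x * elemD T k x y ^ 2 / elem T k x ^ 3)

/-- The quotient is homogeneous of degree one, so superadditivity gives q(x + ty) + q(x - ty) ≤
q(2x) = 2 q(x), and the second derivative at t = 0 is nonpositive. -/
lemma quotientForm_nonneg {T : Finset ι} {k : ℕ} {x : ι → ℝ} (h : InGarding T k x) (y : ι → ℝ) :
    0 ≤ quotientForm T k x y := by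
  have hev := eventually_inGarding h y
  have hneg : Filter.Tendsto (fun t : ℝ => -t) (𝓝 0) (𝓝 0) := by
    simpa using (continuous_neg (G := ℝ)).tendsto 0
  have hP := (h k le_rfl).ne'
  rw [quotientForm, neg_nonneg]
  refine deriv_deriv_nonpos_of_isLocalMax_zero
    (φ := fun t => elem T (k + 1) (x + t • y) / elem T k (x + t • y))
    (φ' := fun t => (elemD T (k + 1) (x + t • y) y * elem T k (x + t • y)
      - elem T (k + 1) (x + t • y) * elemD T k (x + t • y) y) / elem T k (x + t • y) ^ 2)
    ?_ ?_ ?_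
  · filter_upwards [hev] with t ht
    exact (hasDerivAt_elem T (k + 1) x y t).div (hasDerivAt_elem T k x y t) (ht k le_rfl).ne'
  · have a1 := hasDerivAt_elem T (k + 1) x y 0
    have a2 := hasDerivAt_elem T k x y 0
    have b1 := hasDerivAt_elemD T (k + 1) x y 0
    have b2 := hasDerivAt_elemD T k x y 0
    have := ((b1.mul a2).sub (a1.mul b2)).div (a2.pow 2) (by simpa using hP)
    refine this.congr_deriv ?_
    simp
    field_simp
    ring
  · filter_upwards [hev, hneg.eventually hev] with t h1 h2
    have h3 := (elem_quotient_superadditive k T _ _ h1 h2).2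
    have h4 : x + t • y + (x + -t • y) = (2 : ℝ) • x := by
      ext i; simp; ring
    rw [h4, elem_smul, elem_smul] at h3
    refine h3.trans (le_of_eq ?_)
    simp
    field_simp
    ring

/-- Concavity of the logarithm of `elem T k` on the Gårding cone. -/
lemma elem_mul_elemDD_le {T : Finset ι} {k : ℕ} {x : ι → ℝ} (h : InGarding T k x) (y : ι → ℝ) :
    elem T k x * elemDD T k x y ≤ elemD T k x y ^ 2 := by
  induction k with
  | zero => simp
  | succ k ih =>
    have h1 := ih (h.mono (by omega))
    have hG := h k (by omega)
    have hF := h (k + 1) le_rfl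
    have hM := quotientForm_nonneg (h.mono (Nat.le_succ k)) y
    rw [quotientForm] at hM
    set G := elem T k x
    set F := elem T (k + 1) x
    set G' := elemD T k x y
    set F' := elemD T (k + 1) x y
    set G2 := elemDD T k x y
    set F2 := elemDD T (k + 1) x y
    have hM2 : 0 ≤ -(F2 * G ^ 2 - 2 * F' * G' * G - F * G2 * G + 2 * F * G' ^ 2) := by
      have := mul_nonneg hM (pow_pos hG 3).le
      refine this.trans (le_of_eq ?_)
      field_simp
    -- This is -(log F)'' = -(log (F/G))'' - (log G)'' with denominators cleared: the square and the
    -- second term come from the concave positive quotient F/G, the last from the induction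
    -- hypothesis for G.
    have key : G ^ 2 * (F' ^ 2 - F * F2) = (F' * G - F * G') ^ 2
        + F * -(F2 * G ^ 2 - 2 * F' * G' * G - F * G2 * G + 2 * F * G' ^ 2)
        + F ^ 2 * (G' ^ 2 - G * G2) := by ring
    have : 0 ≤ G ^ 2 * (F' ^ 2 - F * F2) := by
      rw [key]
      have := mul_nonneg hF.le hM2
      have := mul_nonneg (sq_nonneg F) (sub_nonneg.2 h1)
      positivity
    have := nonneg_of_mul_nonneg_right this (pow_pos hG 2)
    linarith

lemma elemD_add_single {T : Finset ι} {i : ι} (hi : i ∈ T) (k : ℕ) (x y : ι → ℝ) (s : ℝ) :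
    elemD T (k + 1) x (y + s • Pi.single i 1) =
      elemD T (k + 1) x y + s * elem (T.erase i) k x := by
  have h : ∀ j ∈ T.erase i, (y + s • Pi.single i (1 : ℝ) : ι → ℝ) j = y j := by
    intro j hj
    simp [Finset.ne_of_mem_erase hj]
  rw [elemD_erase hi, elemD_erase hi, elemD_congr h, elemD_congr h]
  simp
  ring

lemma elemDD_add_single {T : Finset ι} {i : ι} (hi : i ∈ T) (k : ℕ) (x y : ι → ℝ) (s : ℝ) :
    elemDD T (k + 1) x (y + s • Pi.single i 1) =
      elemDD T (k + 1) x y + 2 * s * elemD (T.erase i) k x y := by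
  have h : ∀ j ∈ T.erase i, (y + s • Pi.single i (1 : ℝ) : ι → ℝ) j = y j := by
    intro j hj
    simp [Finset.ne_of_mem_erase hj]
  rw [elemDD_erase hi, elemDD_erase hi, elemD_congr h, elemDD_congr h, elemDD_congr h]
  simp
  ring

lemma sq_le_mul_of_quadratic_nonneg {a b c : ℝ} (h : ∀ s : ℝ, 0 ≤ a * (s * s) + 2 * b * s + c) :
    b ^ 2 ≤ a * c := by
  have := discrim_le_zero h
  rw [discrim] at this
  nlinarith

/-- The derivative of `elem (T.erase i) k / elem T (k + 1)` in the direction `y`. -/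
noncomputable def ratioD (T : Finset ι) (k : ℕ) (x y : ι → ℝ) (i : ι) : ℝ :=
  (elemD (T.erase i) k x y * elem T (k + 1) x - elem (T.erase i) k x * elemD T (k + 1) x y)
    / elem T (k + 1) x ^ 2

/-- The derivative of `elem T (k + 1) / elem T k` in the direction `y`. -/
noncomputable def quotientD (T : Finset ι) (k : ℕ) (x y : ι → ℝ) : ℝ :=
  (elemD T (k + 1) x y * elem T k x - elem T (k + 1) x * elemD T k x y) / elem T k x ^ 2

/-- The Cauchy-Schwarz inequality for `quotientForm` and a coordinate direction. -/
lemma quotientForm_cauchy_schwarz {T : Finset ι} {k : ℕ} {x : ι → ℝ} (h : InGarding T (k + 1) x)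
    (y : ι → ℝ) {i : ι} (hi : i ∈ T) :
    ((y i + quotientD T (k + 1) x y) * (elem (T.erase i) k x / elem T (k + 1) x)
      + (x i + elem T (k + 2) x / elem T (k + 1) x) * ratioD T k x y i) ^ 2 ≤
    2 * (1 - (x i + elem T (k + 2) x / elem T (k + 1) x)
        * (elem (T.erase i) k x / elem T (k + 1) x))
      * (elem (T.erase i) k x / elem T (k + 1) x) * quotientForm T (k + 1) x y := by
  have hP := (h (k + 1) le_rfl).ne'
  -- Put q = R/P and p_i = P_i/P. Then ∂_i q = 1 - (x_i + q) p_i. Since P and R are affine in x_i,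
  -- the diagonal entry of -q'' is 2 (∂_i q) p_i, and its mixed entry with `y` is the derivative of
  -- (x_i + q) p_i along `y`.
  refine (le_of_eq ?_).trans (sq_le_mul_of_quadratic_nonneg (a := 2 *
    (1 - (x i + elem T (k + 2) x / elem T (k + 1) x)
        * (elem (T.erase i) k x / elem T (k + 1) x))
      * (elem (T.erase i) k x / elem T (k + 1) x))
    (b := (y i + quotientD T (k + 1) x y) * (elem (T.erase i) k x / elem T (k + 1) x)
      + (x i + elem T (k + 2) x / elem T (k + 1) x) * ratioD T k x y i) fun s => ?_)
  · rfl
  · refine (quotientForm_nonneg h (y + s • Pi.single i 1)).trans (le_of_eq ?_)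
    have e1 := elemD_erase hi k x y
    have e2 := elem_erase hi k x
    rw [quotientForm, quotientForm, elemD_add_single hi, elemD_add_single hi,
      elemDD_add_single hi, elemDD_add_single hi, quotientD, ratioD]
    rw [show k + 1 + 1 = k + 2 from rfl]
    set P := elem T (k + 1) x
    set P' := elemD T (k + 1) x y
    have e1' : elemD (T.erase i) (k + 1) x y =
      P' - x i * elemD (T.erase i) k x y - y i * elem (T.erase i) k x := by rw [e1]; ring
    have e2' : elem (T.erase i) (k + 1) x = P - x i * elem (T.erase i) k x := by rw [e2]; ring
    rw [e1', e2']
    field_simp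
    ring

/-- A lower bound for the second derivative of `log elem`, in terms of the expansion with respect
to a variable equal to one. -/
lemma elem_log_form_ge {T : Finset ι} {o : ι} (ho : o ∉ T) {k : ℕ} {x : ι → ℝ} (hx : x o = 1)
    (hP : InGarding T (k + 1) x) (hf : 0 < elem (insert o T) (k + 2) x) (y : ι → ℝ) :
    elem (insert o T) (k + 2) x *
        (elemD (insert o T) (k + 2) x y / elem (insert o T) (k + 2) x
          - elemD T (k + 1) x y / elem T (k + 1) x) ^ 2
      + elem T (k + 1) x * quotientForm T (k + 1) x y ≤
    -elemDD (insert o T) (k + 2) x y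
      + elemD (insert o T) (k + 2) x y ^ 2 / elem (insert o T) (k + 2) x := by
  have hP0 := hP (k + 1) le_rfl
  have e0 := elem_insert ho (k + 1) x
  have e1 := elemD_erase (Finset.mem_insert_self o T) (k + 1) x y
  have e2 := elemDD_erase (Finset.mem_insert_self o T) (k + 1) x y
  rw [Finset.erase_insert ho, hx] at e1 e2
  rw [hx] at e0
  have hlog := elem_mul_elemDD_le hP y
  rw [show k + 1 + 1 = k + 2 from rfl] at e0 e1 e2
  rw [e0] at hf ⊢
  rw [e1, e2, quotientForm, show k + 1 + 1 = k + 2 from rfl]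
  set P := elem T (k + 1) x
  set R := elem T (k + 2) x
  set P' := elemD T (k + 1) x y
  set R' := elemD T (k + 2) x y
  set P2 := elemDD T (k + 1) x y
  set R2 := elemDD T (k + 2) x y
  rw [one_mul] at hf
  have hf' : R + 1 * P ≠ 0 := by rw [one_mul]; exact hf.ne'
  have hfac : 0 ≤ (R + P) * ((P' ^ 2 - P * P2) / P ^ 2) :=
    mul_nonneg hf.le (div_nonneg (sub_nonneg.2 hlog) (sq_nonneg _))
  refine le_of_sub_nonneg (hfac.trans (le_of_eq ?_))
  rw [one_mul] at hf'
  simp only [one_mul]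
  field_simp
  ring

/-- The variable with value one in terms of the logarithmic derivatives. -/
lemma direction_eq {T : Finset ι} {o : ι} (ho : o ∉ T) {k : ℕ} {x : ι → ℝ} (hx : x o = 1)
    (hP : 0 < elem T (k + 1) x) (hf : 0 < elem (insert o T) (k + 2) x) (y : ι → ℝ) :
    elem T (k + 1) x * y o = elem (insert o T) (k + 2) x *
        (elemD (insert o T) (k + 2) x y / elem (insert o T) (k + 2) x
          - elemD T (k + 1) x y / elem T (k + 1) x)
      - elem T (k + 1) x * quotientD T (k + 1) x y := by
  have e0 := elem_insert ho (k + 1) x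
  have e1 := elemD_erase (Finset.mem_insert_self o T) (k + 1) x y
  rw [Finset.erase_insert ho, hx] at e1
  rw [hx] at e0
  rw [show k + 1 + 1 = k + 2 from rfl] at e0 e1
  rw [mul_sub, mul_div_cancel₀ _ hf.ne', e0, e1, quotientD, show k + 1 + 1 = k + 2 from rfl]
  field_simp
  ring

lemma sum_mul_sq_le_sum_div_mul_sum {s : Finset ι} {c a w : ι → ℝ} (hw : ∀ i ∈ s, 0 < w i) :
    (∑ i ∈ s, a i * c i) ^ 2 ≤ (∑ i ∈ s, c i ^ 2 / w i) * ∑ i ∈ s, w i * a i ^ 2 := by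
  refine Finset.sum_sq_le_sum_mul_sum_of_sq_le_mul s
    (fun i hi => div_nonneg (sq_nonneg _) (hw i hi).le)
    (fun i hi => mul_nonneg (hw i hi).le (sq_nonneg _)) fun i hi => ?_
  have := (hw i hi).ne'
  exact le_of_eq (by field_simp)

/-! ### The scalar estimate for the derivative of a negative quotient. -/

section RealBounds

variable {s : Finset ι} {x p g η : ι → ℝ} {Q y M F ν m Y Φ : ℝ}

-- Here q = -Q, `y` is its derivative, p_i = ∂_i log P, and `g i` is the derivative of p_i. The
-- hypothesis `hB` is Cauchy-Schwarz for -q'' against coordinate vectors, and `hE` is the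
-- differentiated relation ∑ x_i² p_i ≈ m Q. Weighting the first by x_i² / (Q - x_i) and adding the
-- second removes every `g i` and leaves about 2 m y. The right side is at most m √2 √(QM) + 2
-- √(mQF) up to small errors.
set_option maxHeartbeats 1000000 in
lemma weighted_sum_bound (hQ : 0 < Q) (hν0 : 0 ≤ ν) (hν : ν ≤ 1 / 10) (hm : 2 ≤ m) (hM : 0 ≤ M)
    (hp : ∀ i ∈ s, 0 < p i) (hx : ∀ i ∈ s, |x i| ≤ ν * Q) (hp1 : ∀ i ∈ s, 1 ≤ ν * Q * p i)
    (hB : ∀ i ∈ s, ((η i + y) * p i - (Q - x i) * g i) ^ 2 ≤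
      2 * (1 + (Q - x i) * p i) * p i * M)
    (hY : Y = ∑ i ∈ s, x i ^ 2 * p i) (hYm : |Y - m * Q| ≤ ν * m * Q)
    (hF : ∑ i ∈ s, p i * η i ^ 2 ≤ (1 + ν) * F) (hF0 : 0 ≤ F)
    (hΦ : Φ = ∑ i ∈ s, x i * p i * η i)
    (hE : |∑ i ∈ s, x i ^ 2 * g i + 2 * Φ + m * y| ≤ ν * |y| + ν * (√Q * √F)) :
    |y| ≤ (1 + 10 * ν) * √Q * ((√M + √F) / √2) := by
  have hm0 : 0 < m := by linarith
  have hνν : ν * ν ≤ ν * (1 / 10) := mul_le_mul_of_nonneg_left hν hν0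
  have hνν0 : 0 ≤ ν * ν := mul_nonneg hν0 hν0
  have hmνν : m * (ν * ν) ≤ m * (ν * (1 / 10)) := mul_le_mul_of_nonneg_left hνν hm0.le
  have hmν0 : 0 ≤ m * ν := mul_nonneg hm0.le hν0
  have hmνν0 : 0 ≤ m * (ν * ν) := mul_nonneg hm0.le hνν0
  have hd1 : ∀ i ∈ s, (1 - ν) * Q ≤ Q - x i := fun i hi => by
    have := (abs_le.1 (hx i hi)).2; linarith
  have hd2 : ∀ i ∈ s, Q - x i ≤ (1 + ν) * Q := fun i hi => by
    have := (abs_le.1 (hx i hi)).1; linarith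
  have h1ν : 0 < (1 - ν) * Q := mul_pos (by linarith) hQ
  have hd0 : ∀ i ∈ s, 0 < Q - x i := fun i hi => h1ν.trans_le (hd1 i hi)
  set n := √2 with hn
  have hn2 : n ^ 2 = 2 := Real.sq_sqrt (by norm_num)
  have hn0 : 0 < n := Real.sqrt_pos.2 (by norm_num)
  have hn1 : 1 ≤ n := Real.one_le_sqrt.2 (by norm_num)
  have hmn1 : 1 ≤ m * n := one_le_mul_of_one_le_of_one_le (by linarith) hn1
  set a := √Q * √F with ha
  set b := √Q * √M with hb
  have ha0 : 0 ≤ a := by positivity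
  have hb0 : 0 ≤ b := by positivity
  have ha2 : a ^ 2 = Q * F := by rw [ha, mul_pow, Real.sq_sqrt hQ.le, Real.sq_sqrt hF0]
  have hb2 : b ^ 2 = Q * M := by rw [hb, mul_pow, Real.sq_sqrt hQ.le, Real.sq_sqrt hM]
  set w : ι → ℝ := fun i => x i ^ 2 / (Q - x i) with hw
  have hw0 : ∀ i ∈ s, 0 ≤ w i := fun i hi => div_nonneg (sq_nonneg _) (hd0 i hi).le
  set A := ∑ i ∈ s, w i * p i with hA
  have hYu : Y ≤ (1 + ν) * m * Q := by have := (abs_le.1 hYm).2; linarith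
  have hYl : (1 - ν) * m * Q ≤ Y := by have := (abs_le.1 hYm).1; linarith
  have hY0 : 0 ≤ Y := le_trans (by have : 0 ≤ 1 - ν := by linarith
                                   positivity) hYl
  have hAu : A ≤ m * (1 + 3 * ν) := by
    have h1 : (1 - ν) * Q * A ≤ Y := by
      rw [hY, hA, Finset.mul_sum]
      refine Finset.sum_le_sum fun i hi => ?_
      have h2 : (Q - x i) * (w i * p i) = x i ^ 2 * p i := by
        have := (hd0 i hi).ne'
        simp only [hw]; field_simp
      rw [← h2]
      exact mul_le_mul_of_nonneg_right (hd1 i hi) (mul_nonneg (hw0 i hi) (hp i hi).le)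
    have h2 : (1 - ν) * A ≤ (1 + ν) * m := by
      refine le_of_mul_le_mul_right ?_ hQ
      linarith
    have h3 : (1 + ν) * m ≤ (1 - ν) * (m * (1 + 3 * ν)) := by
      linarith
    exact le_of_mul_le_mul_left (h2.trans h3) (by linarith)
  have hAl : m * (1 - 2 * ν) ≤ A := by
    have h1 : Y ≤ (1 + ν) * Q * A := by
      rw [hY, hA, Finset.mul_sum]
      refine Finset.sum_le_sum fun i hi => ?_
      have h2 : (Q - x i) * (w i * p i) = x i ^ 2 * p i := by
        have := (hd0 i hi).ne'
        simp only [hw]; field_simp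
      rw [← h2]
      exact mul_le_mul_of_nonneg_right (hd2 i hi) (mul_nonneg (hw0 i hi) (hp i hi).le)
    have h2 : (1 - ν) * m ≤ (1 + ν) * A := by
      refine le_of_mul_le_mul_right ?_ hQ
      linarith
    have h3 : (1 + ν) * (m * (1 - 2 * ν)) ≤ (1 - ν) * m := by
      linarith
    exact le_of_mul_le_mul_left (h3.trans h2) (by linarith)
  have hA0 : 0 ≤ A := Finset.sum_nonneg fun i hi => mul_nonneg (hw0 i hi) (hp i hi).le
  set Bf : ι → ℝ := fun i => (η i + y) * p i - (Q - x i) * g i with hBf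
  have hBb : ∀ i ∈ s, |Bf i| ≤ p i * (n * (1 + ν) * b) := by
    intro i hi
    have hpi := (hp i hi).le
    refine abs_le_of_sq_le_sq ?_ (by positivity)
    refine (hB i hi).trans ?_
    have h1 : 1 + (Q - x i) * p i ≤ p i * Q * (1 + 2 * ν) := by
      have := mul_le_mul_of_nonneg_right (hd2 i hi) hpi
      have := hp1 i hi
      linarith
    have h2 : (p i * (n * (1 + ν) * b)) ^ 2 = 2 * (p i * Q * (1 + ν) ^ 2) * p i * M := by
      calc _ = p i ^ 2 * n ^ 2 * (1 + ν) ^ 2 * b ^ 2 := by ring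
        _ = _ := by rw [hn2, hb2]; ring
    rw [h2]
    have h3 : p i * Q * (1 + 2 * ν) ≤ p i * Q * (1 + ν) ^ 2 := by
      have : 0 ≤ p i * Q := by positivity
      exact mul_le_mul_of_nonneg_left (by linarith) this
    gcongr
    exact h1.trans h3
  have hSB : |∑ i ∈ s, w i * Bf i| ≤ A * (n * (1 + ν) * b) := by
    rw [hA, Finset.sum_mul]
    refine (Finset.abs_sum_le_sum_abs _ _).trans (Finset.sum_le_sum fun i hi => ?_)
    rw [abs_mul, abs_of_nonneg (hw0 i hi), mul_assoc]
    exact mul_le_mul_of_nonneg_left (hBb i hi) (hw0 i hi)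
  set G := ∑ i ∈ s, |x i| * p i * |η i| with hG
  -- This is where m ≥ 2 is needed: √m ≤ m/√2 lets the contribution of `F` carry the same constant
  -- as that of `M`. Here `n` is √2.
  have hsm : √m ≤ m * n / 2 := by
    rw [Real.sqrt_le_left (by positivity), div_pow, mul_pow, hn2]
    have := mul_le_mul_of_nonneg_left hm hm0.le
    linarith
  have hGb : G ≤ m * n / 2 * (1 + ν) * a := by
    have h1 : G ^ 2 ≤ Y * ∑ i ∈ s, p i * η i ^ 2 := by
      rw [hG, hY]
      refine Finset.sum_sq_le_sum_mul_sum_of_sq_le_mul s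
        (fun i hi => mul_nonneg (sq_nonneg _) (hp i hi).le)
        (fun i hi => mul_nonneg (hp i hi).le (sq_nonneg _)) fun i hi => le_of_eq ?_
      rw [mul_pow, mul_pow, sq_abs, sq_abs]; ring
    have h2 : G ^ 2 ≤ (√m * (1 + ν) * a) ^ 2 := by
      refine h1.trans ?_
      calc Y * ∑ i ∈ s, p i * η i ^ 2 ≤ ((1 + ν) * m * Q) * ((1 + ν) * F) := by
            refine mul_le_mul hYu hF ?_ (by positivity)
            exact Finset.sum_nonneg fun i hi => mul_nonneg (hp i hi).le (sq_nonneg _)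
        _ = (√m * (1 + ν) * a) ^ 2 := by
            rw [mul_pow, mul_pow, ha2, Real.sq_sqrt hm0.le]; ring
    have h3 := abs_le_of_sq_le_sq h2 (by positivity)
    refine (le_abs_self G).trans (h3.trans ?_)
    gcongr
  have hG0 : 0 ≤ G := Finset.sum_nonneg fun i hi => mul_nonneg
    (mul_nonneg (abs_nonneg _) (hp i hi).le) (abs_nonneg _)
  have hΦG : |Φ| ≤ G := by
    rw [hΦ, hG]
    refine (Finset.abs_sum_le_sum_abs _ _).trans (Finset.sum_le_sum fun i hi => ?_)
    rw [abs_mul, abs_mul, abs_of_pos (hp i hi)]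
  have hSη : |∑ i ∈ s, w i * (p i * η i)| ≤ 2 * ν * G := by
    rw [hG, Finset.mul_sum]
    refine (Finset.abs_sum_le_sum_abs _ _).trans (Finset.sum_le_sum fun i hi => ?_)
    rw [abs_mul, abs_mul, abs_of_pos (hp i hi), abs_of_nonneg (hw0 i hi)]
    have h1 : w i ≤ 2 * ν * |x i| := by
      simp only [hw]
      rw [div_le_iff₀ (hd0 i hi), ← sq_abs]
      have h2 : |x i| ≤ 2 * ν * (Q - x i) := by
        refine (hx i hi).trans ?_
        have h3 := mul_le_mul_of_nonneg_left (hd1 i hi) hν0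
        have h4 := mul_le_mul_of_nonneg_right hνν hQ.le
        have h5 := mul_nonneg hν0 hQ.le
        linarith
      have h3 := mul_le_mul_of_nonneg_left h2 (abs_nonneg (x i))
      linarith
    calc w i * (p i * |η i|) ≤ 2 * ν * |x i| * (p i * |η i|) :=
          mul_le_mul_of_nonneg_right h1 (mul_nonneg (hp i hi).le (abs_nonneg _))
      _ = _ := by ring
  -- The weights satisfy w_i (Q - x_i) = x_i², so the sums of x_i² g_i cancel.
  have hid : y * (A + m) = ∑ i ∈ s, w i * Bf i - ∑ i ∈ s, w i * (p i * η i)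
      + (∑ i ∈ s, x i ^ 2 * g i + 2 * Φ + m * y) - 2 * Φ := by
    have h1 : ∑ i ∈ s, w i * Bf i =
        ∑ i ∈ s, w i * (p i * η i) + y * A - ∑ i ∈ s, x i ^ 2 * g i := by
      rw [hA, Finset.mul_sum, ← Finset.sum_add_distrib, ← Finset.sum_sub_distrib]
      refine Finset.sum_congr rfl fun i hi => ?_
      have h2 : w i * (Q - x i) = x i ^ 2 := div_mul_cancel₀ _ (hd0 i hi).ne'
      simp only [hBf]
      rw [← h2]; ring
    rw [h1]; ring
  have hmain : |y| * (A + m) ≤ A * (n * (1 + ν) * b) + 2 * ν * G + (ν * |y| + ν * a) + 2 * G := by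
    have h1 : |y| * (A + m) = |y * (A + m)| := by
      rw [abs_mul, abs_of_nonneg (by linarith : 0 ≤ A + m)]
    rw [h1, hid]
    refine abs_le.2 ⟨?_, ?_⟩ <;>
      linarith [abs_le.1 hSB, abs_le.1 hSη, abs_le.1 hE, abs_le.1 hΦG]
  have hab : 0 ≤ a + b := by linarith
  have hfin : |y| * ((2 - 3 * ν) * m) ≤ m * n * (1 + 5 * ν) * (a + b) := by
    have e1 : A * (n * (1 + ν) * b) ≤ m * n * (1 + 5 * ν) * b := by
      calc A * (n * (1 + ν) * b) ≤ m * (1 + 3 * ν) * (n * (1 + ν) * b) := by gcongr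
        _ = m * n * b * ((1 + 3 * ν) * (1 + ν)) := by ring
        _ ≤ m * n * b * (1 + 5 * ν) := by
            have : (1 + 3 * ν) * (1 + ν) ≤ 1 + 5 * ν := by linarith
            gcongr
        _ = _ := by ring
    have e2 : (2 * ν + 2) * G ≤ m * n * (1 + 3 * ν) * a := by
      calc (2 * ν + 2) * G ≤ (2 * ν + 2) * (m * n / 2 * (1 + ν) * a) := by gcongr
        _ = m * n * a * ((1 + ν) * (1 + ν)) := by ring
        _ ≤ m * n * a * (1 + 3 * ν) := by
            have : (1 + ν) * (1 + ν) ≤ 1 + 3 * ν := by linarith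
            gcongr
        _ = _ := by ring
    have e3 : ν * a ≤ m * n * ν * a := by
      have h4 : 0 ≤ ν * a := by positivity
      have := mul_le_mul_of_nonneg_right hmn1 h4
      linarith
    have e4 : |y| * (m * (1 - 2 * ν) + m) ≤ |y| * (A + m) := by gcongr
    have e5 : ν * |y| ≤ ν * m * |y| := by
      have h4 : 0 ≤ ν * |y| := by positivity
      have := mul_le_mul_of_nonneg_right hm h4
      linarith
    have e6 : 0 ≤ m * n * ν * a := by positivity
    linarith
  have h6 : |y| * (2 - 3 * ν) ≤ n * (1 + 5 * ν) * (a + b) := by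
    refine le_of_mul_le_mul_right ?_ hm0
    linarith
  have h7 : n * (1 + 5 * ν) * (a + b) ≤ (1 + 10 * ν) * (n / 2 * (a + b)) * (2 - 3 * ν) := by
    have : 0 ≤ n * (a + b) := by positivity
    have h9 : 0 ≤ n * (a + b) * (ν * (7 - 30 * ν)) :=
      mul_nonneg this (mul_nonneg hν0 (by linarith))
    linarith
  have h8 := le_of_mul_le_mul_right (h6.trans h7) (by linarith)
  refine h8.trans (le_of_eq ?_)
  have : n / 2 = 1 / n := by field_simp; linarith
  rw [this, ha, hb]; ring

/-- By Cauchy-Schwarz (1 - ε)(√M + √F)² ≤ (2 - ε)(M + (1 - ε) F). The gain of 2 - ε over 2 absorbs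
the error factor (1 + ε/10)². -/
lemma weighted_sum_sq_bound {ε : ℝ} (hε0 : 0 < ε) (hε1 : ε < 1) (hQ : 0 < Q) (hM : 0 ≤ M)
    (hF : 0 ≤ F) (h : |y| ≤ (1 + 10 * (ε / 100)) * √Q * ((√M + √F) / √2)) :
    (1 - ε) * y ^ 2 ≤ Q * (M + (1 - ε) * F) := by
  have h1 : y ^ 2 ≤ ((1 + 10 * (ε / 100)) * √Q * ((√M + √F) / √2)) ^ 2 := by
    rw [← sq_abs y]
    exact pow_le_pow_left₀ (abs_nonneg _) h 2
  have h2 : ((1 + 10 * (ε / 100)) * √Q * ((√M + √F) / √2)) ^ 2 =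
      (1 + ε / 10) ^ 2 * Q * ((√M + √F) ^ 2 / 2) := by
    rw [mul_pow, mul_pow, div_pow, Real.sq_sqrt hQ.le, Real.sq_sqrt (by norm_num : (0 : ℝ) ≤ 2)]
    ring
  rw [h2] at h1
  have h3 : (1 - ε) * (√M + √F) ^ 2 ≤ (2 - ε) * (M + (1 - ε) * F) := by
    have hM2 := Real.sq_sqrt hM
    have hF2 := Real.sq_sqrt hF
    nlinarith [sq_nonneg (√M - (1 - ε) * √F)]
  have h4 : 0 ≤ M + (1 - ε) * F := by
    have := mul_nonneg (by linarith : 0 ≤ 1 - ε) hF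
    linarith
  have h5 : (1 + ε / 10) ^ 2 * (2 - ε) ≤ 2 := by nlinarith [mul_pos hε0 hε0]
  calc (1 - ε) * y ^ 2 ≤ (1 - ε) * ((1 + ε / 10) ^ 2 * Q * ((√M + √F) ^ 2 / 2)) :=
        mul_le_mul_of_nonneg_left h1 (by linarith)
    _ = (1 + ε / 10) ^ 2 * Q / 2 * ((1 - ε) * (√M + √F) ^ 2) := by ring
    _ ≤ (1 + ε / 10) ^ 2 * Q / 2 * ((2 - ε) * (M + (1 - ε) * F)) := by gcongr
    _ = Q * (M + (1 - ε) * F) / 2 * ((1 + ε / 10) ^ 2 * (2 - ε)) := by ring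
    _ ≤ Q * (M + (1 - ε) * F) / 2 * 2 := by gcongr
    _ = _ := by ring

end RealBounds

/-! ### Expansion of symmetric functions of a union of large and small variables. -/

/-- Each removed variable costs one degree of the cone. -/
lemma InGarding.of_union {A S : Finset ι} {k : ℕ} {x : ι → ℝ} (hd : Disjoint A S)
    (h : InGarding (A ∪ S) (A.card + k) x) : InGarding S k x := by
  induction A using Finset.induction_on generalizing k with
  | empty => simpa using h
  | insert a A ha ih =>
    rw [Finset.disjoint_insert_left] at hd
    refine ih hd.2 ?_
    rw [Finset.card_insert_of_notMem ha, Finset.insert_union] at h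
    have h' : InGarding (insert a (A ∪ S)) (A.card + k + 1) x := by
      convert h using 1; ring
    have := h'.erase (Finset.mem_insert_self _ _)
    rwa [Finset.erase_insert (by simp [ha, hd.1])] at this

lemma abs_elem_le {T : Finset ι} {x : ι → ℝ} (hx : ∀ i ∈ T, |x i| ≤ 1) (k : ℕ) :
    |elem T k x| ≤ 2 ^ T.card := by
  unfold elem
  refine (Finset.abs_sum_le_sum_abs _ _).trans ?_
  calc ∑ s ∈ T.powersetCard k, |∏ i ∈ s, x i| ≤ ∑ s ∈ T.powersetCard k, (1 : ℝ) := by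
        refine Finset.sum_le_sum fun s hs => ?_
        rw [Finset.abs_prod]
        exact Finset.prod_le_one (fun _ _ => abs_nonneg _)
          fun i hi => hx i ((Finset.mem_powersetCard.1 hs).1 hi)
    _ = ((T.powersetCard k).card : ℝ) := by simp
    _ ≤ (T.powerset.card : ℝ) := by
        exact_mod_cast Finset.card_le_card fun s hs =>
          Finset.mem_powerset.2 (Finset.mem_powersetCard.1 hs).1
    _ = 2 ^ T.card := by rw [Finset.card_powerset]; norm_num

lemma elem_card (T : Finset ι) (x : ι → ℝ) : elem T T.card x = ∏ i ∈ T, x i := by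
  simp [elem, Finset.powersetCard_self]

section Expansion

variable {B S : Finset ι} {x : ι → ℝ} {K : ℝ} {c : ℕ}

/-- In the expansion of the function of degree |B| + c, at most |B| factors come from `B`, so at
least c come from `S`. Degree exactly c is the main term, and each other nonzero term is bounded by
2^|B| K. -/
lemma abs_elem_union_sub_le (hd : Disjoint B S) (hx : ∀ i ∈ B, |x i| ≤ 1) (hK0 : 0 ≤ K)
    (hK : ∀ d, c < d → |elem S d x| ≤ K) :
    |elem (B ∪ S) (B.card + c) x - elem B B.card x * elem S c x| ≤
      (B.card + c + 1) * 2 ^ B.card * K := by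
  have hmem : (B.card, c) ∈ Finset.HasAntidiagonal.antidiagonal (B.card + c) := by simp
  rw [elem_union hd, ← Finset.add_sum_erase _ _ hmem]
  simp only [add_sub_cancel_left]
  refine (Finset.abs_sum_le_sum_abs _ _).trans ?_
  calc _ ≤ ∑ p ∈ (Finset.HasAntidiagonal.antidiagonal (B.card + c)).erase (B.card, c),
        2 ^ B.card * K := by
        refine Finset.sum_le_sum fun p hp => ?_
        rw [Finset.mem_erase, Finset.HasAntidiagonal.mem_antidiagonal] at hp
        obtain ⟨hne, hp⟩ := hp
        rcases lt_trichotomy p.2 c with h | h | h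
        · rw [elem_eq_zero (T := B) (k := p.1) (by omega), zero_mul, abs_zero]
          positivity
        · exact absurd (Prod.ext (by simp; omega) h) hne
        · rw [abs_mul]
          exact mul_le_mul (abs_elem_le hx _) (hK _ h) (abs_nonneg _) (by positivity)
    _ ≤ ∑ p ∈ Finset.HasAntidiagonal.antidiagonal (B.card + c), 2 ^ B.card * K :=
        Finset.sum_le_sum_of_subset_of_nonneg (Finset.erase_subset _ _)
          fun _ _ _ => by positivity
    _ = _ := by
        rw [Finset.sum_const, Finset.Nat.card_antidiagonal, nsmul_eq_mul]
        push_cast; ring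

lemma abs_elem_union_le (hd : Disjoint B S) (hx : ∀ i ∈ B, |x i| ≤ 1) (hK0 : 0 ≤ K)
    (hK : ∀ d, c ≤ d → |elem S d x| ≤ K) :
    |elem (B ∪ S) (B.card + c) x| ≤ (B.card + c + 2) * 2 ^ B.card * K := by
  have h1 := abs_elem_union_sub_le hd hx hK0 fun d hd => hK d hd.le
  have h2 : |elem B B.card x * elem S c x| ≤ 2 ^ B.card * K := by
    rw [abs_mul]
    exact mul_le_mul (abs_elem_le hx _) (hK _ le_rfl) (abs_nonneg _) (by positivity)
  have h3 := abs_add_le (elem (B ∪ S) (B.card + c) x - elem B B.card x * elem S c x)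
    (elem B B.card x * elem S c x)
  rw [sub_add_cancel] at h3
  linarith

/-- One order further than `abs_elem_union_sub_le`: the terms of degree c and c + 1 in `S` are both
kept. Since x_o = 1, the product over `insert o B` is the product over `B`. -/
lemma abs_elem_insert_union_sub_le {o : ι} (ho : o ∉ B ∪ S) (hxo : x o = 1) (hd : Disjoint B S)
    (hx : ∀ i ∈ B, |x i| ≤ 1) (hK0 : 0 ≤ K) (hK : ∀ d, c + 1 < d → |elem S d x| ≤ K) :
    |elem (insert o (B ∪ S)) (B.card + c + 1) x - (elem B B.card x * elem S c x
      + elem (insert o B) B.card x * elem S (c + 1) x)| ≤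
      2 * ((B.card + c + 2) * 2 ^ B.card * K) := by
  have h1 := abs_elem_union_sub_le (c := c + 1) hd hx hK0 hK
  have hmem : (B.card, c) ∈ Finset.HasAntidiagonal.antidiagonal (B.card + c) := by simp
  have key : |elem (B ∪ S) (B.card + c) x - (elem B B.card x * elem S c x
      + (elem (insert o B) B.card x - elem B B.card x) * elem S (c + 1) x)| ≤
      (B.card + c + 1) * 2 ^ B.card * K := by
    have hoB : o ∉ B := fun h => ho (Finset.mem_union_left _ h)
    rw [elem_union hd, ← Finset.add_sum_erase _ _ hmem]
    rcases hb : B.card with _ | b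
    · rw [Finset.card_eq_zero] at hb
      subst hb
      rw [Finset.sum_eq_zero]
      · simp; positivity
      · intro p hp
        rw [Finset.mem_erase, Finset.HasAntidiagonal.mem_antidiagonal] at hp
        obtain ⟨hne, hp⟩ := hp
        have : p.1 ≠ 0 := fun h => hne (Prod.ext h (by simp; omega))
        rw [elem_eq_zero (by simp; omega), zero_mul]
    · rw [elem_insert hoB, hxo, one_mul, add_sub_cancel_left]
      have hmem2 : (b, c + 1) ∈
          (Finset.HasAntidiagonal.antidiagonal (b + 1 + c)).erase (b + 1, c) := by
        simp; omega
      rw [← Finset.add_sum_erase _ _ hmem2, ← add_assoc, add_sub_cancel_left]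
      refine (Finset.abs_sum_le_sum_abs _ _).trans ?_
      calc _ ≤ ∑ p ∈ ((Finset.HasAntidiagonal.antidiagonal (b + 1 + c)).erase
            (b + 1, c)).erase (b, c + 1), 2 ^ (b + 1) * K := by
            refine Finset.sum_le_sum fun p hp => ?_
            rw [Finset.mem_erase, Finset.mem_erase, Finset.HasAntidiagonal.mem_antidiagonal] at hp
            obtain ⟨hne2, hne, hp⟩ := hp
            rcases lt_trichotomy p.2 c with h | h | h
            · rw [elem_eq_zero (T := B) (k := p.1) (by omega), zero_mul, abs_zero]
              positivity
            · exact absurd (Prod.ext (by simp; omega) h) hne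
            · have h' : c + 1 < p.2 := by
                rcases Nat.lt_or_ge (c + 1) p.2 with h' | h'
                · exact h'
                · exact absurd (Prod.ext (by simp; omega) (by simp; omega)) hne2
              rw [abs_mul, ← hb]
              exact mul_le_mul (abs_elem_le hx _) (hK _ h') (abs_nonneg _) (by positivity)
        _ ≤ ∑ p ∈ Finset.HasAntidiagonal.antidiagonal (b + 1 + c), 2 ^ (b + 1) * K :=
            Finset.sum_le_sum_of_subset_of_nonneg
              ((Finset.erase_subset _ _).trans (Finset.erase_subset _ _))
              fun _ _ _ => by positivity
        _ = _ := by
            rw [Finset.sum_const, Finset.Nat.card_antidiagonal, nsmul_eq_mul]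
            push_cast; ring
  rw [elem_insert ho, hxo, one_mul]
  rw [abs_le] at *
  push_cast at h1
  have h2 : 0 ≤ 2 ^ B.card * K := by positivity
  rw [show B.card + (c + 1) = B.card + c + 1 from rfl] at h1
  constructor <;> linarith

end Expansion

/-! ### Symmetric functions of uniformly small variables. -/

section Small

variable {S : Finset ι} {x : ι → ℝ} {δ : ℝ} {m n κ : ℕ}

/-- On the Gårding cone the left side has nonnegative terms, so the identity bounds each of them and
also bounds the function of degree `m + 2` from above. -/
lemma sum_sq_mul_elem_erase (S : Finset ι) (m : ℕ) (x : ι → ℝ) :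
    ∑ i ∈ S, x i ^ 2 * elem (S.erase i) m x =
      elem S (m + 1) x * ∑ i ∈ S, x i - (m + 2) * elem S (m + 2) x := by
  have h : ∀ i ∈ S, x i ^ 2 * elem (S.erase i) m x =
      elem S (m + 1) x * x i - x i * elem (S.erase i) (m + 1) x := fun i hi => by
    rw [elem_erase hi]; ring
  rw [Finset.sum_congr rfl h, Finset.sum_sub_distrib, ← Finset.mul_sum, sum_mul_elem_erase]
  push_cast
  ring

lemma abs_sum_le_card_mul (hδ : ∀ i ∈ S, |x i| ≤ δ) (hn : S.card ≤ n) (hδ0 : 0 ≤ δ) :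
    |∑ i ∈ S, x i| ≤ n * δ := by
  refine (Finset.abs_sum_le_sum_abs _ _).trans ((Finset.sum_le_sum hδ).trans ?_)
  rw [Finset.sum_const, nsmul_eq_mul]
  have : (S.card : ℝ) ≤ n := by exact_mod_cast hn
  gcongr

/-- In the Gårding cone, with all variables small, a symmetric function is small compared with
the one of lower degree in fewer variables. -/
lemma elem_le_small_mul_erase (h : InGarding S (m + 1) x) (hδ0 : 0 ≤ δ) (hδ : ∀ i ∈ S, |x i| ≤ δ)
    (hn : S.card ≤ n) {i : ι} (hi : i ∈ S) :
    elem S (m + 1) x ≤ (n + 1) * δ * elem (S.erase i) m x := by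
  have hpi := elem_erase_pos h hi
  have hxi := abs_le.1 (hδ i hi)
  have e := elem_erase hi m x
  have hn0 : (0 : ℝ) ≤ n := n.cast_nonneg
  have h1 : x i * elem (S.erase i) m x ≤ δ * elem (S.erase i) m x :=
    mul_le_mul_of_nonneg_right hxi.2 hpi.le
  have h2 : elem (S.erase i) (m + 1) x ≤ n * δ * elem (S.erase i) m x := by
    rcases le_or_gt (elem (S.erase i) (m + 1) x) 0 with h0 | h0
    · exact h0.trans (by positivity)
    -- In the remaining case `S.erase i` lies in the cone of the full degree, so the coefficients in
    -- Euler's relation are positive and each variable may be replaced by its bound δ.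
    have hG : InGarding (S.erase i) (m + 1) x := by
      intro j hj
      rcases Nat.lt_or_ge j (m + 1) with hj' | hj'
      · exact h.erase hi j (by omega)
      · obtain rfl : j = m + 1 := by omega
        exact h0
    have e1 := sum_mul_elem_erase (S.erase i) m x
    have e2 := sum_elem_erase (S.erase i) m x
    have h3 : ∑ a ∈ S.erase i, x a * elem ((S.erase i).erase a) m x ≤
        δ * ∑ a ∈ S.erase i, elem ((S.erase i).erase a) m x := by
      rw [Finset.mul_sum]
      exact Finset.sum_le_sum fun a ha => mul_le_mul_of_nonneg_right
        (abs_le.1 (hδ a (Finset.mem_of_mem_erase ha))).2 (elem_erase_pos hG ha).le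
    rw [e1, e2] at h3
    have hc : ((S.erase i).card : ℝ) ≤ n := by
      exact_mod_cast (Finset.card_le_card (Finset.erase_subset _ _)).trans hn
    have hm : (0 : ℝ) ≤ m := m.cast_nonneg
    have h4 : δ * ((((S.erase i).card : ℝ) - m) * elem (S.erase i) m x) ≤
        n * δ * elem (S.erase i) m x := by
      have : 0 ≤ δ * elem (S.erase i) m x := by positivity
      nlinarith
    nlinarith
  linarith

/-- Bounds for the symmetric functions of high degree in small variables. -/
lemma abs_elem_small_le (h : InGarding S (m + 1) x) (hδ0 : 0 ≤ δ) (hδ1 : δ ≤ 1)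
    (hδ : ∀ i ∈ S, |x i| ≤ δ) (hn : S.card ≤ n) (hm : m ≤ κ) (t : ℕ) :
    (∀ i ∈ S, |elem (S.erase i) (m + 2 + t) x| ≤
      (n + κ + 4) * (n + 1) ^ t * (|elem S (m + 2) x| + δ * elem S (m + 1) x)) ∧
    |elem S (m + 3 + t) x| ≤
      (n + κ + 4) * (n + 1) ^ (t + 1) * δ * (|elem S (m + 2) x| + δ * elem S (m + 1) x) := by
  have hp := h (m + 1) le_rfl
  set p := elem S (m + 1) x with hpdef
  set r := elem S (m + 2) x with hrdef
  set Q := |r| + δ * p with hQ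
  have hQ0 : 0 ≤ Q := by positivity
  have hn0 : (0 : ℝ) ≤ n := n.cast_nonneg
  have hκ0 : (0 : ℝ) ≤ κ := κ.cast_nonneg
  have hmκ : (m : ℝ) ≤ κ := by exact_mod_cast hm
  have hSn : (S.card : ℝ) ≤ n := by exact_mod_cast hn
  -- The two families are bounded alternately: Euler's relation turns a bound for `S.erase i` into
  -- one for `S` in the next degree with an extra δ, and removing a variable turns that into the
  -- next bound for `S.erase i`.
  have second : ∀ t : ℕ, (∀ i ∈ S, |elem (S.erase i) (m + 2 + t) x| ≤
      (n + κ + 4) * (n + 1) ^ t * Q) →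
      |elem S (m + 3 + t) x| ≤ (n : ℝ) * ((n + κ + 4) * (n + 1) ^ t * δ * Q) := by
    intro t ht
    have e := sum_mul_elem_erase S (m + 2 + t) x
    have h1 : |∑ i ∈ S, x i * elem (S.erase i) (m + 2 + t) x| ≤
        (n : ℝ) * ((n + κ + 4) * (n + 1) ^ t * δ * Q) := by
      refine (Finset.abs_sum_le_sum_abs _ _).trans ?_
      calc _ ≤ ∑ i ∈ S, δ * ((n + κ + 4) * (n + 1) ^ t * Q) := by
            refine Finset.sum_le_sum fun i hi => ?_
            rw [abs_mul]
            exact mul_le_mul (hδ i hi) (ht i hi) (abs_nonneg _) hδ0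
        _ = S.card * (δ * ((n + κ + 4) * (n + 1) ^ t * Q)) := by
            rw [Finset.sum_const, nsmul_eq_mul]
        _ ≤ n * (δ * ((n + κ + 4) * (n + 1) ^ t * Q)) := by gcongr
        _ = _ := by ring
    rw [e, abs_mul] at h1
    have h2 : (1 : ℝ) ≤ |((m + 2 + t : ℕ) : ℝ) + 1| := by
      rw [abs_of_nonneg (by positivity)]
      have : (0 : ℝ) ≤ ((m + 2 + t : ℕ) : ℝ) := Nat.cast_nonneg _
      linarith
    have h3 : |elem S (m + 2 + t + 1) x| ≤
        |((m + 2 + t : ℕ) : ℝ) + 1| * |elem S (m + 2 + t + 1) x| :=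
      le_mul_of_one_le_left (abs_nonneg _) h2
    rw [show m + 3 + t = m + 2 + t + 1 by ring]
    exact h3.trans h1
  have first : ∀ i ∈ S, |elem (S.erase i) (m + 2 + t) x| ≤ (n + κ + 4) * (n + 1) ^ t * Q := by
    induction t with
    | zero =>
      intro i hi
      have e1 : elem (S.erase i) (m + 1) x = p - x i * elem (S.erase i) m x := by
        rw [hpdef, elem_erase hi]; ring
      have e2 : elem (S.erase i) (m + 2) x = r - x i * elem (S.erase i) (m + 1) x := by
        rw [hrdef, show m + 2 = m + 1 + 1 from rfl, elem_erase hi]; ring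
      -- The degree `m` function on `S.erase i` has no bound by p; only its multiple by x_i² is
      -- controlled, as one term of the nonnegative sum of squares.
      have h1 : x i ^ 2 * elem (S.erase i) m x ≤ n * δ * p + (m + 2) * |r| := by
        have h2 : x i ^ 2 * elem (S.erase i) m x ≤
            ∑ a ∈ S, x a ^ 2 * elem (S.erase a) m x :=
          Finset.single_le_sum (f := fun a => x a ^ 2 * elem (S.erase a) m x)
            (fun a ha => mul_nonneg (sq_nonneg _) (elem_erase_pos h ha).le) hi
        rw [sum_sq_mul_elem_erase] at h2
        have h3 : p * ∑ i ∈ S, x i ≤ p * (n * δ) :=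
          mul_le_mul_of_nonneg_left ((le_abs_self _).trans (abs_sum_le_card_mul hδ hn hδ0)) hp.le
        have h4 : -((m + 2) * r) ≤ (m + 2) * |r| := by
          have := neg_abs_le r
          have hm2 : (0 : ℝ) ≤ m + 2 := by positivity
          nlinarith
        linarith
      have h0 : 0 ≤ x i ^ 2 * elem (S.erase i) m x :=
        mul_nonneg (sq_nonneg _) (elem_erase_pos h hi).le
      have h5 : |x i * p| ≤ δ * p := by
        rw [abs_mul, abs_of_pos hp]; exact mul_le_mul_of_nonneg_right (hδ i hi) hp.le
      have e3 : elem (S.erase i) (m + 2 + 0) x = r - x i * p + x i ^ 2 * elem (S.erase i) m x := by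
        rw [add_zero, e2, e1]; ring
      rw [e3, pow_zero, mul_one]
      have hr := abs_le.1 (le_refl |r|)
      have hb : |r| + δ * p + (n * δ * p + (m + 2) * |r|) ≤ (n + κ + 4) * Q := by
        rw [hQ]
        have a1 : 0 ≤ |r| := abs_nonneg r
        have a2 : 0 ≤ δ * p := by positivity
        nlinarith [mul_nonneg hn0 a1, mul_nonneg hκ0 a2, mul_le_mul_of_nonneg_right hmκ a1]
      rw [abs_le] at h5 ⊢
      constructor <;> linarith
    | succ t ih =>
      intro i hi
      have h1 := ih i hi
      have h2 := second t ih
      have e : elem (S.erase i) (m + 2 + (t + 1)) x =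
          elem S (m + 3 + t) x - x i * elem (S.erase i) (m + 2 + t) x := by
        rw [show m + 3 + t = m + 2 + t + 1 by ring, elem_erase hi]
        ring_nf
      rw [e]
      have h3 : |x i * elem (S.erase i) (m + 2 + t) x| ≤ 1 * ((n + κ + 4) * (n + 1) ^ t * Q) := by
        rw [abs_mul]
        exact mul_le_mul ((hδ i hi).trans hδ1) h1 (abs_nonneg _) zero_le_one
      have h4 : (n : ℝ) * ((n + κ + 4) * (n + 1) ^ t * δ * Q) ≤
          n * ((n + κ + 4) * (n + 1) ^ t * 1 * Q) := by gcongr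
      refine (abs_sub _ _).trans ?_
      rw [pow_succ]
      linarith
  refine ⟨first, (second t first).trans ?_⟩
  have : (0 : ℝ) ≤ (n + κ + 4) * (n + 1) ^ t * δ * Q := by positivity
  rw [pow_succ]
  linarith

/-- Degrees beyond the number of variables give zero, so the exponent t may be replaced by n
throughout. -/
lemma abs_elem_small_uniform (h : InGarding S (m + 1) x) (hδ0 : 0 ≤ δ) (hδ1 : δ ≤ 1)
    (hδ : ∀ i ∈ S, |x i| ≤ δ) (hn : S.card ≤ n) (hm : m ≤ κ) :
    (∀ i ∈ S, ∀ d, m + 2 ≤ d → |elem (S.erase i) d x| ≤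
      (n + κ + 4) * (n + 1) ^ (n + 1) * (|elem S (m + 2) x| + δ * elem S (m + 1) x)) ∧
    ∀ d, m + 3 ≤ d → |elem S d x| ≤
      (n + κ + 4) * (n + 1) ^ (n + 1) * δ * (|elem S (m + 2) x| + δ * elem S (m + 1) x) := by
  have hp := h (m + 1) le_rfl
  have hQ0 : 0 ≤ |elem S (m + 2) x| + δ * elem S (m + 1) x := by positivity
  have hn1 : (1 : ℝ) ≤ n + 1 := by
    have : (0 : ℝ) ≤ n := n.cast_nonneg
    linarith
  constructor
  · intro i hi d hd
    obtain ⟨t, rfl⟩ := Nat.exists_eq_add_of_le hd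
    rcases Nat.lt_or_ge n t with ht | ht
    · rw [elem_eq_zero, abs_zero]
      · positivity
      · have := Finset.card_le_card (Finset.erase_subset i S)
        omega
    · refine ((abs_elem_small_le h hδ0 hδ1 hδ hn hm t).1 i hi).trans ?_
      have : ((n : ℝ) + 1) ^ t ≤ (n + 1) ^ (n + 1) := pow_le_pow_right₀ hn1 (by omega)
      gcongr
  · intro d hd
    obtain ⟨t, rfl⟩ := Nat.exists_eq_add_of_le hd
    rcases Nat.lt_or_ge n t with ht | ht
    · rw [elem_eq_zero, abs_zero]
      · positivity
      · omega
    · refine ((abs_elem_small_le h hδ0 hδ1 hδ hn hm t).2).trans ?_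
      have : ((n : ℝ) + 1) ^ (t + 1) ≤ (n + 1) ^ (n + 1) := pow_le_pow_right₀ hn1 (by omega)
      gcongr

end Small

/-! ### Consequences of a spectral gap. -/

/-- The variables `x` consist of a leading one, equal to `1`, those indexed by `B`, which lie in
`[D, 1]`, and those indexed by `S`, of size at most `δ`; they lie in the Gårding cone of degree
`κ + 2`, and `B` has `κ - m` elements. -/
structure SpectralGap (n κ m : ℕ) (D δ : ℝ) (o : ι) (B S : Finset ι) (x : ι → ℝ) : Prop where
  disj : Disjoint B S
  notMem : o ∉ B ∪ S
  lead : x o = 1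
  big_ge : ∀ j ∈ B, D ≤ x j
  big_le : ∀ j ∈ B, x j ≤ 1
  small : ∀ i ∈ S, |x i| ≤ δ
  card_le : (B ∪ S).card ≤ n
  card_add : B.card + m = κ
  garding : InGarding (insert o (B ∪ S)) (κ + 2) x

lemma elem_erase_insert {T : Finset ι} {o i : ι} (ho : o ∉ T) (hi : i ∈ T) {x : ι → ℝ}
    (hx : x o = 1) (k : ℕ) :
    elem ((insert o T).erase i) (k + 1) x =
      elem T (k + 1) x + (1 - x i) * elem (T.erase i) k x := by
  have hoi : o ≠ i := fun h => ho (h ▸ hi)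
  rw [Finset.erase_insert_of_ne hoi, elem_insert (fun h => ho (Finset.mem_of_mem_erase h)),
    elem_erase hi, hx]
  ring

namespace SpectralGap

variable {n κ m : ℕ} {D δ : ℝ} {o : ι} {B S : Finset ι} {x : ι → ℝ}

lemma garding_union (h : SpectralGap n κ m D δ o B S x) : InGarding (B ∪ S) (κ + 1) x := by
  have := h.garding.erase (Finset.mem_insert_self o (B ∪ S))
  rwa [Finset.erase_insert h.notMem] at this

/-- Removing the leading variable and then all of `B` costs 1 + |B| degrees, which leaves κ + 2 - 1
- |B| = m + 1. -/
lemma garding_small (h : SpectralGap n κ m D δ o B S x) : InGarding S (m + 1) x := by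
  refine InGarding.of_union h.disj ?_
  rw [← add_assoc, h.card_add]
  exact h.garding_union

lemma abs_big_le (h : SpectralGap n κ m D δ o B S x) (hD : 0 < D) : ∀ j ∈ B, |x j| ≤ 1 :=
  fun j hj => by
    rw [abs_of_nonneg (hD.le.trans (h.big_ge j hj))]
    exact h.big_le j hj

lemma prod_big_ge (h : SpectralGap n κ m D δ o B S x) (hD : 0 < D) (hD1 : D ≤ 1) :
    D ^ κ ≤ elem B B.card x := by
  rw [elem_card]
  calc D ^ κ ≤ D ^ B.card := pow_le_pow_of_le_one hD.le hD1 (by have := h.card_add; omega)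
    _ = ∏ _j ∈ B, D := by rw [Finset.prod_const]
    _ ≤ _ := Finset.prod_le_prod (fun _ _ => hD.le) h.big_ge

lemma prod_big_le (h : SpectralGap n κ m D δ o B S x) (hD : 0 < D) : elem B B.card x ≤ 1 := by
  rw [elem_card]
  exact Finset.prod_le_one (fun j hj => hD.le.trans (h.big_ge j hj)) h.big_le

lemma prod_big_le_elem (h : SpectralGap n κ m D δ o B S x) (hD : 0 < D) :
    elem B B.card x ≤ elem (insert o B) B.card x := by
  have ho : o ∉ B := fun h' => h.notMem (Finset.mem_union_left _ h')
  rcases hb : B.card with _ | b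
  · simp
  · rw [elem_insert ho, h.lead, one_mul]
    have : 0 ≤ elem B b x := Finset.sum_nonneg fun s hs => Finset.prod_nonneg fun i hi =>
      hD.le.trans (h.big_ge i ((Finset.mem_powersetCard.1 hs).1 hi))
    linarith

lemma card_small_le (h : SpectralGap n κ m D δ o B S x) : S.card ≤ n :=
  (Finset.card_le_card Finset.subset_union_right).trans h.card_le

lemma card_big_le (h : SpectralGap n κ m D δ o B S x) : B.card ≤ n :=
  (Finset.card_le_card Finset.subset_union_left).trans h.card_le

lemma coeff_le (h : SpectralGap n κ m D δ o B S x) {b c : ℕ} (hb : b ≤ B.card) (hc : c ≤ m + 3)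
    {K : ℝ} (hK : 0 ≤ K) : ((b : ℝ) + c + 2) * 2 ^ b * K ≤ (κ + 5) * 2 ^ n * K := by
  have h1 : (b : ℝ) + c + 2 ≤ κ + 5 := by
    have := h.card_add
    have : b + c + 2 ≤ κ + 5 := by omega
    exact_mod_cast this
  have h2 : (2 : ℝ) ^ b ≤ 2 ^ n := pow_le_pow_right₀ (by norm_num) (hb.trans h.card_big_le)
  gcongr

end SpectralGap

/-- The basic comparison of the symmetric functions of `B ∪ S` with those of `S`. -/
lemma exists_small_bounds (n κ : ℕ) {D : ℝ} (hD : 0 < D) (hD1 : D ≤ 1) :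
    ∃ C : ℝ, 1 ≤ C ∧ ∃ δ₀ : ℝ, 0 < δ₀ ∧ δ₀ ≤ 1 ∧
      ∀ (m : ℕ) (δ : ℝ) (o : ι) (B S : Finset ι) (x : ι → ℝ), 0 < δ → δ ≤ δ₀ →
        SpectralGap n κ m D δ o B S x →
        elem S (m + 1) x ≤ C * elem (B ∪ S) (κ + 1) x ∧
        elem (B ∪ S) (κ + 1) x ≤ C * elem S (m + 1) x ∧
        (∀ d, m + 2 ≤ d → |elem S d x| ≤ C * elem S (m + 1) x) ∧
        (∀ d, m + 3 ≤ d → |elem S d x| ≤ C * δ * elem S (m + 1) x) ∧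
        (∀ i ∈ S, ∀ d, m + 2 ≤ d → |elem (S.erase i) d x| ≤ C * elem S (m + 1) x) := by
  obtain ⟨d, hd⟩ : ∃ t : ℝ, t = D ^ κ := ⟨_, rfl⟩
  have hd0 : 0 < d := by rw [hd]; positivity
  have hd1 : d ≤ 1 := hd ▸ pow_le_one₀ hD.le hD1
  obtain ⟨E, hE⟩ : ∃ t : ℝ, t = 2 * ((κ + 5) * 2 ^ n) := ⟨_, rfl⟩
  obtain ⟨C1, hC1⟩ : ∃ t : ℝ, t = (n + κ + 4) * (n + 1) ^ (n + 1) := ⟨_, rfl⟩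
  obtain ⟨C2, hC2⟩ : ∃ t : ℝ, t = n + 4 / d := ⟨_, rfl⟩
  obtain ⟨C3, hC3⟩ : ∃ t : ℝ, t = E * C1 * (C2 + 1) + n := ⟨_, rfl⟩
  have hn0 : (0 : ℝ) ≤ n := n.cast_nonneg
  have hκ0 : (0 : ℝ) ≤ κ := κ.cast_nonneg
  have hE1 : 1 ≤ E := by
    have : (1 : ℝ) ≤ 2 ^ n := one_le_pow₀ (by norm_num)
    have : (1 : ℝ) ≤ (κ + 5) * 2 ^ n := by nlinarith
    rw [hE]; linarith
  have hC11 : 1 ≤ C1 := by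
    have : (1 : ℝ) ≤ (n + 1) ^ (n + 1) := one_le_pow₀ (by linarith)
    have : (1 : ℝ) ≤ n + κ + 4 := by linarith
    rw [hC1]; nlinarith
  have hC20 : 0 < C2 := by rw [hC2]; positivity
  have hC30 : 0 < C3 := by rw [hC3]; positivity
  obtain ⟨C4, hC4⟩ : ∃ t : ℝ, t = 2 * (E + 1) / d ^ 2 := ⟨_, rfl⟩
  obtain ⟨C5, hC5⟩ : ∃ t : ℝ, t = C1 * (C2 + 1) := ⟨_, rfl⟩
  have hC40 : 0 < C4 := by rw [hC4]; positivity
  have hC50 : 0 < C5 := by rw [hC5]; positivity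
  refine ⟨1 + E * (C2 + C5) + C2 + C4 + C5, ?_,
    min 1 (min (d / (2 * E * C1)) (d ^ 2 / (2 * (E + 1) * C3))), by positivity, min_le_left _ _,
    ?_⟩
  · have : 0 < E * (C2 + C5) := by positivity
    linarith
  intro m δ o B S x hδ0 hδ h
  have hδ1 : δ ≤ 1 := hδ.trans (min_le_left _ _)
  have hδa : E * C1 * δ ≤ d / 2 := by
    have := (hδ.trans (min_le_right _ _)).trans (min_le_left _ _)
    rw [le_div_iff₀ (by positivity)] at this
    linarith
  have hδb : (E + 1) * C3 * δ ≤ d ^ 2 / 2 := by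
    have := (hδ.trans (min_le_right _ _)).trans (min_le_right _ _)
    rw [le_div_iff₀ (by positivity)] at this
    linarith
  have hS := h.garding_small
  have hmκ : m ≤ κ := by have := h.card_add; omega
  obtain ⟨u1, u2⟩ := abs_elem_small_uniform hS hδ0.le hδ1 h.small h.card_small_le hmκ
  rw [← hC1] at u1 u2
  have hp := hS (m + 1) le_rfl
  have hP := h.garding_union (κ + 1) le_rfl
  have hf := h.garding (κ + 2) le_rfl
  have hfe := elem_insert h.notMem (κ + 1) x
  rw [h.lead, one_mul] at hfe
  obtain ⟨p, hpdef⟩ : ∃ t, t = elem S (m + 1) x := ⟨_, rfl⟩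
  obtain ⟨r, hrdef⟩ : ∃ t, t = elem S (m + 2) x := ⟨_, rfl⟩
  obtain ⟨P, hPdef⟩ : ∃ t, t = elem (B ∪ S) (κ + 1) x := ⟨_, rfl⟩
  rw [← hpdef, ← hrdef] at u1 u2
  rw [← hpdef] at hp ⊢
  rw [← hPdef] at hP hfe ⊢
  have hbge := h.prod_big_ge hD hD1
  rw [← hd] at hbge
  have hble := h.prod_big_le hD
  have hbe := h.prod_big_le_elem hD
  obtain ⟨b, hb⟩ : ∃ t, t = elem B B.card x := ⟨_, rfl⟩
  rw [← hb] at hbge hble hbe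
  have hQ0 : 0 ≤ |r| + δ * p := by positivity
  have hx := h.abs_big_le hD
  -- Upper bound from the nonnegative sum of squares. A very negative r is excluded next by
  -- positivity of f, whose main part is b p plus a coefficient at least d times r.
  have hr_pos : r ≤ n * δ * p := by
    have h1 : 0 ≤ ∑ i ∈ S, x i ^ 2 * elem (S.erase i) m x :=
      Finset.sum_nonneg fun i hi => mul_nonneg (sq_nonneg _) (elem_erase_pos hS hi).le
    rw [sum_sq_mul_elem_erase, ← hpdef, ← hrdef] at h1
    have h2 : p * ∑ i ∈ S, x i ≤ p * (n * δ) := mul_le_mul_of_nonneg_left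
      ((le_abs_self _).trans (abs_sum_le_card_mul h.small h.card_small_le hδ0.le)) hp.le
    rcases le_or_gt r 0 with hr | hr
    · exact hr.trans (by positivity)
    · have : r ≤ (m + 2) * r := le_mul_of_one_le_left hr.le (by
        have : (0 : ℝ) ≤ m := m.cast_nonneg
        linarith)
      linarith
  have hr_abs : |r| ≤ C2 * p := by
    rcases le_or_gt 0 r with hr | hr
    · rw [abs_of_nonneg hr]
      refine hr_pos.trans (mul_le_mul_of_nonneg_right ?_ hp.le)
      have : (n : ℝ) * δ ≤ n := mul_le_of_le_one_right hn0 hδ1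
      have : 0 < 4 / d := by positivity
      linarith
    · have h1 := abs_elem_insert_union_sub_le (c := m + 1) (K := C1 * δ * (|r| + δ * p))
        h.notMem h.lead h.disj hx (by positivity) (fun d hd => u2 d (by omega))
      have h2 := h.coeff_le (b := B.card) (c := m + 1) le_rfl (by omega)
        (K := C1 * δ * (|r| + δ * p)) (by positivity)
      rw [show B.card + (m + 1) + 1 = κ + 2 by have := h.card_add; omega, ← hb, ← hpdef,
        ← hrdef] at h1
      have h3 := (abs_le.1 h1).2
      have h4 : E * C1 * δ * |r| ≤ d / 2 * |r| := mul_le_mul_of_nonneg_right hδa (abs_nonneg _)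
      have h5 : E * C1 * δ * (δ * p) ≤ 1 / 2 * p := by
        have e1 : E * C1 * δ * δ ≤ 1 / 2 * 1 :=
          mul_le_mul (by linarith) hδ1 hδ0.le (by norm_num)
        have := mul_le_mul_of_nonneg_right e1 hp.le
        linarith
      have h6 : d * |r| ≤ elem (insert o B) B.card x * |r| :=
        mul_le_mul_of_nonneg_right (hbge.trans hbe) (abs_nonneg _)
      have h7 : b * p ≤ p := mul_le_of_le_one_left hp.le hble
      have h8 : |r| = -r := abs_of_neg hr
      have h9 : elem (insert o B) B.card x * |r| = -(elem (insert o B) B.card x * r) := by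
        rw [h8]; ring
      have h10 : d * |r| ≤ 4 * p := by
        have e : 2 * ((κ + 5) * 2 ^ n * (C1 * δ * (|r| + δ * p))) =
          E * C1 * δ * |r| + E * C1 * δ * (δ * p) := by rw [hE]; ring
        linarith
      have h11 : |r| ≤ 4 / d * p := by
        rw [div_mul_eq_mul_div, le_div_iff₀ hd0]
        linarith
      have : 0 ≤ n * p := by positivity
      rw [hC2, add_mul]
      linarith
  have hQ : |r| + δ * p ≤ (C2 + 1) * p := by
    have : δ * p ≤ 1 * p := mul_le_mul_of_nonneg_right hδ1 hp.le
    linarith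
  have hQ' : C1 * (|r| + δ * p) ≤ C5 * p := by
    have := mul_le_mul_of_nonneg_left hQ (by positivity : 0 ≤ C1)
    rw [hC5]; linarith
  have hQ'' : C1 * δ * (|r| + δ * p) ≤ C5 * δ * p := by
    have := mul_le_mul_of_nonneg_left hQ' hδ0.le
    linarith
  have v1 : ∀ i ∈ S, ∀ d, m + 2 ≤ d → |elem (S.erase i) d x| ≤ C5 * p :=
    fun i hi d hd => (u1 i hi d hd).trans hQ'
  have v2 : ∀ d, m + 3 ≤ d → |elem S d x| ≤ C5 * δ * p := fun d hd => (u2 d hd).trans hQ''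
  have hδp : C5 * δ * p ≤ C5 * p := by
    have := mul_le_mul_of_nonneg_left hδ1 (by positivity : 0 ≤ C5 * p)
    linarith
  have v3 : ∀ d, m + 2 ≤ d → |elem S d x| ≤ |r| + C5 * δ * p := fun d hd => by
    rcases Nat.lt_or_ge (m + 2) d with h' | h'
    · have := v2 d h'
      have := abs_nonneg r
      linarith
    · obtain rfl : d = m + 2 := by omega
      have : 0 ≤ C5 * δ * p := by positivity
      rw [← hrdef]; linarith
  have hP_sub : |P - b * p| ≤ E * (|r| + C5 * δ * p) := by
    have h1 := abs_elem_union_sub_le (c := m + 1) (K := |r| + C5 * δ * p) h.disj hx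
      (by positivity) (fun d hd => v3 d (by omega))
    have h2 := h.coeff_le (b := B.card) (c := m + 1) le_rfl (by omega)
        (K := |r| + C5 * δ * p) (by positivity)
    rw [show B.card + (m + 1) = κ + 1 by have := h.card_add; omega, ← hb, ← hPdef, ← hpdef] at h1
    have h3 : 0 ≤ 2 ^ B.card * (|r| + C5 * δ * p) := by positivity
    have h4 : 0 ≤ (κ + 5) * 2 ^ n * (|r| + C5 * δ * p) := by positivity
    rw [hE]
    linarith
  have hR_sub : |elem (B ∪ S) (κ + 2) x - b * r| ≤ E * (C5 * δ * p) := by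
    have h1 := abs_elem_union_sub_le (c := m + 2) (K := C5 * δ * p) h.disj hx
      (by positivity) (fun d hd => v2 d (by omega))
    have h2 := h.coeff_le (b := B.card) (c := m + 2) le_rfl (by omega)
        (K := C5 * δ * p) (by positivity)
    rw [show B.card + (m + 2) = κ + 2 by have := h.card_add; omega, ← hb, ← hrdef] at h1
    have h3 : 0 ≤ 2 ^ B.card * (C5 * δ * p) := by positivity
    have h4 : 0 ≤ (κ + 5) * 2 ^ n * (C5 * δ * p) := by positivity
    rw [hE]
    linarith
  have hC3' : E * (C5 * δ * p) + n * δ * p = C3 * δ * p := by rw [hC3, hC5]; ring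
  have hnp : 0 ≤ n * δ * p := by positivity
  have low1 : d * p - E * |r| - C3 * δ * p ≤ P := by
    have := (abs_le.1 hP_sub).1
    have : d * p ≤ b * p := mul_le_mul_of_nonneg_right hbge hp.le
    linarith
  -- From f = R + P > 0: if r < 0 then P > -R, and -R is close to b |r|.
  have low2 : d * |r| - C3 * δ * p ≤ P := by
    rcases le_or_gt 0 r with hr | hr
    · rw [abs_of_nonneg hr]
      have h1 : d * r ≤ 1 * r := mul_le_mul_of_nonneg_right hd1 hr
      have h2 : 0 ≤ E * (C5 * δ * p) := by positivity
      linarith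
    · have h1 := (abs_le.1 hR_sub).2
      have h2 : d * |r| ≤ b * |r| := mul_le_mul_of_nonneg_right hbge (abs_nonneg _)
      rw [abs_of_neg hr] at h2 ⊢
      linarith
  -- P ≈ b p alone may fail to dominate when |r| is large, and then the second lower bound takes
  -- over. The combination d · `low1` + E · `low2` eliminates |r|.
  have low : p ≤ C4 * P := by
    have h1 := mul_le_mul_of_nonneg_left low1 hd0.le
    have h2 := mul_le_mul_of_nonneg_left low2 (by positivity : 0 ≤ E)
    have h3 := mul_le_mul_of_nonneg_right hδb hp.le
    have h4 : (d + E) * (C3 * δ * p) ≤ (1 + E) * (C3 * δ * p) := by gcongr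
    have h5 : (d + E) * P ≤ (1 + E) * P := by gcongr
    rw [hC4, div_mul_eq_mul_div, le_div_iff₀ (by positivity)]
    linarith
  have hECp : 0 ≤ E * (C2 + C5) * p := by positivity
  have h2p : 0 ≤ C2 * p := by positivity
  have h4p : 0 ≤ C4 * p := by positivity
  have h5p : 0 ≤ C5 * p := by positivity
  have up : P ≤ p + E * (C2 + C5) * p := by
    have h1 := (abs_le.1 hP_sub).2
    have h2 : b * p ≤ p := mul_le_of_le_one_left hp.le hble
    have h3 : E * (|r| + C5 * δ * p) ≤ E * (C2 * p + C5 * p) := by gcongr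
    linarith
  refine ⟨low.trans (mul_le_mul_of_nonneg_right ?_ hP.le), ?_, fun d hd => ?_, fun d hd => ?_,
    fun i hi d hd => ?_⟩
  · have : 0 < E * (C2 + C5) := by positivity
    linarith
  · linarith
  · have := v3 d hd
    linarith
  · have h1 := v2 d hd
    have h2 : C5 * (δ * p) ≤ (1 + E * (C2 + C5) + C2 + C4 + C5) * (δ * p) := by
      refine mul_le_mul_of_nonneg_right ?_ (by positivity)
      have : 0 < E * (C2 + C5) := by positivity
      linarith
    linarith
  · have := v1 i hi d hd
    linarith

/-- The estimates for the symmetric functions of a vector with a spectral gap. -/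
lemma exists_gap_bounds (n κ : ℕ) {D : ℝ} (hD : 0 < D) (hD1 : D ≤ 1) :
    ∃ C : ℝ, 1 ≤ C ∧ ∃ δ₀ : ℝ, 0 < δ₀ ∧ δ₀ ≤ 1 / 2 ∧
      ∀ (m : ℕ) (δ : ℝ) (o : ι) (B S : Finset ι) (x : ι → ℝ), 0 < δ → δ ≤ δ₀ →
        SpectralGap n κ m D δ o B S x →
        (∀ i ∈ S, elem (B ∪ S) (κ + 1) x ≤ C * δ * elem ((B ∪ S).erase i) κ x) ∧
        (∀ j ∈ B, |elem ((B ∪ S).erase j) (κ + 2) x| ≤ C * δ * elem (B ∪ S) (κ + 1) x) ∧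
        ∀ j ∈ B, ∀ i ∈ (B ∪ S).erase j, elem (((B ∪ S).erase j).erase i) (κ + 1) x ^ 2 ≤
          C * δ * elem (B ∪ S) (κ + 1) x * elem ((insert o (B ∪ S)).erase i) (κ + 1) x := by
  obtain ⟨C, hC, δ₁, hδ₁, hδ₁', key⟩ := exists_small_bounds (ι := ι) n κ hD hD1
  obtain ⟨d, hd⟩ : ∃ t : ℝ, t = D ^ κ := ⟨_, rfl⟩
  have hd0 : 0 < d := by rw [hd]; positivity
  have hd1 : d ≤ 1 := hd ▸ pow_le_one₀ hD.le hD1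
  obtain ⟨E, hE⟩ : ∃ t : ℝ, t = (κ + 5) * 2 ^ n := ⟨_, rfl⟩
  have hE0 : 0 < E := by rw [hE]; positivity
  have hn0 : (0 : ℝ) ≤ n := n.cast_nonneg
  obtain ⟨C6, hC6⟩ : ∃ t : ℝ, t = (n + 2) + C * (n + 1) := ⟨_, rfl⟩
  have hC60 : 0 < C6 := by rw [hC6]; positivity
  obtain ⟨C7, hC7⟩ : ∃ t : ℝ, t = 2 / d * (C * (n + 1)) := ⟨_, rfl⟩
  have hC70 : 0 < C7 := by rw [hC7]; positivity
  obtain ⟨C8, hC8⟩ : ∃ t : ℝ, t = E * (C * C) := ⟨_, rfl⟩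
  have hC80 : 0 < C8 := by rw [hC8]; positivity
  refine ⟨1 + C * C7 + C8 + C8 ^ 2 + 2 * C8 ^ 2 * (C * C7), by
    have : 0 < C * C7 := by positivity
    have : 0 < C8 ^ 2 := by positivity
    have : 0 < 2 * C8 ^ 2 * (C * C7) := by positivity
    linarith, min (1 / 2) (min δ₁ (d / (2 * (E * C6)))), by positivity, min_le_left _ _, ?_⟩
  intro m δ o B S x hδ0 hδ h
  have hδ2 : δ ≤ 1 / 2 := hδ.trans (min_le_left _ _)
  have hδa : E * C6 * δ ≤ d / 2 := by
    have := (hδ.trans (min_le_right _ _)).trans (min_le_right _ _)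
    rw [le_div_iff₀ (by positivity)] at this
    linarith
  obtain ⟨lo, up, w1, w2, w3⟩ := key m δ o B S x hδ0
    ((hδ.trans (min_le_right _ _)).trans (min_le_left _ _)) h
  have hS := h.garding_small
  have hT := h.garding_union
  have hp := hS (m + 1) le_rfl
  have hP := hT (κ + 1) le_rfl
  have hx := h.abs_big_le hD
  have hbge := h.prod_big_ge hD hD1
  rw [← hd] at hbge
  have hca := h.card_add
  obtain ⟨p, hpdef⟩ : ∃ t, t = elem S (m + 1) x := ⟨_, rfl⟩
  obtain ⟨P, hPdef⟩ : ∃ t, t = elem (B ∪ S) (κ + 1) x := ⟨_, rfl⟩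
  rw [← hpdef] at lo up w1 w2 w3 hp
  rw [← hPdef] at lo up hP ⊢
  have hpi : ∀ i ∈ S, p ≤ (n + 1) * δ * elem (S.erase i) m x := fun i hi => by
    rw [hpdef]; exact elem_le_small_mul_erase hS hδ0.le h.small h.card_small_le hi
  have hpi0 : ∀ i ∈ S, 0 < elem (S.erase i) m x := fun i hi => elem_erase_pos hS hi
  have hmemS : ∀ i ∈ S, i ∉ B := fun i hi hB => Finset.disjoint_left.1 h.disj hB hi
  have hmemB : ∀ i ∈ B, i ∉ S := fun i hi hB => Finset.disjoint_left.1 h.disj hi hB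
  have erS : ∀ i ∈ S, (B ∪ S).erase i = B ∪ S.erase i := fun i hi => by
    rw [Finset.erase_union_distrib, Finset.erase_eq_of_notMem (hmemS i hi)]
  have erB : ∀ j ∈ B, (B ∪ S).erase j = B.erase j ∪ S := fun j hj => by
    rw [Finset.erase_union_distrib, Finset.erase_eq_of_notMem (hmemB j hj)]
  -- P_i has main term b times the degree `m` function of `S.erase i`, which exceeds p by a factor
  -- of order 1/δ.
  have hPi : ∀ i ∈ S, p ≤ C7 * δ * elem ((B ∪ S).erase i) κ x := fun i hi => by
    have e1 := hpi i hi
    have e2 := hpi0 i hi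
    have hd' : Disjoint B (S.erase i) := h.disj.mono_right (Finset.erase_subset _ _)
    have h1 := abs_elem_union_sub_le (c := m) (K := C6 * δ * elem (S.erase i) m x) hd' hx
      (by positivity) (fun d hd => ?_)
    · have h2 := h.coeff_le (b := B.card) (c := m) le_rfl (by omega)
        (K := C6 * δ * elem (S.erase i) m x) (by positivity)
      rw [hca, ← erS i hi] at h1
      have h3 : 0 ≤ 2 ^ B.card * (C6 * δ * elem (S.erase i) m x) := by positivity
      rw [← hE] at h2
      have h4 := (abs_le.1 h1).1
      have h5 := mul_le_mul_of_nonneg_right hδa e2.le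
      have h6 := mul_le_mul_of_nonneg_right hbge e2.le
      have h7 : d / 2 * elem (S.erase i) m x ≤ elem ((B ∪ S).erase i) κ x := by linarith
      have h8 : elem (S.erase i) m x ≤ 2 / d * elem ((B ∪ S).erase i) κ x := by
        rw [div_mul_eq_mul_div, le_div_iff₀ hd0]
        linarith
      have h9 : (n + 1) * δ * elem (S.erase i) m x ≤
          (n + 1) * δ * (2 / d * elem ((B ∪ S).erase i) κ x) := by gcongr
      have h10 : (n + 1) * δ * (2 / d * elem ((B ∪ S).erase i) κ x) =
        2 / d * (n + 1) * δ * elem ((B ∪ S).erase i) κ x := by ring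
      have h11 : 0 < elem ((B ∪ S).erase i) κ x := elem_erase_pos hT (Finset.mem_union_right _ hi)
      have h12 : 2 / d * (n + 1) * δ * elem ((B ∪ S).erase i) κ x ≤
          C7 * δ * elem ((B ∪ S).erase i) κ x := by
        have : 2 / d * (1 * (n + 1)) ≤ C7 := by rw [hC7]; gcongr
        rw [one_mul] at this
        gcongr
      linarith
    · rcases Nat.lt_or_ge (m + 1) d with h' | h'
      · refine (w3 i hi d h').trans ?_
        have := mul_le_mul_of_nonneg_left e1 (by linarith : 0 ≤ C)
        refine this.trans ?_
        have h8 : C * (n + 1) ≤ C6 := by rw [hC6]; linarith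
        calc _ = C * (n + 1) * δ * elem (S.erase i) m x := by ring
          _ ≤ _ := by gcongr
      · obtain rfl : d = m + 1 := by omega
        have e3 := elem_erase hi m x
        rw [← hpdef] at e3
        have e4 : |x i * elem (S.erase i) m x| ≤ δ * elem (S.erase i) m x := by
          rw [abs_mul, abs_of_pos e2]
          exact mul_le_mul_of_nonneg_right (h.small i hi) e2.le
        have e5 : (n + 2) * δ * elem (S.erase i) m x ≤ C6 * δ * elem (S.erase i) m x := by
          have h8 : (n : ℝ) + 2 ≤ C6 := by rw [hC6]; have : 0 ≤ C * (n + 1) := by positivity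
                                           linarith
          gcongr
        rw [abs_le] at e4 ⊢
        constructor <;> linarith
  -- Every product with too few large factors available must take at least m + 3 factors from `S`,
  -- where the symmetric functions carry a factor δ.
  have big2 : ∀ B' : Finset ι, ∀ c, B' ⊆ B → c = m + 3 → |elem (B' ∪ S) (B'.card + c) x| ≤
      C8 * δ * P := fun B' c hB' hc => by
    have hd' : Disjoint B' S := h.disj.mono_left hB'
    have h1 := abs_elem_union_le (c := c) (K := C * δ * p) hd' (fun j hj => hx j (hB' hj))
      (by positivity) (fun d hd => w2 d (by omega))
    have h2 := h.coeff_le (b := B'.card) (c := c) (Finset.card_le_card hB') (by omega)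
        (K := C * δ * p) (by positivity)
    refine (h1.trans h2).trans ?_
    calc (κ + 5) * 2 ^ n * (C * δ * p) ≤ (κ + 5) * 2 ^ n * (C * δ * (C * P)) := by gcongr
      _ = _ := by rw [hC8, hE]; ring
  have hC8P : 0 ≤ C8 * δ * P := by positivity
  refine ⟨fun i hi => ?_, fun j hj => ?_, fun j hj i hi => ?_⟩
  · have h11 : 0 < elem ((B ∪ S).erase i) κ x := elem_erase_pos hT (Finset.mem_union_right _ hi)
    calc P ≤ C * p := up
      _ ≤ C * (C7 * δ * elem ((B ∪ S).erase i) κ x) := by gcongr; exact hPi i hi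
      _ = C * C7 * δ * elem ((B ∪ S).erase i) κ x := by ring
      _ ≤ _ := by
        gcongr
        have : 0 < C8 ^ 2 := by positivity
        have : 0 < 2 * C8 ^ 2 * (C * C7) := by positivity
        linarith
  · have h1 := big2 (B.erase j) (m + 3) (Finset.erase_subset _ _) rfl
    have h2 := Finset.card_erase_add_one hj
    rw [show (B.erase j).card + (m + 3) = κ + 2 by omega, ← erB j hj] at h1
    refine h1.trans ?_
    gcongr
    have : 0 < C8 ^ 2 := by positivity
    have : 0 < 2 * C8 ^ 2 * (C * C7) := by positivity
    have : 0 < C * C7 := by positivity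
    linarith
  · obtain ⟨hij, hiT⟩ := Finset.mem_erase.1 hi
    have hfi := elem_erase_insert h.notMem hiT h.lead κ
    rw [← hPdef] at hfi
    have hPi0 : 0 < elem ((B ∪ S).erase i) κ x := elem_erase_pos hT hiT
    rw [hfi, erB j hj]
    have h2 := Finset.card_erase_add_one hj
    rcases Finset.mem_union.1 hiT with hiB | hiS
    · have h3 : i ∈ B.erase j := Finset.mem_erase.2 ⟨hij, hiB⟩
      have h4 := Finset.card_erase_add_one h3
      have h1 := big2 ((B.erase j).erase i) (m + 3)
        ((Finset.erase_subset _ _).trans (Finset.erase_subset _ _)) rfl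
      rw [show ((B.erase j).erase i).card + (m + 3) = κ + 1 by omega] at h1
      rw [Finset.erase_union_distrib, Finset.erase_eq_of_notMem (hmemB i hiB)]
      have h5 : P ≤ P + (1 - x i) * elem ((B ∪ S).erase i) κ x := by
        have := mul_nonneg (sub_nonneg.2 (h.big_le i hiB)) hPi0.le
        linarith
      rw [← sq_abs]
      calc _ ≤ (C8 * δ * P) ^ 2 := pow_le_pow_left₀ (abs_nonneg _) h1 2
        _ = C8 ^ 2 * δ * δ * P * P := by ring
        _ ≤ C8 ^ 2 * δ * 1 * P * (P + (1 - x i) * elem ((B ∪ S).erase i) κ x) := by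
            gcongr
            linarith
        _ ≤ _ := by
            rw [mul_one]
            have : 0 < 2 * C8 ^ 2 * (C * C7) := by positivity
            have : 0 < C * C7 := by positivity
            gcongr <;> linarith
    -- With one small index removed only m + 2 factors from `S` are forced, which gives no
    -- smallness; the factor δ comes from p ≤ C7 δ P_i instead.
    · have hd' : Disjoint (B.erase j) (S.erase i) :=
        h.disj.mono (Finset.erase_subset _ _) (Finset.erase_subset _ _)
      have h1 := abs_elem_union_le (c := m + 2) (K := C * p) hd'
        (fun j hj => hx j (Finset.mem_of_mem_erase hj)) (by positivity)
        (fun d hd => w3 i hiS d hd)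
      have h3 := h.coeff_le (b := (B.erase j).card) (c := m + 2)
        (Finset.card_le_card (Finset.erase_subset _ _)) (by omega) (K := C * p) (by positivity)
      rw [show (B.erase j).card + (m + 2) = κ + 1 by omega] at h1
      rw [Finset.erase_union_distrib, Finset.erase_eq_of_notMem
        (fun h' => hmemS i hiS (Finset.mem_of_mem_erase h'))]
      rw [← hE] at h3
      have h4 := h1.trans h3
      have h5 : 1 / 2 * elem ((B ∪ S).erase i) κ x ≤
          P + (1 - x i) * elem ((B ∪ S).erase i) κ x := by
        have h6 := (abs_le.1 (h.small i hiS)).2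
        have := mul_le_mul_of_nonneg_right (show (1 : ℝ) / 2 ≤ 1 - x i by linarith) hPi0.le
        linarith
      have h6 : 0 ≤ P + (1 - x i) * elem ((B ∪ S).erase i) κ x := by
        have : 0 ≤ 1 / 2 * elem ((B ∪ S).erase i) κ x := by positivity
        linarith
      have h7 : E * (C * p) ≤ C8 * P := by
        calc E * (C * p) ≤ E * (C * (C * P)) := by gcongr
          _ = _ := by rw [hC8]; ring
      rw [← sq_abs, sq]
      calc _ ≤ C8 * P * (E * (C * p)) :=
            mul_le_mul (h4.trans h7) h4 (abs_nonneg _) (by positivity)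
        _ ≤ C8 * P * (E * (C * (C7 * δ * elem ((B ∪ S).erase i) κ x))) := by
            gcongr; exact hPi i hiS
        _ = 2 * (C8 * (E * C) * C7) * δ * P * (1 / 2 * elem ((B ∪ S).erase i) κ x) := by ring
        _ ≤ 2 * (C8 * (E * C) * C7) * δ * P *
            (P + (1 - x i) * elem ((B ∪ S).erase i) κ x) := by gcongr
        _ ≤ _ := by
            have e1 : 2 * (C8 * (E * C) * C7) ≤ 2 * C8 ^ 2 * (C * C7) := by
              have : E * C ≤ C8 := by
                rw [hC8, ← mul_assoc]
                exact le_mul_of_one_le_right (by positivity) hC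
              calc 2 * (C8 * (E * C) * C7) ≤ 2 * (C8 * C8 * (C * C7)) := by
                    have : C7 ≤ C * C7 := le_mul_of_one_le_left hC70.le hC
                    gcongr
                _ = _ := by ring
            have : 0 < C8 ^ 2 := by positivity
            have : 0 < C * C7 := by positivity
            gcongr
            linarith

/-! ### The sum-of-squares identity restricted to the small variables, and its derivative. -/

section Identities

variable {B S : Finset ι}

/-- For j in `B`, x_j² P_j = P x_j - R + R_j. Subtracting these terms from the full identity lowers
the coefficient of R by |B|; with k = κ it becomes m + 2. -/
lemma sum_sq_mul_elem_erase_union (hd : Disjoint B S) (k : ℕ) (x : ι → ℝ) :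
    ∑ i ∈ S, x i ^ 2 * elem ((B ∪ S).erase i) k x =
      elem (B ∪ S) (k + 1) x * ∑ i ∈ S, x i - (k + 2 - B.card) * elem (B ∪ S) (k + 2) x
        - ∑ j ∈ B, elem ((B ∪ S).erase j) (k + 2) x := by
  have h := sum_sq_mul_elem_erase (B ∪ S) k x
  rw [Finset.sum_union hd, Finset.sum_union hd] at h
  have h1 : ∀ j ∈ B, x j ^ 2 * elem ((B ∪ S).erase j) k x = elem (B ∪ S) (k + 1) x * x j
      - elem (B ∪ S) (k + 2) x + elem ((B ∪ S).erase j) (k + 2) x := fun j hj => by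
    have hj' : j ∈ B ∪ S := Finset.mem_union_left _ hj
    rw [elem_erase hj' (k + 1), elem_erase hj' k]
    ring
  rw [Finset.sum_congr rfl h1, Finset.sum_add_distrib, Finset.sum_sub_distrib, Finset.sum_const,
    ← Finset.mul_sum, nsmul_eq_mul] at h
  linarith

/-- The previous identity holds along the whole line x + t y, so the derivatives of its two sides at
t = 0 agree. -/
lemma sum_sq_mul_elemD_erase_union (hd : Disjoint B S) (k : ℕ) (x y : ι → ℝ) :
    ∑ i ∈ S, (2 * x i * y i * elem ((B ∪ S).erase i) k x
        + x i ^ 2 * elemD ((B ∪ S).erase i) k x y) =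
      elemD (B ∪ S) (k + 1) x y * ∑ i ∈ S, x i + elem (B ∪ S) (k + 1) x * ∑ i ∈ S, y i
        - (k + 2 - B.card) * elemD (B ∪ S) (k + 2) x y
        - ∑ j ∈ B, elemD ((B ∪ S).erase j) (k + 2) x y := by
  have hx : ∀ i, HasDerivAt (fun t : ℝ => (x + t • y) i) (y i) 0 := fun i => by
    simpa using ((hasDerivAt_id (0 : ℝ)).mul_const (y i)).const_add (x i)
  have he : ∀ T : Finset ι, ∀ k, HasDerivAt (fun t : ℝ => elem T k (x + t • y))
      (elemD T k x y) 0 := fun T k => by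
    simpa using hasDerivAt_elem T k x y 0
  have h1 : HasDerivAt (fun t : ℝ => ∑ i ∈ S, (x + t • y) i ^ 2
      * elem ((B ∪ S).erase i) k (x + t • y)) (∑ i ∈ S, (2 * x i * y i
        * elem ((B ∪ S).erase i) k x + x i ^ 2 * elemD ((B ∪ S).erase i) k x y)) 0 :=
    HasDerivAt.fun_sum fun i _ => by
      exact (((hx i).fun_pow 2).fun_mul (he ((B ∪ S).erase i) k)).congr_deriv (by simp)
  have h2 := (((he (B ∪ S) (k + 1)).mul (HasDerivAt.fun_sum fun i (_ : i ∈ S) => hx i)).sub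
    ((he (B ∪ S) (k + 2)).const_mul ((k : ℝ) + 2 - B.card))).sub
    (HasDerivAt.fun_sum fun j (_ : j ∈ B) => he ((B ∪ S).erase j) (k + 2))
  have h3 := h1.unique (h2.congr_of_eventuallyEq (Filter.Eventually.of_forall fun t =>
    sum_sq_mul_elem_erase_union hd k (x + t • y)))
  rw [h3]
  simp

end Identities

/-! ### Bounds for the degree κ + 2 function and its gradient under gap estimates. -/

/-- The vector `x` has a spectral gap, and the symmetric functions of the variables other than the
leading one satisfy the resulting estimates, with constant `C`. -/
structure GapEstimates (n κ m : ℕ) (D δ C : ℝ) (o : ι) (B S : Finset ι) (x : ι → ℝ) : Prop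
    extends SpectralGap n κ m D δ o B S x where
  pos : 0 < D
  delta_pos : 0 < δ
  delta_le : δ ≤ 1 / 2
  one_le : 1 ≤ C
  small_le : ∀ i ∈ S, elem (B ∪ S) (κ + 1) x ≤ C * δ * elem ((B ∪ S).erase i) κ x
  big_rest_le : ∀ j ∈ B, |elem ((B ∪ S).erase j) (κ + 2) x| ≤ C * δ * elem (B ∪ S) (κ + 1) x
  big_deriv_le : ∀ j ∈ B, ∀ i ∈ (B ∪ S).erase j,
    elem (((B ∪ S).erase j).erase i) (κ + 1) x ^ 2 ≤
      C * δ * elem (B ∪ S) (κ + 1) x * elem ((insert o (B ∪ S)).erase i) (κ + 1) x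

/-- The quadratic form carried by the variables other than the leading one. -/
noncomputable def restForm (κ : ℕ) (o : ι) (T : Finset ι) (x ξ : ι → ℝ) : ℝ :=
  ∑ i ∈ T, elem ((insert o T).erase i) (κ + 1) x * ξ i ^ 2

namespace GapEstimates

variable {n κ m : ℕ} {D δ C : ℝ} {o : ι} {B S : Finset ι} {x : ι → ℝ}

lemma P_pos (h : GapEstimates n κ m D δ C o B S x) : 0 < elem (B ∪ S) (κ + 1) x :=
  h.garding_union (κ + 1) le_rfl

lemma erase_pos (h : GapEstimates n κ m D δ C o B S x) {i : ι} (hi : i ∈ B ∪ S) :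
    0 < elem ((B ∪ S).erase i) κ x := elem_erase_pos h.garding_union hi

lemma f_eq (h : GapEstimates n κ m D δ C o B S x) : elem (insert o (B ∪ S)) (κ + 2) x =
    elem (B ∪ S) (κ + 2) x + elem (B ∪ S) (κ + 1) x := by
  rw [elem_insert h.notMem, h.lead, one_mul]

lemma f_pos (h : GapEstimates n κ m D δ C o B S x) : 0 < elem (insert o (B ∪ S)) (κ + 2) x :=
  h.garding _ le_rfl

lemma coeff_pos (h : GapEstimates n κ m D δ C o B S x) {i : ι} (hi : i ∈ B ∪ S) :
    0 < elem ((insert o (B ∪ S)).erase i) (κ + 1) x :=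
  elem_erase_pos h.garding (Finset.mem_insert_of_mem hi)

lemma coeff_ge_small (h : GapEstimates n κ m D δ C o B S x) {i : ι} (hi : i ∈ S) :
    (1 - δ) * elem ((B ∪ S).erase i) κ x ≤ elem ((insert o (B ∪ S)).erase i) (κ + 1) x := by
  have hi' : i ∈ B ∪ S := Finset.mem_union_right _ hi
  rw [elem_erase_insert h.notMem hi' h.lead]
  have h1 := h.P_pos
  have h2 := mul_le_mul_of_nonneg_right (abs_le.1 (h.small i hi)).2 (h.erase_pos hi').le
  linarith

lemma coeff_ge_big (h : GapEstimates n κ m D δ C o B S x) {j : ι} (hj : j ∈ B) :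
    elem (B ∪ S) (κ + 1) x ≤ elem ((insert o (B ∪ S)).erase j) (κ + 1) x := by
  have hj' : j ∈ B ∪ S := Finset.mem_union_left _ hj
  rw [elem_erase_insert h.notMem hj' h.lead]
  have := mul_nonneg (sub_nonneg.2 (h.big_le j hj)) (h.erase_pos hj').le
  linarith

lemma restForm_nonneg (h : GapEstimates n κ m D δ C o B S x) (ξ : ι → ℝ) :
    0 ≤ restForm κ o (B ∪ S) x ξ :=
  Finset.sum_nonneg fun _ hi => mul_nonneg (h.coeff_pos hi).le (sq_nonneg _)

/-- Cauchy-Schwarz with the weights of `restForm`: each of the at most n coefficients contributes at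
most t. -/
lemma sq_sum_le (h : GapEstimates n κ m D δ C o B S x) (ξ : ι → ℝ) {A : Finset ι}
    (hA : A ⊆ B ∪ S) {c : ι → ℝ} {t : ℝ}
    (ht : ∀ i ∈ A, c i ^ 2 ≤ t * elem ((insert o (B ∪ S)).erase i) (κ + 1) x) (ht0 : 0 ≤ t) :
    (∑ i ∈ A, ξ i * c i) ^ 2 ≤ n * t * restForm κ o (B ∪ S) x ξ := by
  refine (sum_mul_sq_le_sum_div_mul_sum fun i hi => h.coeff_pos (hA hi)).trans ?_
  have h1 : ∑ i ∈ A, c i ^ 2 / elem ((insert o (B ∪ S)).erase i) (κ + 1) x ≤ n * t := by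
    calc _ ≤ ∑ _i ∈ A, t := Finset.sum_le_sum fun i hi => by
          rw [div_le_iff₀ (h.coeff_pos (hA hi))]; exact ht i hi
      _ = A.card * t := by rw [Finset.sum_const, nsmul_eq_mul]
      _ ≤ n * t := by
          have : (A.card : ℝ) ≤ n := by
            exact_mod_cast (Finset.card_le_card hA).trans h.card_le
          gcongr
  have h2 : ∑ i ∈ A, elem ((insert o (B ∪ S)).erase i) (κ + 1) x * ξ i ^ 2 ≤
      restForm κ o (B ∪ S) x ξ :=
    Finset.sum_le_sum_of_subset_of_nonneg hA
      fun i hi _ => mul_nonneg (h.coeff_pos hi).le (sq_nonneg _)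
  exact mul_le_mul h1 h2 (Finset.sum_nonneg fun i hi =>
    mul_nonneg (h.coeff_pos (hA hi)).le (sq_nonneg _)) (by positivity)

/-- In the restricted identity, P ∑_{i ∈ S} x_i and the terms R_j with j in `B` are of order δ P.
This yields both the upper bound for R/P and, when R = -QP, the relation ∑ x_i² P_i / P ≈ (m + 2) Q.
-/
lemma sum_sq_small (h : GapEstimates n κ m D δ C o B S x) :
    |∑ i ∈ S, x i ^ 2 * elem ((B ∪ S).erase i) κ x + (m + 2) * elem (B ∪ S) (κ + 2) x| ≤
      2 * n * C * δ * elem (B ∪ S) (κ + 1) x := by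
  have hP := h.P_pos
  have hn : (0 : ℝ) ≤ n := n.cast_nonneg
  have hδ := h.delta_pos
  have hC := h.one_le
  rw [sum_sq_mul_elem_erase_union h.disj]
  have hc : ((B.card : ℝ) + m) = κ := by exact_mod_cast h.card_add
  have h1 : |elem (B ∪ S) (κ + 1) x * ∑ i ∈ S, x i| ≤ n * δ * elem (B ∪ S) (κ + 1) x := by
    rw [abs_mul, abs_of_pos hP, mul_comm]
    exact mul_le_mul_of_nonneg_right (abs_sum_le_card_mul h.small h.card_small_le hδ.le) hP.le
  have h2 : |∑ j ∈ B, elem ((B ∪ S).erase j) (κ + 2) x| ≤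
      n * (C * δ * elem (B ∪ S) (κ + 1) x) := by
    refine (Finset.abs_sum_le_sum_abs _ _).trans ((Finset.sum_le_sum h.big_rest_le).trans ?_)
    rw [Finset.sum_const, nsmul_eq_mul]
    have : (B.card : ℝ) ≤ n := by exact_mod_cast h.card_big_le
    gcongr
  have h3 : n * δ * elem (B ∪ S) (κ + 1) x ≤ C * (n * δ * elem (B ∪ S) (κ + 1) x) :=
    le_mul_of_one_le_left (by positivity) hC
  rw [show ((κ : ℝ) + 2 - B.card) = m + 2 by linarith]
  rw [abs_le] at *
  constructor <;> linarith

/-- The degree `κ + 2` symmetric function of the variables other than the leading one cannot be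
large and positive. -/
lemma quotient_le (h : GapEstimates n κ m D δ C o B S x) :
    elem (B ∪ S) (κ + 2) x ≤ 2 * n * C * δ * elem (B ∪ S) (κ + 1) x := by
  have h1 : 0 ≤ ∑ i ∈ S, x i ^ 2 * elem ((B ∪ S).erase i) κ x := Finset.sum_nonneg fun i hi =>
    mul_nonneg (sq_nonneg _) (h.erase_pos (Finset.mem_union_right _ hi)).le
  have h2 := (abs_le.1 h.sum_sq_small).2
  have hm : (0 : ℝ) ≤ m := m.cast_nonneg
  rcases le_or_gt (elem (B ∪ S) (κ + 2) x) 0 with h3 | h3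
  · have := h.P_pos
    have := h.delta_pos
    have := h.one_le
    exact h3.trans (by positivity)
  · have := mul_nonneg hm h3.le
    linarith

/-- The gradient of the degree `κ + 2` symmetric function is small when its value is. -/
lemma sq_elemD_le (h : GapEstimates n κ m D δ C o B S x) (ξ : ι → ℝ) {t : ℝ} (ht1 : t ≤ 1)
    (ht : |elem (B ∪ S) (κ + 2) x| ≤ t * elem (B ∪ S) (κ + 1) x)
    (htδ : (2 * n + 1) * C * δ ≤ t) :
    elemD (B ∪ S) (κ + 2) x ξ ^ 2 ≤
      (4 * n + 4 * (κ + 3) + 4 * n / D ^ 2) * t * elem (B ∪ S) (κ + 1) x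
        * restForm κ o (B ∪ S) x ξ := by
  have hP := h.P_pos
  have hn : (0 : ℝ) ≤ n := n.cast_nonneg
  have hκ : (0 : ℝ) ≤ κ := κ.cast_nonneg
  have hδ := h.delta_pos
  have hδ2 := h.delta_le
  have hC := h.one_le
  have hD := h.pos
  obtain ⟨P, hPe⟩ : ∃ t, t = elem (B ∪ S) (κ + 1) x := ⟨_, rfl⟩
  have hsq := h.sum_sq_small
  have hbr := h.big_rest_le
  have hsl := h.small_le
  have hcb := fun j hj => h.coeff_ge_big (j := j) hj
  rw [← hPe] at hP ht hsq hbr hsl hcb ⊢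
  have hnCδ : 0 ≤ 2 * n * C * δ := by positivity
  have hCδ : C * δ ≤ t := by linarith
  have hCδ0 : 0 < C * δ := by positivity
  have ht0 : 0 < t := hCδ0.trans_le hCδ
  rw [elemD_succ]
  refine (sum_mul_sq_le_sum_div_mul_sum fun i hi => h.coeff_pos hi).trans ?_
  refine mul_le_mul_of_nonneg_right ?_ (h.restForm_nonneg ξ)
  rw [Finset.sum_union h.disj]
  -- For small i, ∂_i R = P - x_i P_i: here P² is of order δ P P_i, and the sum of the x_i² P_i is
  -- bounded by |R| and δ P.
  have hS : ∑ i ∈ S, elem ((B ∪ S).erase i) (κ + 1) x ^ 2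
      / elem ((insert o (B ∪ S)).erase i) (κ + 1) x ≤ (4 * n + 4 * (κ + 3)) * t * P := by
    have h1 : ∀ i ∈ S, elem ((B ∪ S).erase i) (κ + 1) x ^ 2
        / elem ((insert o (B ∪ S)).erase i) (κ + 1) x ≤
        4 * (C * δ) * P + 4 * (x i ^ 2 * elem ((B ∪ S).erase i) κ x) := fun i hi => by
      have hi' : i ∈ B ∪ S := Finset.mem_union_right _ hi
      have hpi := h.erase_pos hi'
      have hci := h.coeff_ge_small hi
      have hci' : 1 / 2 * elem ((B ∪ S).erase i) κ x ≤
          elem ((insert o (B ∪ S)).erase i) (κ + 1) x :=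
        le_trans (mul_le_mul_of_nonneg_right (by linarith) hpi.le) hci
      have e := elem_erase hi' κ x
      rw [← hPe] at e
      rw [div_le_iff₀ (h.coeff_pos hi')]
      have h2 : elem ((B ∪ S).erase i) (κ + 1) x ^ 2 ≤
          2 * P ^ 2 + 2 * (x i ^ 2 * elem ((B ∪ S).erase i) κ x ^ 2) := by
        have := sq_nonneg (P + x i * elem ((B ∪ S).erase i) κ x)
        have e' : elem ((B ∪ S).erase i) (κ + 1) x = P - x i * elem ((B ∪ S).erase i) κ x := by
          linarith
        rw [e']
        linarith
      have h3 : P ^ 2 ≤ C * δ * P * elem ((B ∪ S).erase i) κ x := by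
        have := mul_le_mul_of_nonneg_left (hsl i hi) hP.le
        linarith
      have h4 := mul_le_mul_of_nonneg_left hci'
        (by positivity : 0 ≤ 4 * (C * δ) * P + 4 * (x i ^ 2 * elem ((B ∪ S).erase i) κ x))
      linarith
    refine (Finset.sum_le_sum h1).trans ?_
    rw [Finset.sum_add_distrib, Finset.sum_const, nsmul_eq_mul, ← Finset.mul_sum]
    have h2 : (S.card : ℝ) * (4 * (C * δ) * P) ≤ n * (4 * t * P) := by
      have : (S.card : ℝ) ≤ n := by exact_mod_cast h.card_small_le
      gcongr
    have h3 : ∑ i ∈ S, x i ^ 2 * elem ((B ∪ S).erase i) κ x ≤ (κ + 3) * t * P := by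
      have h4 := (abs_le.1 hsq).2
      have h5 := mul_le_mul_of_nonneg_left (abs_le.1 ht).1 (by positivity : 0 ≤ (m : ℝ) + 2)
      have h6 : (m : ℝ) ≤ κ := by
        have := h.card_add
        exact_mod_cast (by omega : m ≤ κ)
      have h7 := mul_le_mul_of_nonneg_right h6 (by positivity : 0 ≤ t * P)
      have h8 : 2 * n * C * δ * P ≤ t * P :=
        mul_le_mul_of_nonneg_right (by linarith) hP.le
      linarith
    linarith
  -- For large i, x_i ∂_i R is R minus the same function without x_i. Both are small, and x_i ≥ D
  -- may be divided out.
  have hB : ∑ i ∈ B, elem ((B ∪ S).erase i) (κ + 1) x ^ 2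
      / elem ((insert o (B ∪ S)).erase i) (κ + 1) x ≤ 4 * n / D ^ 2 * t * P := by
    have h1 : ∀ i ∈ B, elem ((B ∪ S).erase i) (κ + 1) x ^ 2
        / elem ((insert o (B ∪ S)).erase i) (κ + 1) x ≤ 4 / D ^ 2 * t * P := fun i hi => by
      have hi' : i ∈ B ∪ S := Finset.mem_union_left _ hi
      have hDx := h.big_ge i hi
      have e := elem_erase hi' (κ + 1) x
      rw [div_le_iff₀ (h.coeff_pos hi')]
      have hr := hbr i hi
      have h2 : |x i * elem ((B ∪ S).erase i) (κ + 1) x| ≤ 2 * t * P := by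
        have h3 : C * δ * P ≤ t * P := mul_le_mul_of_nonneg_right hCδ hP.le
        rw [abs_le] at *
        constructor <;> linarith
      have h3 : D * |elem ((B ∪ S).erase i) (κ + 1) x| ≤ 2 * t * P := by
        refine le_trans ?_ h2
        rw [abs_mul, abs_of_pos (hD.trans_le hDx)]
        exact mul_le_mul_of_nonneg_right hDx (abs_nonneg _)
      have h4 : |elem ((B ∪ S).erase i) (κ + 1) x| ≤ 2 * t * P / D := by
        rw [le_div_iff₀ hD]; linarith
      rw [← sq_abs]
      calc _ ≤ (2 * t * P / D) ^ 2 := pow_le_pow_left₀ (abs_nonneg _) h4 2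
        _ = 4 / D ^ 2 * t * P * (t * P) := by ring
        _ ≤ 4 / D ^ 2 * t * P * (1 * P) := by gcongr
        _ ≤ _ := by rw [one_mul]; have := hcb i hi; gcongr
    refine (Finset.sum_le_sum h1).trans ?_
    rw [Finset.sum_const, nsmul_eq_mul]
    calc (B.card : ℝ) * (4 / D ^ 2 * t * P) ≤ n * (4 / D ^ 2 * t * P) := by
          have : (B.card : ℝ) ≤ n := by exact_mod_cast h.card_big_le
          gcongr
      _ = _ := by ring
  linarith

end GapEstimates

/-! ### The two scalar cases of the final estimate. -/

section RealInequalities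

variable {ε P R F G M Q a r t u y z : ℝ}

/-- Here z = u + (R a - r) / P with R and r small. Young's inequality with parameter ε keeps the
coefficient of u² below R + P; the term (R + P) a² absorbs R a, and F absorbs r. -/
lemma leading_sq_le_of_abs_le (hε0 : 0 < ε) (hε1 : ε < 1) (hP : 0 < P) (hR : |R| ≤ t * P)
    (ht0 : 0 < t) (ht1 : t ≤ 1 / 2) (htε : t ≤ ε ^ 2) (htε' : 8 * t ^ 2 ≤ ε) (hG : 4 * G ≤ ε)
    (hr : r ^ 2 ≤ G * P * F) (hF : 0 ≤ F) (hz : P * z = P * u + R * a - r) :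
    (1 - ε) * (P * z ^ 2) ≤ (R + P) * u ^ 2 + (R + P) * a ^ 2 + (1 - ε) * F := by
  have h1 : (R * a - r) ^ 2 ≤ 2 * (t ^ 2 * P ^ 2 * a ^ 2) + 2 * (G * P * F) := by
    have e1 : R ^ 2 * a ^ 2 ≤ t ^ 2 * P ^ 2 * a ^ 2 := by
      refine mul_le_mul_of_nonneg_right ?_ (sq_nonneg a)
      rw [← sq_abs R, ← mul_pow]
      exact pow_le_pow_left₀ (abs_nonneg _) hR 2
    have := sq_nonneg (R * a + r)
    linarith
  have h2 : ε * (P * z) ^ 2 ≤ ε * (1 + ε) * (P ^ 2 * u ^ 2) + (1 + ε) * (R * a - r) ^ 2 := by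
    rw [hz]
    have := sq_nonneg (ε * (P * u) - (R * a - r))
    linarith
  have h3 := mul_le_mul_of_nonneg_left h2 (by linarith : 0 ≤ 1 - ε)
  have h4 := mul_le_mul_of_nonneg_left h1 (mul_nonneg (by linarith : 0 ≤ 1 - ε)
    (by linarith : 0 ≤ 1 + ε))
  have hfP : (1 - t) * P ≤ R + P := by
    have := (abs_le.1 hR).1
    linarith
  have h5 : ε * (1 - ε ^ 2) * (P ^ 2 * u ^ 2) ≤ ε * P * ((R + P) * u ^ 2) := by
    have e1 : (1 - ε ^ 2) * P ≤ R + P :=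
      (mul_le_mul_of_nonneg_right (by linarith) hP.le).trans hfP
    have := mul_le_mul_of_nonneg_left e1 (by positivity : 0 ≤ ε * P * u ^ 2)
    linarith
  have h6 : (1 - ε) * (1 + ε) * (2 * (t ^ 2 * P ^ 2 * a ^ 2)) ≤ ε * P * ((R + P) * a ^ 2) := by
    have e1 : 1 / 2 * P ≤ R + P := (mul_le_mul_of_nonneg_right (by linarith) hP.le).trans hfP
    have e2 := mul_le_mul_of_nonneg_left e1 (by positivity : 0 ≤ ε * P * a ^ 2)
    have e3 := mul_le_mul_of_nonneg_right htε' (by positivity : 0 ≤ P ^ 2 * a ^ 2)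
    have e4 : (1 - ε) * (1 + ε) * (2 * (t ^ 2 * P ^ 2 * a ^ 2)) ≤
        1 * (2 * (t ^ 2 * P ^ 2 * a ^ 2)) := by
      refine mul_le_mul_of_nonneg_right ?_ (by positivity)
      have := sq_nonneg ε
      linarith
    have e5 : 0 ≤ ε * (P ^ 2 * a ^ 2) := by positivity
    linarith
  have h7 : (1 - ε) * (1 + ε) * (2 * (G * P * F)) ≤ ε * P * ((1 - ε) * F) := by
    have e1 := mul_le_mul_of_nonneg_right hG
      (mul_nonneg (mul_nonneg (by linarith : 0 ≤ 1 - ε) hP.le) hF)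
    have e2 : 0 ≤ G * P * F := (sq_nonneg r).trans hr
    have e3 := mul_nonneg (mul_nonneg (by linarith : 0 ≤ 1 - ε) (by linarith : 0 ≤ 1 - ε)) e2
    linarith
  have h8 : ε * P * ((1 - ε) * (P * z ^ 2)) ≤
      ε * P * ((R + P) * u ^ 2 + (R + P) * a ^ 2 + (1 - ε) * F) := by
    linarith
  exact le_of_mul_le_mul_left h8 (by positivity)

/-- Now z = (1 - Q) u + Q (-y/Q) is a convex combination, so z² ≤ (1 - Q) u² + y²/Q, and the assumed
bound on y² is exactly what remains. -/
lemma leading_sq_le_of_neg (hP : 0 < P) (hQ : 0 < Q) (hQ1 : Q < 1) (hR : R = -(Q * P))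
    (hy : (1 - ε) * y ^ 2 ≤ Q * (M + (1 - ε) * (F / P))) (hε0 : 0 < ε)
    (hε1 : ε < 1) (hz : P * z = (R + P) * u - P * y) :
    (1 - ε) * (P * z ^ 2) ≤ (R + P) * u ^ 2 + P * M + (1 - ε) * F := by
  have hz' : z = (1 - Q) * u - y := by
    have : P * z = P * ((1 - Q) * u - y) := by rw [hz, hR]; ring
    exact mul_left_cancel₀ hP.ne' this
  have h1 : Q * z ^ 2 ≤ Q * ((1 - Q) * u ^ 2) + y ^ 2 := by
    have := mul_nonneg (by linarith : 0 ≤ 1 - Q) (sq_nonneg (Q * u + y))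
    rw [hz']
    linarith
  have h2 := mul_le_mul_of_nonneg_left h1 (by linarith : 0 ≤ 1 - ε)
  have h3 : Q * ((1 - ε) * z ^ 2) ≤ Q * ((1 - Q) * u ^ 2 + M + (1 - ε) * (F / P)) := by
    have := mul_nonneg hQ.le (mul_nonneg (by linarith : 0 ≤ 1 - Q) (sq_nonneg u))
    have := mul_nonneg hε0.le this
    linarith
  have h4 := le_of_mul_le_mul_left h3 hQ
  have h5 := mul_le_mul_of_nonneg_left h4 hP.le
  have h6 : P * (F / P) = F := by field_simp
  have h7 : P * ((1 - Q) * u ^ 2 + M + (1 - ε) * (F / P)) =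
      (R + P) * u ^ 2 + P * M + (1 - ε) * (P * (F / P)) := by rw [hR]; ring
  rw [h7, h6] at h5
  linarith

lemma abs_le_of_sq_le_mul {θ b : ℝ} (hθ : 0 ≤ θ) (hQ : 0 ≤ Q) (hF : 0 ≤ F)
    (h : b ^ 2 ≤ θ ^ 2 * (Q * F)) : |b| ≤ θ * (√Q * √F) := by
  refine abs_le_of_sq_le_sq ?_ (by positivity)
  rw [mul_pow, mul_pow, Real.sq_sqrt hQ, Real.sq_sqrt hF]
  exact h

end RealInequalities

/-! ### The derivative of the quotient when the quotient is negative. -/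

namespace GapEstimates

variable {n κ m : ℕ} {D δ C : ℝ} {o : ι} {B S : Finset ι} {x : ι → ℝ}

/-- The derivative of the identity for `∑ i ∈ S, x i ^ 2 * elem ((B ∪ S).erase i) κ x`, divided
by `elem (B ∪ S) (κ + 1) x`. -/
lemma sum_sq_mul_ratioD (h : GapEstimates n κ m D δ C o B S x) (ξ : ι → ℝ) :
    ∑ i ∈ S, x i ^ 2 * ratioD (B ∪ S) κ x ξ i
      + 2 * ∑ i ∈ S, x i * (elem ((B ∪ S).erase i) κ x / elem (B ∪ S) (κ + 1) x) * ξ i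
      + (m + 2) * quotientD (B ∪ S) (κ + 1) x ξ =
    ∑ i ∈ S, ξ i - ∑ j ∈ B, (elemD ((B ∪ S).erase j) (κ + 2) x ξ * elem (B ∪ S) (κ + 1) x
      - elem ((B ∪ S).erase j) (κ + 2) x * elemD (B ∪ S) (κ + 1) x ξ)
        / elem (B ∪ S) (κ + 1) x ^ 2 := by
  have hP := h.P_pos.ne'
  have h1 := sum_sq_mul_elem_erase_union h.disj κ x
  have h2 := sum_sq_mul_elemD_erase_union h.disj κ x ξ
  have hc : ((κ : ℝ) + 2 - B.card) = m + 2 := by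
    have : ((B.card : ℝ) + m) = κ := by exact_mod_cast h.card_add
    linarith
  rw [hc] at h1 h2
  rw [Finset.sum_add_distrib] at h2
  have e1 : ∑ i ∈ S, x i ^ 2 * ratioD (B ∪ S) κ x ξ i =
      ((∑ i ∈ S, x i ^ 2 * elemD ((B ∪ S).erase i) κ x ξ) * elem (B ∪ S) (κ + 1) x
        - (∑ i ∈ S, x i ^ 2 * elem ((B ∪ S).erase i) κ x) * elemD (B ∪ S) (κ + 1) x ξ)
        / elem (B ∪ S) (κ + 1) x ^ 2 := by
    rw [Finset.sum_mul, Finset.sum_mul, ← Finset.sum_sub_distrib, Finset.sum_div]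
    refine Finset.sum_congr rfl fun i _ => ?_
    rw [ratioD]; ring
  have e2 : 2 * ∑ i ∈ S, x i * (elem ((B ∪ S).erase i) κ x / elem (B ∪ S) (κ + 1) x) * ξ i =
      (∑ i ∈ S, 2 * x i * ξ i * elem ((B ∪ S).erase i) κ x) / elem (B ∪ S) (κ + 1) x := by
    rw [Finset.mul_sum, Finset.sum_div]
    refine Finset.sum_congr rfl fun i _ => ?_
    ring
  have e3 : ∑ j ∈ B, (elemD ((B ∪ S).erase j) (κ + 2) x ξ * elem (B ∪ S) (κ + 1) x
      - elem ((B ∪ S).erase j) (κ + 2) x * elemD (B ∪ S) (κ + 1) x ξ)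
        / elem (B ∪ S) (κ + 1) x ^ 2 =
      ((∑ j ∈ B, elemD ((B ∪ S).erase j) (κ + 2) x ξ) * elem (B ∪ S) (κ + 1) x
      - (∑ j ∈ B, elem ((B ∪ S).erase j) (κ + 2) x) * elemD (B ∪ S) (κ + 1) x ξ)
        / elem (B ∪ S) (κ + 1) x ^ 2 := by
    rw [Finset.sum_mul, Finset.sum_mul, ← Finset.sum_sub_distrib, Finset.sum_div]
  rw [e1, e2, e3, h1, quotientD]
  have h2' : ∑ i ∈ S, 2 * x i * ξ i * elem ((B ∪ S).erase i) κ x =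
    elemD (B ∪ S) (κ + 1) x ξ * ∑ i ∈ S, x i + elem (B ∪ S) (κ + 1) x * ∑ i ∈ S, ξ i
        - (m + 2) * elemD (B ∪ S) (κ + 2) x ξ
        - ∑ j ∈ B, elemD ((B ∪ S).erase j) (κ + 2) x ξ
        - ∑ i ∈ S, x i ^ 2 * elemD ((B ∪ S).erase i) κ x ξ := by linarith
  rw [h2']
  field_simp
  ring

/-- The bound for the derivative of the quotient when the quotient is negative. -/
lemma quotientD_sq_le (h : GapEstimates n κ m D δ C o B S x) (ξ : ι → ℝ) {ε η θ H Q : ℝ}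
    (hε0 : 0 < ε) (hε1 : ε < 1) (hη0 : 0 < η) (hηQ : η ≤ Q) (hQ1 : Q < 1)
    (hQ : elem (B ∪ S) (κ + 2) x = -(Q * elem (B ∪ S) (κ + 1) x))
    (hθ : θ = ε / 100 / (3 * (n + 1))) (hH : H = 4 * n + 4 * (κ + 3) + 4 * n / D ^ 2)
    (hδ : (2 * n + 2) * C * δ * (H + 1) ≤ θ ^ 2 * η ^ 3) :
    (1 - ε) * quotientD (B ∪ S) (κ + 1) x ξ ^ 2 ≤
      Q * (quotientForm (B ∪ S) (κ + 1) x ξ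
        + (1 - ε) * (restForm κ o (B ∪ S) x ξ / elem (B ∪ S) (κ + 1) x)) := by
  have hP := h.P_pos
  have hn : (0 : ℝ) ≤ n := n.cast_nonneg
  have hκ : (0 : ℝ) ≤ κ := κ.cast_nonneg
  have hm : (0 : ℝ) ≤ m := m.cast_nonneg
  have hδ0 := h.delta_pos
  have hδ2 := h.delta_le
  have hC := h.one_le
  have hD := h.pos
  have hF := h.restForm_nonneg ξ
  have hQ0 : 0 < Q := hη0.trans_le hηQ
  have hη1 : η < 1 := hηQ.trans_lt hQ1
  obtain ⟨ν, hν⟩ : ∃ t, t = ε / 100 := ⟨_, rfl⟩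
  rw [← hν] at hθ
  have hν0 : 0 < ν := by rw [hν]; positivity
  have hν1 : ν ≤ 1 / 100 := by rw [hν]; linarith
  have hθ0 : 0 < θ := by rw [hθ]; positivity
  -- Error budget for the differentiated identity: one error from ∑ ξ_i and two from each of the at
  -- most n large variables, each of size θ √Q √(F/P).
  have hθν : (2 * n + 1) * θ ≤ ν := by
    rw [hθ, mul_div_assoc', div_le_iff₀ (by positivity)]
    have := mul_nonneg hn hν0.le
    linarith
  have hθν' : θ ≤ ν := by
    have := mul_nonneg hn hθ0.le
    linarith
  have hH0 : 0 < H := by rw [hH]; positivity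
  obtain ⟨X, hX⟩ : ∃ t, t = (2 * n + 2) * C * δ := ⟨_, rfl⟩
  rw [← hX] at hδ
  have hX0 : 0 < X := by rw [hX]; positivity
  have hCδ : 0 < C * δ := by positivity
  have hnCδ : 0 ≤ n * (C * δ) := by positivity
  have hX1 : X ≤ θ ^ 2 * η ^ 3 := by
    have := mul_pos hX0 hH0
    linarith
  have hη3 : η ^ 3 ≤ η := pow_le_of_le_one hη0.le hη1.le (by norm_num)
  have hη2 : η ^ 2 ≤ 1 := pow_le_one₀ hη0.le hη1.le
  have hθ1 : θ ≤ 1 := by linarith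
  have hθ2 : θ ^ 2 ≤ θ := pow_le_of_le_one hθ0.le hθ1 (by norm_num)
  have hX2 : X ≤ θ ^ 2 * η := hX1.trans (by gcongr)
  have hX3 : X ≤ ν * η := hX2.trans (by gcongr; linarith)
  have hX4 : X ≤ ν := hX3.trans (mul_le_of_le_one_right hν0.le hη1.le)
  have hXC : 2 * (C * δ) ≤ X := by rw [hX]; linarith
  have hδC : δ ≤ C * δ := le_mul_of_one_le_left hδ0.le hC
  have hνQ : ν * η ≤ ν * Q := by gcongr
  obtain ⟨P, hPe⟩ : ∃ t, t = elem (B ∪ S) (κ + 1) x := ⟨_, rfl⟩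
  obtain ⟨F, hFe⟩ : ∃ t, t = restForm κ o (B ∪ S) x ξ := ⟨_, rfl⟩
  obtain ⟨y, hy⟩ : ∃ t, t = quotientD (B ∪ S) (κ + 1) x ξ := ⟨_, rfl⟩
  obtain ⟨DR, hDR⟩ : ∃ t, t = elemD (B ∪ S) (κ + 2) x ξ := ⟨_, rfl⟩
  obtain ⟨DP, hDP⟩ : ∃ t, t = elemD (B ∪ S) (κ + 1) x ξ := ⟨_, rfl⟩
  have hFP : 0 ≤ F / P := by rw [hFe, hPe]; positivity
  have hsum : |∑ i ∈ S, ξ i| ≤ θ * (√Q * √(F / P)) := by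
    refine abs_le_of_sq_le_mul hθ0.le hQ0.le hFP ?_
    have h1 := h.sq_sum_le ξ (A := S) Finset.subset_union_right (c := fun _ => 1)
      (t := 2 * (C * δ) / P) (fun i hi => ?_) (by rw [hPe]; positivity)
    · simp only [mul_one] at h1
      refine h1.trans ?_
      rw [← hFe]
      calc (n : ℝ) * (2 * (C * δ) / P) * F = 2 * n * (C * δ) * (F / P) := by ring
        _ ≤ X * (F / P) := by
          refine mul_le_mul_of_nonneg_right ?_ hFP
          rw [hX]; linarith
        _ ≤ θ ^ 2 * Q * (F / P) := by
          refine mul_le_mul_of_nonneg_right (hX2.trans (by gcongr)) hFP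
        _ = _ := by ring
    · have e1 := h.small_le i hi
      have e2 := h.coeff_ge_small hi
      have e3 := h.erase_pos (Finset.mem_union_right _ hi)
      have e4 : 1 / 2 * elem ((B ∪ S).erase i) κ x ≤
          elem ((insert o (B ∪ S)).erase i) (κ + 1) x :=
        le_trans (mul_le_mul_of_nonneg_right (by linarith) e3.le) e2
      have e5 := mul_le_mul_of_nonneg_left e4 (by positivity : 0 ≤ 2 * (C * δ))
      rw [div_mul_eq_mul_div, le_div_iff₀ (by rw [hPe]; exact hP), hPe]
      linarith
  have hR0 : elem (B ∪ S) (κ + 2) x = -(Q * P) := by rw [hQ, hPe]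
  have hDRsq : DR ^ 2 ≤ H * P * F := by
    have := h.sq_elemD_le ξ (t := 1) le_rfl (by
      rw [hQ, abs_neg, abs_mul, abs_of_pos hQ0, abs_of_pos hP]; gcongr) (by linarith)
    rw [← hH, ← hDR, ← hPe, ← hFe, mul_one] at this
    exact this
  rw [← hPe] at hP
  have hDRj : ∀ j ∈ B, |elemD ((B ∪ S).erase j) (κ + 2) x ξ / P| ≤ θ * (√Q * √(F / P)) := by
    intro j hj
    refine abs_le_of_sq_le_mul hθ0.le hQ0.le hFP ?_
    have h1 := h.sq_sum_le ξ (Finset.erase_subset j _)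
      (c := fun i => elem (((B ∪ S).erase j).erase i) (κ + 1) x)
      (t := C * δ * P) (fun i hi => by rw [hPe]; exact h.big_deriv_le j hj i hi) (by positivity)
    rw [← elemD_succ, ← hFe] at h1
    rw [div_pow, div_le_iff₀ (by positivity)]
    refine h1.trans ?_
    calc (n : ℝ) * (C * δ * P) * F = n * (C * δ) * (P * F) := by ring
      _ ≤ X * (P * F) := by
        have : 0 ≤ P * F := by rw [hFe]; positivity
        refine mul_le_mul_of_nonneg_right ?_ this
        rw [hX]; linarith
      _ ≤ θ ^ 2 * Q * (P * F) := by
        have : 0 ≤ P * F := by rw [hFe]; positivity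
        refine mul_le_mul_of_nonneg_right (hX2.trans (by gcongr)) this
      _ = _ := by field_simp
  have hRj : ∀ j ∈ B, |elem ((B ∪ S).erase j) (κ + 2) x| ≤ C * δ * P := fun j hj => by
    rw [hPe]; exact h.big_rest_le j hj
  have hmix : ∀ j ∈ B, |elem ((B ∪ S).erase j) (κ + 2) x * DR / (P * (Q * P))| ≤
      θ * (√Q * √(F / P)) := by
    intro j hj
    refine abs_le_of_sq_le_mul hθ0.le hQ0.le hFP ?_
    rw [div_pow, div_le_iff₀ (by positivity), mul_pow, ← sq_abs (elem _ _ _)]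
    have hPF : 0 ≤ P ^ 3 * F := by rw [hFe]; positivity
    calc |elem ((B ∪ S).erase j) (κ + 2) x| ^ 2 * DR ^ 2 ≤ (C * δ * P) ^ 2 * (H * P * F) :=
          mul_le_mul (pow_le_pow_left₀ (abs_nonneg _) (hRj j hj) 2) hDRsq (sq_nonneg _)
            (by positivity)
      _ = C * δ * (C * δ * H) * (P ^ 3 * F) := by ring
      _ ≤ X * (X * (H + 1)) * (P ^ 3 * F) := by
        refine mul_le_mul_of_nonneg_right ?_ hPF
        gcongr <;> linarith
      _ ≤ η ^ 3 * (θ ^ 2 * η ^ 3) * (P ^ 3 * F) := by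
        refine mul_le_mul_of_nonneg_right ?_ hPF
        have : X ≤ η ^ 3 := hX1.trans
          (mul_le_of_le_one_left (by positivity) (hθ2.trans hθ1))
        gcongr
      _ = θ ^ 2 * η ^ 3 * η ^ 3 * (P ^ 3 * F) := by ring
      _ ≤ θ ^ 2 * Q ^ 3 * 1 * (P ^ 3 * F) := by
        refine mul_le_mul_of_nonneg_right ?_ hPF
        have : η ^ 3 ≤ 1 := pow_le_one₀ hη0.le hη1.le
        gcongr
      _ = _ := by field_simp
  have hz : ∀ j ∈ B, |(elemD ((B ∪ S).erase j) (κ + 2) x ξ * P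
      - elem ((B ∪ S).erase j) (κ + 2) x * DP) / P ^ 2| ≤
      2 * (θ * (√Q * √(F / P))) + C * δ / η * |y| := by
    intro j hj
    -- The derivative of P is eliminated in favour of those of R and of the quotient y = DR/P + Q
    -- DP/P. This divides by Q, hence the requirement Q ≥ η.
    have e : (elemD ((B ∪ S).erase j) (κ + 2) x ξ * P
        - elem ((B ∪ S).erase j) (κ + 2) x * DP) / P ^ 2 =
        elemD ((B ∪ S).erase j) (κ + 2) x ξ / P
          + elem ((B ∪ S).erase j) (κ + 2) x * DR / (P * (Q * P))
          - elem ((B ∪ S).erase j) (κ + 2) x / (Q * P) * y := by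
      rw [hy, quotientD, ← hDR, ← hDP, ← hPe, hR0]
      field_simp
      ring
    have h3 : |elem ((B ∪ S).erase j) (κ + 2) x / (Q * P) * y| ≤ C * δ / η * |y| := by
      rw [abs_mul]
      refine mul_le_mul_of_nonneg_right ?_ (abs_nonneg _)
      rw [abs_div, abs_of_pos (by positivity : 0 < Q * P), div_le_div_iff₀ (by positivity) hη0]
      calc |elem ((B ∪ S).erase j) (κ + 2) x| * η ≤ C * δ * P * Q :=
            mul_le_mul (hRj j hj) hηQ hη0.le (by positivity)
        _ = _ := by ring
    rw [e]
    have := abs_sub (elemD ((B ∪ S).erase j) (κ + 2) x ξ / P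
          + elem ((B ∪ S).erase j) (κ + 2) x * DR / (P * (Q * P)))
          (elem ((B ∪ S).erase j) (κ + 2) x / (Q * P) * y)
    have := abs_add_le (elemD ((B ∪ S).erase j) (κ + 2) x ξ / P)
          (elem ((B ∪ S).erase j) (κ + 2) x * DR / (P * (Q * P)))
    have := hDRj j hj
    have := hmix j hj
    linarith
  have hE := h.sum_sq_mul_ratioD ξ
  rw [← hPe, ← hDP, ← hy] at hE
  have hsqF : 0 ≤ √Q * √(F / P) := by positivity
  have hE' : |∑ i ∈ S, x i ^ 2 * ratioD (B ∪ S) κ x ξ i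
      + 2 * ∑ i ∈ S, x i * (elem ((B ∪ S).erase i) κ x / P) * ξ i + (m + 2) * y| ≤
      ν * |y| + ν * (√Q * √(F / P)) := by
    rw [hE]
    refine (abs_sub _ _).trans ?_
    have h1 := (Finset.abs_sum_le_sum_abs _ _).trans (Finset.sum_le_sum hz)
    rw [Finset.sum_const, nsmul_eq_mul] at h1
    have h2 : (B.card : ℝ) * (2 * (θ * (√Q * √(F / P))) + C * δ / η * |y|) ≤
        n * (2 * (θ * (√Q * √(F / P))) + C * δ / η * |y|) := by
      have : (B.card : ℝ) ≤ n := by exact_mod_cast h.card_big_le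
      gcongr
    have h3 : n * (C * δ / η) ≤ ν := by
      rw [mul_div_assoc', div_le_iff₀ hη0]
      refine le_trans ?_ hX3
      rw [hX]; linarith
    have h4 := mul_le_mul_of_nonneg_right h3 (abs_nonneg y)
    have h5 := mul_le_mul_of_nonneg_right hθν hsqF
    linarith
  -- The scalar estimate is applied to p_i = P_i/P and its derivative, with multiplicity m + 2 and
  -- form F/P.
  have hmain := weighted_sum_bound (s := S) (ν := ν) (Q := Q) (m := (m : ℝ) + 2)
    (M := quotientForm (B ∪ S) (κ + 1) x ξ) (F := F / P) (η := ξ) (y := y) (x := x)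
    (p := fun i => elem ((B ∪ S).erase i) κ x / P) (g := ratioD (B ∪ S) κ x ξ)
    hQ0 hν0.le (by linarith) (by linarith) (quotientForm_nonneg h.garding_union ξ)
    (fun i hi => div_pos (h.erase_pos (Finset.mem_union_right _ hi)) hP)
    (fun i hi => (h.small i hi).trans (by linarith))
    (fun i hi => by
      rw [mul_div_assoc', le_div_iff₀ hP, one_mul, hPe]
      refine (h.small_le i hi).trans (mul_le_mul_of_nonneg_right (by linarith)
        (h.erase_pos (Finset.mem_union_right _ hi)).le))
    (fun i hi => by
      have := quotientForm_cauchy_schwarz h.garding_union ξ (Finset.mem_union_right B hi)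
      rw [← hy, ← hPe, hR0, neg_div, mul_div_assoc, div_self hP.ne', mul_one] at this
      convert this using 2 <;> ring)
    rfl
    (by
      have h1 := h.sum_sq_small
      rw [← hPe, hR0] at h1
      have e : ∑ i ∈ S, x i ^ 2 * (elem ((B ∪ S).erase i) κ x / P) - (m + 2) * Q =
          (∑ i ∈ S, x i ^ 2 * elem ((B ∪ S).erase i) κ x + (m + 2) * -(Q * P)) / P := by
        rw [add_div, Finset.sum_div]
        simp only [mul_div_assoc]
        field_simp
        ring
      rw [e, abs_div, abs_of_pos hP, div_le_iff₀ hP]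
      refine h1.trans (mul_le_mul_of_nonneg_right ?_ hP.le)
      have h2 : 2 * n * C * δ ≤ X := by rw [hX]; linarith
      have h3 : 0 ≤ ν * Q * m := by positivity
      have h4 : 0 ≤ ν * Q := by positivity
      linarith)
    (by
      rw [show (1 + ν) * (F / P) = (1 + ν) * F / P by ring, le_div_iff₀ hP, Finset.sum_mul, hFe,
        restForm, Finset.mul_sum]
      refine (Finset.sum_le_sum fun i hi => ?_).trans (Finset.sum_le_sum_of_subset_of_nonneg
        Finset.subset_union_right fun i hi _ =>
          mul_nonneg (by linarith) (mul_nonneg (h.coeff_pos hi).le (sq_nonneg _)))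
      have e1 := h.coeff_ge_small hi
      have e2 := h.erase_pos (Finset.mem_union_right _ hi)
      have e3 : elem ((B ∪ S).erase i) κ x ≤
          (1 + ν) * elem ((insert o (B ∪ S)).erase i) (κ + 1) x := by
        have e4 := mul_le_mul_of_nonneg_left e1 (by linarith : 0 ≤ 1 + ν)
        have e5 : (1 : ℝ) ≤ (1 + ν) * (1 - δ) := by
          have : 2 * δ ≤ ν := by linarith
          have : 0 ≤ ν * (1 / 2 - δ) := mul_nonneg hν0.le (by linarith)
          linarith
        have e6 := mul_le_mul_of_nonneg_right e5 e2.le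
        linarith
      have e4 := mul_le_mul_of_nonneg_right e3 (sq_nonneg (ξ i))
      rw [show elem ((B ∪ S).erase i) κ x / P * ξ i ^ 2 * P =
        elem ((B ∪ S).erase i) κ x * ξ i ^ 2 by field_simp]
      linarith)
    hFP rfl hE'
  rw [hν] at hmain
  rw [← hy, ← hPe, ← hFe]
  exact weighted_sum_sq_bound hε0 hε1 hQ0 (quotientForm_nonneg h.garding_union ξ) hFP hmain

end GapEstimates

/-! ### Concavity under a spectral gap. -/

/-- The concavity inequality for a vector with a sufficiently large spectral gap. -/
theorem exists_concavity_of_gap (n κ : ℕ) {D ε : ℝ} (hD : 0 < D) (hD1 : D ≤ 1) (hε0 : 0 < ε)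
    (hε1 : ε < 1) :
    ∃ δ₀ : ℝ, 0 < δ₀ ∧ ∀ (m : ℕ) (δ : ℝ) (o : ι) (B S : Finset ι) (x : ι → ℝ), 0 < δ → δ ≤ δ₀ →
      SpectralGap n κ m D δ o B S x → ∀ ξ : ι → ℝ,
        (1 - ε) * (elem (B ∪ S) (κ + 1) x * ξ o ^ 2) ≤
          -elemDD (insert o (B ∪ S)) (κ + 2) x ξ
            + 2 * (elemD (insert o (B ∪ S)) (κ + 2) x ξ ^ 2 / elem (insert o (B ∪ S)) (κ + 2) x)
            + (1 - ε) * restForm κ o (B ∪ S) x ξ := by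
  obtain ⟨C, hC, δ₁, hδ₁, hδ₁', key⟩ := exists_gap_bounds (ι := ι) n κ hD hD1
  have hn : (0 : ℝ) ≤ n := n.cast_nonneg
  obtain ⟨H, hH⟩ : ∃ H : ℝ, H = 4 * n + 4 * (κ + 3) + 4 * n / D ^ 2 := ⟨_, rfl⟩
  have hH0 : 0 < H := by rw [hH]; positivity
  -- The gradient of R is bounded with constant H η when |R| ≤ η P; this choice gives H η ≤ ε²/16,
  -- as Young's inequality requires.
  obtain ⟨η, hη⟩ : ∃ η : ℝ, η = ε ^ 2 / (16 * (H + 1)) := ⟨_, rfl⟩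
  have hη0 : 0 < η := by rw [hη]; positivity
  have hηH : 16 * (H + 1) * η = ε ^ 2 := by rw [hη]; field_simp
  have hε2 : ε ^ 2 ≤ ε := pow_le_of_le_one hε0.le hε1.le (by norm_num)
  have hHη : 0 < H * η := by positivity
  obtain ⟨θ, hθ⟩ : ∃ θ : ℝ, θ = ε / 100 / (3 * (n + 1)) := ⟨_, rfl⟩
  have hθ0 : 0 < θ := by rw [hθ]; positivity
  have hθ1 : θ ≤ 1 := by
    rw [hθ, div_le_iff₀ (by positivity)]
    linarith
  refine ⟨min δ₁ (θ ^ 2 * η ^ 3 / ((2 * n + 2) * C * (H + 1))), by positivity, ?_⟩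
  intro m δ o B S x hδ0 hδ hgap ξ
  obtain ⟨s1, s2, s3⟩ := key m δ o B S x hδ0 (hδ.trans (min_le_left _ _)) hgap
  have h : GapEstimates n κ m D δ C o B S x :=
    ⟨hgap, hD, hδ0, (hδ.trans (min_le_left _ _)).trans hδ₁', hC, s1, s2, s3⟩
  have hδX : (2 * n + 2) * C * δ * (H + 1) ≤ θ ^ 2 * η ^ 3 := by
    have := hδ.trans (min_le_right _ _)
    rw [le_div_iff₀ (by positivity)] at this
    linarith
  have hX : (2 * n + 1) * C * δ ≤ η := by
    have e1 : 0 < (2 * n + 2) * C * δ * H := by positivity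
    have e2 : 0 < C * δ := by positivity
    have e3 : θ ^ 2 * η ^ 3 ≤ 1 * η :=
      mul_le_mul (pow_le_one₀ hθ0.le hθ1) (pow_le_of_le_one hη0.le (by linarith) (by norm_num))
        (by positivity) zero_le_one
    linarith
  have hP := h.P_pos
  have hf := h.f_pos
  have hF := h.restForm_nonneg ξ
  have hlog := elem_log_form_ge h.notMem h.lead h.garding_union hf ξ
  have hdir := direction_eq h.notMem h.lead hP hf ξ
  have hM := quotientForm_nonneg h.garding_union ξ
  have hquot : elem (B ∪ S) (κ + 1) x * quotientD (B ∪ S) (κ + 1) x ξ =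
      elemD (B ∪ S) (κ + 2) x ξ - elem (B ∪ S) (κ + 2) x
        * (elemD (B ∪ S) (κ + 1) x ξ / elem (B ∪ S) (κ + 1) x) := by
    rw [quotientD]; field_simp
  have ha : elemD (insert o (B ∪ S)) (κ + 2) x ξ ^ 2 / elem (insert o (B ∪ S)) (κ + 2) x =
      elem (insert o (B ∪ S)) (κ + 2) x * (elemD (insert o (B ∪ S)) (κ + 2) x ξ
        / elem (insert o (B ∪ S)) (κ + 2) x) ^ 2 := by
    field_simp
  rw [ha] at hlog ⊢
  rw [h.f_eq] at hf hlog hdir ⊢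
  obtain ⟨a, hae⟩ : ∃ a, a = elemD (insert o (B ∪ S)) (κ + 2) x ξ
    / (elem (B ∪ S) (κ + 2) x + elem (B ∪ S) (κ + 1) x) := ⟨_, rfl⟩
  rw [← hae] at hlog hdir ⊢
  -- Since R/P is bounded above by a multiple of δ, either |R| ≤ η P or R < -η P. Of the two copies
  -- of f'²/f, one completes -f'' to -f (log f)''; the other is f a², which is used in the first
  -- case and discarded in the second.
  rcases le_or_gt (-(η * elem (B ∪ S) (κ + 1) x)) (elem (B ∪ S) (κ + 2) x) with hR | hR
  · have hRabs : |elem (B ∪ S) (κ + 2) x| ≤ η * elem (B ∪ S) (κ + 1) x := by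
      refine abs_le.2 ⟨hR, h.quotient_le.trans (mul_le_mul_of_nonneg_right ?_ hP.le)⟩
      have : 0 < C * δ := by positivity
      linarith
    have hr := h.sq_elemD_le ξ (by linarith) hRabs hX
    rw [← hH] at hr
    have hη2 : 8 * η ^ 2 ≤ ε := by
      have : η ^ 2 ≤ η * 1 := by rw [sq]; exact mul_le_mul_of_nonneg_left (by linarith) hη0.le
      linarith
    have := leading_sq_le_of_abs_le (u := a - elemD (B ∪ S) (κ + 1) x ξ
      / elem (B ∪ S) (κ + 1) x) (a := a) (z := ξ o) hε0 hε1 hP hRabs hη0 (by linarith)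
      (by linarith) hη2 (by linarith) hr hF (by rw [hdir, hquot]; ring)
    have := mul_nonneg hP.le hM
    linarith
  · have hQe : elem (B ∪ S) (κ + 2) x = -(-elem (B ∪ S) (κ + 2) x / elem (B ∪ S) (κ + 1) x
        * elem (B ∪ S) (κ + 1) x) := by field_simp
    have hQη : η ≤ -elem (B ∪ S) (κ + 2) x / elem (B ∪ S) (κ + 1) x := by
      rw [le_div_iff₀ hP]; linarith
    have hQ1 : -elem (B ∪ S) (κ + 2) x / elem (B ∪ S) (κ + 1) x < 1 := by
      rw [div_lt_one hP]; linarith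
    have hy := h.quotientD_sq_le ξ hε0 hε1 hη0 hQη hQ1 hQe hθ hH hδX
    have := leading_sq_le_of_neg hP (hη0.trans_le hQη) hQ1 hQe hy hε0 hε1 hdir
    have := mul_nonneg hf.le (sq_nonneg a)
    linarith

/-! ### Producing the spectral gap: scaling, thresholds and pigeonhole. -/

lemma elemD_smul (T : Finset ι) (k : ℕ) (c : ℝ) (x y : ι → ℝ) :
    elemD T (k + 1) (c • x) y = c ^ k * elemD T (k + 1) x y := by
  simp only [elemD_succ, elem_smul, Finset.mul_sum]
  exact Finset.sum_congr rfl fun i _ => by ring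

lemma elemDD_smul (T : Finset ι) (k : ℕ) (c : ℝ) (x y : ι → ℝ) :
    elemDD T (k + 2) (c • x) y = c ^ k * elemDD T (k + 2) x y := by
  simp only [elemDD_succ, elemD_smul, Finset.mul_sum]
  exact Finset.sum_congr rfl fun i _ => by ring

/-- Iterates the choice D ↦ δ starting from 1; taking the minimum with D keeps the sequence
decreasing. The gap between any two consecutive thresholds is then wide enough. -/
lemma exists_thresholds {G : ℝ → ℝ → Prop}
    (h : ∀ D, 0 < D → D ≤ 1 → ∃ δ₀, 0 < δ₀ ∧ ∀ δ, 0 < δ → δ ≤ δ₀ → G D δ) :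
    ∃ d : ℕ → ℝ, (∀ s, 0 < d s) ∧ (∀ s, d s ≤ 1) ∧ Antitone d ∧ ∀ s, G (d s) (d (s + 1)) := by
  have step : ∀ D : {D : ℝ // 0 < D ∧ D ≤ 1}, ∃ D' : {D : ℝ // 0 < D ∧ D ≤ 1},
      D'.1 ≤ D.1 ∧ G D.1 D'.1 := fun ⟨D, h0, h1⟩ => by
    obtain ⟨δ₀, hδ₀, hG⟩ := h D h0 h1
    exact ⟨⟨min δ₀ D, lt_min hδ₀ h0, (min_le_right _ _).trans h1⟩, min_le_right _ _,
      hG _ (lt_min hδ₀ h0) (min_le_left _ _)⟩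
  choose f hf using step
  let d : ℕ → {D : ℝ // 0 < D ∧ D ≤ 1} := fun s => f^[s] ⟨1, one_pos, le_rfl⟩
  have hd : ∀ s, d (s + 1) = f (d s) := fun s => Function.iterate_succ_apply' f s _
  refine ⟨fun s => (d s).1, fun s => (d s).2.1, fun s => (d s).2.2,
    antitone_nat_of_succ_le fun s => ?_, fun s => ?_⟩
  · show (d (s + 1)).1 ≤ (d s).1
    rw [hd]; exact (hf _).1
  · show G (d s).1 (d (s + 1)).1
    rw [hd]; exact (hf _).2

/-- A negative product has a negative factor, which is at least -a, and the remaining factors have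
absolute value at most one. -/
lemma prod_mem_Icc {T : Finset ι} {x : ι → ℝ} {a : ℝ} (ha0 : 0 ≤ a) (ha1 : a ≤ 1)
    (hx : ∀ i ∈ T, -a ≤ x i ∧ x i ≤ 1) : -a ≤ ∏ i ∈ T, x i ∧ ∏ i ∈ T, x i ≤ 1 := by
  induction T using Finset.induction_on with
  | empty => simp; linarith
  | insert i T hi ih =>
    rw [Finset.prod_insert hi]
    obtain ⟨h1, h2⟩ := hx i (Finset.mem_insert_self _ _)
    obtain ⟨h3, h4⟩ := ih fun j hj => hx j (Finset.mem_insert_of_mem hj)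
    have h5 : |x i| ≤ 1 := abs_le.2 ⟨by linarith, h2⟩
    have h6 : |∏ i ∈ T, x i| ≤ 1 := abs_le.2 ⟨by linarith, h4⟩
    constructor
    · rcases le_or_gt 0 (x i) with h | h
      · have e1 := mul_le_mul_of_nonneg_left h3 h
        have e2 := mul_le_mul_of_nonneg_right h2 ha0
        linarith
      · rcases le_or_gt 0 (∏ i ∈ T, x i) with h' | h'
        · have e1 := mul_le_mul_of_nonneg_right h1 h'
          have e2 := mul_le_mul_of_nonneg_right h4 ha0
          linarith
        · have := mul_pos_of_neg_of_neg h h'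
          linarith
    · refine (le_abs_self _).trans ?_
      rw [abs_mul]
      exact mul_le_one₀ h5 (abs_nonneg _) h6

/-- If `k` of the variables are at least `d` and none is below `-a`, then the symmetric function
of degree `k` is not much below `d ^ k`. -/
lemma elem_ge_of_subset {U W : Finset ι} {x : ι → ℝ} {a d : ℝ} (ha0 : 0 ≤ a) (ha1 : a ≤ 1)
    (hx : ∀ i ∈ U, -a ≤ x i ∧ x i ≤ 1) (hW : W ⊆ U) (hd : 0 ≤ d) (hWd : ∀ i ∈ W, d ≤ x i) :
    d ^ W.card - 2 ^ U.card * a ≤ elem U W.card x := by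
  have hmem : W ∈ U.powersetCard W.card := Finset.mem_powersetCard.2 ⟨hW, rfl⟩
  rw [elem, ← Finset.add_sum_erase _ _ hmem]
  have h1 : d ^ W.card ≤ ∏ i ∈ W, x i := by
    rw [← Finset.prod_const]
    exact Finset.prod_le_prod (fun _ _ => hd) hWd
  have h2 : ∑ _s ∈ (U.powersetCard W.card).erase W, (-a) ≤
      ∑ s ∈ (U.powersetCard W.card).erase W, ∏ i ∈ s, x i := by
    refine Finset.sum_le_sum fun s hs => (prod_mem_Icc ha0 ha1 fun i hi => hx i ?_).1
    exact (Finset.mem_powersetCard.1 (Finset.mem_of_mem_erase hs)).1 hi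
  rw [Finset.sum_const, nsmul_eq_mul] at h2
  have h3 : (((U.powersetCard W.card).erase W).card : ℝ) ≤ 2 ^ U.card := by
    have : ((U.powersetCard W.card).erase W).card ≤ U.powerset.card :=
      Finset.card_le_card fun s hs => Finset.mem_powerset.2
        (Finset.mem_powersetCard.1 (Finset.mem_of_mem_erase hs)).1
    rw [Finset.card_powerset] at this
    exact_mod_cast this
  have h4 := mul_le_mul_of_nonneg_right h3 ha0
  linarith

/-- Pigeonhole: with no repetition the count would grow by at least one in each of κ + 1 steps and
exceed κ. -/
lemma exists_succ_eq_of_le {c : ℕ → ℕ} (hc : Monotone c) {κ : ℕ} (h : ∀ s ≤ κ + 1, c s ≤ κ) :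
    ∃ s ≤ κ, c (s + 1) = c s := by
  by_contra! hne
  have : ∀ s ≤ κ + 1, s ≤ c s := fun s => by
    induction s with
    | zero => simp
    | succ s ih =>
      intro hs
      have h1 := ih (by omega)
      have h2 := hne s (by omega)
      have h3 : c s ≤ c (s + 1) := hc (Nat.le_succ s)
      omega
  have h1 := this (κ + 1) le_rfl
  have h2 := h (κ + 1) le_rfl
  omega

/-- The concavity inequality for the elementary symmetric function of degree `κ + 2`, for real
vectors with a large leading component. -/
theorem exists_concavity (n κ : ℕ) {A s₁ ε : ℝ} (hA : 0 < A) (hs₁ : 0 < s₁) (hε0 : 0 < ε)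
    (hε1 : ε < 1) :
    ∃ L : ℝ, 0 < L ∧ ∀ (o : ι) (T : Finset ι) (l : ι → ℝ), o ∉ T → T.card ≤ n →
      InGarding (insert o T) (κ + 2) l → (∀ i ∈ T, l i ≤ l o) → (∀ i ∈ T, -A < l i) →
      elem (insert o T) (κ + 2) l ≤ s₁ → L ≤ l o → ∀ ξ : ι → ℝ,
        (1 - ε) * (elem T (κ + 1) l * ξ o ^ 2 / l o) ≤
          -elemDD (insert o T) (κ + 2) l ξ
            + 2 * (elemD (insert o T) (κ + 2) l ξ ^ 2 / elem (insert o T) (κ + 2) l)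
            + (1 - ε) * ∑ i ∈ T, elem ((insert o T).erase i) (κ + 1) l * ξ i ^ 2 / l o := by
  obtain ⟨d, hd0, hd1, hdanti, hG⟩ := exists_thresholds (G := fun D δ =>
    ∀ (m : ℕ) (o : ι) (B S : Finset ι) (x : ι → ℝ), SpectralGap n κ m D δ o B S x → ∀ ξ : ι → ℝ,
      (1 - ε) * (elem (B ∪ S) (κ + 1) x * ξ o ^ 2) ≤
          -elemDD (insert o (B ∪ S)) (κ + 2) x ξ
            + 2 * (elemD (insert o (B ∪ S)) (κ + 2) x ξ ^ 2 / elem (insert o (B ∪ S)) (κ + 2) x)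
            + (1 - ε) * restForm κ o (B ∪ S) x ξ) fun D hD hD1 => by
    obtain ⟨δ₀, hδ₀, h⟩ := exists_concavity_of_gap (ι := ι) n κ hD hD1 hε0 hε1
    exact ⟨δ₀, hδ₀, fun δ h0 h1 m o B S x => h m δ o B S x h0 h1⟩
  obtain ⟨e, he⟩ : ∃ e, e = d (κ + 1) := ⟨_, rfl⟩
  have he0 : 0 < e := he ▸ hd0 _
  have he1 : e ≤ 1 := he ▸ hd1 _
  -- The summands make, in order, λ_1 > 1; the normalised entries at least -e; the negative products
  -- in σ_k at most e^(κ+2)/2 in total; and λ_1 e^(κ+2)/2 larger than s₁.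
  refine ⟨1 + A / e + 2 * (2 ^ (n + 1) * A) / e ^ (κ + 2) + 2 * s₁ / e ^ (κ + 2), by positivity, ?_⟩
  intro o T l ho hTn hl hlo hlA hf hL ξ
  have p1 : 0 < A / e := by positivity
  have p2 : 0 < 2 * (2 ^ (n + 1) * A) / e ^ (κ + 2) := by positivity
  have p3 : 0 < 2 * s₁ / e ^ (κ + 2) := by positivity
  have hΛ1 : 1 < l o := by linarith
  have hΛ0 : 0 < l o := by linarith
  have hAe : A / l o ≤ e := by
    rw [div_le_iff₀ hΛ0, ← div_le_iff₀' he0]; linarith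
  obtain ⟨x, hx⟩ : ∃ x : ι → ℝ, x = (l o)⁻¹ • l := ⟨_, rfl⟩
  have hlx : l = l o • x := by rw [hx, smul_smul, mul_inv_cancel₀ hΛ0.ne', one_smul]
  have hxi : ∀ i, x i = l i / l o := fun i => by rw [hx]; simp; ring
  have hxo : x o = 1 := by rw [hxi, div_self hΛ0.ne']
  have hx1 : ∀ i ∈ T, x i ≤ 1 := fun i hi => by
    rw [hxi, div_le_one hΛ0]; exact hlo i hi
  have hxA : ∀ i ∈ T, -(A / l o) ≤ x i := fun i hi => by
    rw [hxi, ← neg_div]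
    exact div_le_div_of_nonneg_right (hlA i hi).le hΛ0.le
  have hxG : InGarding (insert o T) (κ + 2) x := fun j hj => by
    rw [hx, elem_smul]
    exact mul_pos (by positivity) (hl j hj)
  have hA0 : 0 ≤ A / l o := by positivity
  let Bs : ℕ → Finset ι := fun s => T.filter fun i => d s ≤ x i
  have hBmono : Monotone Bs := fun s t hst => by
    intro i hi
    simp only [Bs, Finset.mem_filter] at hi ⊢
    exact ⟨hi.1, (hdanti hst).trans hi.2⟩
  -- With κ + 1 large entries besides the leading one, some product of κ + 2 entries is at least
  -- e^(κ+2), so σ_k(λ) ≥ λ_1 e^(κ+2)/2 > s₁.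
  have hBcard : ∀ s ≤ κ + 1, (Bs s).card ≤ κ := by
    intro s hs
    by_contra! hlt
    have hoB : o ∉ Bs s := fun h => ho (Finset.mem_filter.1 h).1
    obtain ⟨W, hW, hWc⟩ := Finset.exists_subset_card_eq
      (show κ + 2 ≤ (insert o (Bs s)).card by rw [Finset.card_insert_of_notMem hoB]; omega)
    have hds : e ≤ d s := he ▸ hdanti hs
    have h1 := elem_ge_of_subset (U := insert o T) (W := W) (x := x) (d := e) hA0
      (hAe.trans he1) (fun i hi => by
        rcases Finset.mem_insert.1 hi with rfl | hi
        · rw [hxo]; constructor <;> linarith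
        · exact ⟨hxA i hi, hx1 i hi⟩)
      (hW.trans (Finset.insert_subset_insert _ (Finset.filter_subset _ _))) he0.le
      (fun i hi => by
        rcases Finset.mem_insert.1 (hW hi) with rfl | hi
        · rw [hxo]; exact he1
        · exact hds.trans (Finset.mem_filter.1 hi).2)
    rw [hWc, Finset.card_insert_of_notMem ho] at h1
    have h2 : (2 : ℝ) ^ (T.card + 1) * (A / l o) ≤ e ^ (κ + 2) / 2 := by
      have e1 : (2 : ℝ) ^ (T.card + 1) * (A / l o) ≤ 2 ^ (n + 1) * (A / l o) := by
        gcongr; norm_num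
      refine e1.trans ?_
      rw [mul_div_assoc', div_le_iff₀ hΛ0]
      have : 2 * (2 ^ (n + 1) * A) / e ^ (κ + 2) ≤ l o := by linarith
      rw [div_le_iff₀ (by positivity)] at this
      linarith
    have h3 : elem (insert o T) (κ + 2) l = l o ^ (κ + 2) * elem (insert o T) (κ + 2) x := by
      conv_lhs => rw [hlx, elem_smul]
    have h4 : l o * (e ^ (κ + 2) / 2) ≤ elem (insert o T) (κ + 2) l := by
      rw [h3]
      have : l o ≤ l o ^ (κ + 2) := le_self_pow₀ hΛ1.le (by omega)
      have h5 : e ^ (κ + 2) / 2 ≤ elem (insert o T) (κ + 2) x := by linarith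
      gcongr
    have h5 : 2 * s₁ / e ^ (κ + 2) < l o := by linarith
    rw [div_lt_iff₀ (by positivity)] at h5
    linarith
  -- Two consecutive thresholds cut out the same set, so no entry lies between them.
  obtain ⟨s, hs, hcard⟩ := exists_succ_eq_of_le (c := fun s => (Bs s).card)
    (fun s t hst => Finset.card_le_card (hBmono hst)) hBcard
  have hBeq : Bs s = Bs (s + 1) :=
    Finset.eq_of_subset_of_card_le (hBmono (Nat.le_succ s)) hcard.le
  have hunion : Bs s ∪ T \ Bs s = T := Finset.union_sdiff_of_subset (Finset.filter_subset _ _)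
  have hgap : SpectralGap n κ (κ - (Bs s).card) (d s) (d (s + 1)) o (Bs s) (T \ Bs s) x := by
    refine ⟨Finset.disjoint_sdiff, by rwa [hunion], hxo, fun j hj => (Finset.mem_filter.1 hj).2,
      fun j hj => hx1 j (Finset.mem_filter.1 hj).1, fun i hi => ?_, by rwa [hunion],
      by have := hBcard s (by omega); omega, by rwa [hunion]⟩
    obtain ⟨hiT, hiB⟩ := Finset.mem_sdiff.1 hi
    rw [hBeq] at hiB
    have h1 : x i < d (s + 1) := by
      by_contra! h
      exact hiB (Finset.mem_filter.2 ⟨hiT, h⟩)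
    refine abs_le.2 ⟨?_, h1.le⟩
    have h2 := hxA i hiT
    have h3 : e ≤ d (s + 1) := he ▸ hdanti (by omega)
    linarith
  have hmain := hG s _ o _ _ x hgap ξ
  rw [hunion] at hmain
  obtain ⟨Λ, hΛ⟩ : ∃ Λ, Λ = l o := ⟨_, rfl⟩
  rw [← hΛ] at hlx hΛ0 ⊢
  have hfx := (hxG (κ + 2) le_rfl).ne'
  -- Undoing the normalisation: every term of the inequality scales by Λ^κ, the division by λ_1
  -- compensating for the extra degree of the first-order coefficients.
  have e1 : ∀ U : Finset ι, ∀ t : ℝ, elem U (κ + 1) l * t / Λ = Λ ^ κ * (elem U (κ + 1) x * t) :=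
    fun U t => by rw [hlx, elem_smul]; field_simp; ring
  have e2 : elemDD (insert o T) (κ + 2) l ξ = Λ ^ κ * elemDD (insert o T) (κ + 2) x ξ := by
    rw [hlx, elemDD_smul]
  have e3 : elemD (insert o T) (κ + 2) l ξ ^ 2 / elem (insert o T) (κ + 2) l =
      Λ ^ κ * (elemD (insert o T) (κ + 2) x ξ ^ 2 / elem (insert o T) (κ + 2) x) := by
    rw [hlx, elemD_smul, elem_smul]; field_simp; ring
  simp only [e1, e2, e3, ← Finset.mul_sum]
  have := mul_le_mul_of_nonneg_left hmain (by positivity : 0 ≤ Λ ^ κ)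
  rw [restForm] at this
  linarith

/-! ### Derivatives of the matrix function σ_k at a diagonal matrix. -/

lemma elem_add_single {R : Type*} [CommRing R] {T : Finset ι} {i : ι} (hi : i ∈ T) (k : ℕ)
    (x : ι → R) (t : R) :
    elem T (k + 1) (x + t • Pi.single i 1) = elem T (k + 1) x + t * elem (T.erase i) k x := by
  have h : ∀ j ∈ T.erase i, (x + t • Pi.single i (1 : R) : ι → R) j = x j := fun j hj => by
    simp [Finset.ne_of_mem_erase hj]
  rw [elem_erase hi, elem_erase hi, elem_congr h, elem_congr h]
  simp
  ring

lemma elem_ofReal (T : Finset ι) (k : ℕ) (x : ι → ℝ) :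
    elem T k (fun i => (x i : ℂ)) = ((elem T k x : ℝ) : ℂ) := by
  simp [elem]

section Matrices

variable {n : ℕ}

/-- Chain rule for a polynomial in differentiable entries. Over ℂ, along lines of matrices, it
identifies the partial derivatives of `esymmPoly`; over ℝ it differentiates σ_k of a matrix-valued
function. -/
lemma hasFDerivAt_mvPolynomial_eval {𝕜 E σ : Type*} [NontriviallyNormedField 𝕜]
    [NormedAlgebra 𝕜 ℂ] [NormedAddCommGroup E] [NormedSpace 𝕜 E] [Fintype σ]
    (q : MvPolynomial σ ℂ) {a : σ → E → ℂ} {a' : σ → E →L[𝕜] ℂ} {z : E}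
    (ha : ∀ s, HasFDerivAt (a s) (a' s) z) :
    HasFDerivAt (fun w => MvPolynomial.eval (fun s => a s w) q)
      (∑ s, MvPolynomial.eval (fun s => a s z) (MvPolynomial.pderiv s q) • a' s) z := by
  classical
  induction q using MvPolynomial.induction_on with
  | C c =>
    simp only [MvPolynomial.eval_C]
    refine (hasFDerivAt_const c z).congr_fderiv ?_
    ext v
    simp
  | add p q hp hq =>
    simp only [map_add]
    refine (hp.fun_add hq).congr_fderiv ?_
    ext v
    simp [Finset.sum_add_distrib, add_mul]
  | mul_X p s hp =>
    simp only [map_mul, MvPolynomial.eval_X, MvPolynomial.pderiv_mul, map_add,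
      MvPolynomial.pderiv_X]
    refine (hp.fun_mul (ha s)).congr_fderiv ?_
    ext v
    simp only [add_apply, FunLike.coe_smul, Pi.smul_apply, smul_eq_mul,
      sum_apply, add_mul, Finset.sum_add_distrib, Finset.mul_sum]
    rw [add_comm]
    congr 1
    · exact Finset.sum_congr rfl fun i _ => by ring
    · rw [Finset.sum_eq_single s]
      · simp
      · intro b _ hb
        simp [hb.symm]
      · simp

/-- The `k`-th elementary symmetric function of the eigenvalues, as a polynomial in the entries of
the matrix. -/
noncomputable def esymmPoly (n k : ℕ) : MvPolynomial (Fin n × Fin n) ℂ :=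
  MvPolynomial.C ((-1) ^ k) * (Matrix.charpoly.univ ℂ (Fin n)).coeff (n - k)

/-- Vieta's formula over ℂ, where the characteristic polynomial splits; k ≤ n makes the subtraction
n - k genuine. -/
lemma esymm_roots_charpoly {k : ℕ} (hk : k ≤ n) (N : Matrix (Fin n) (Fin n) ℂ) :
    N.charpoly.roots.esymm k = (-1) ^ k * N.charpoly.coeff (n - k) := by
  have hd : N.charpoly.natDegree = n := by simp
  rw [Polynomial.coeff_eq_esymm_roots_of_splits (IsAlgClosed.splits _) (by omega), hd,
    N.charpoly_monic.leadingCoeff, one_mul, Nat.sub_sub_self hk, ← mul_assoc, ← mul_pow]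
  simp

lemma eval_esymmPoly {k : ℕ} (hk : k ≤ n) (N : Matrix (Fin n) (Fin n) ℂ) :
    MvPolynomial.eval (fun s : Fin n × Fin n => N s.1 s.2) (esymmPoly n k) =
      N.charpoly.roots.esymm k := by
  have h := Matrix.charpoly.univ_coeff_eval₂Hom (Fin n) (RingHom.id ℂ)
    (fun s : Fin n × Fin n => N s.1 s.2) (n - k)
  have hN : (Matrix.of (Function.curry fun s : Fin n × Fin n => N s.1 s.2)) = N := by
    ext i j; rfl
  rw [hN] at h
  rw [esymm_roots_charpoly hk, ← h, esymmPoly, map_mul, MvPolynomial.eval_C]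
  rfl

lemma esymm_roots_charpoly_diagonal (k : ℕ) (d : Fin n → ℂ) :
    (Matrix.diagonal d).charpoly.roots.esymm k = elem Finset.univ k d := by
  rw [Matrix.charpoly_diagonal]
  have : (∏ i, (Polynomial.X - Polynomial.C (d i))).roots = Finset.univ.val.map d := by
    have := Polynomial.roots_multiset_prod_X_sub_C (Finset.univ.val.map d)
    rw [Multiset.map_map] at this
    exact this
  rw [this, Finset.esymm_map_val]
  rfl

lemma diagonal_add_single (d : Fin n → ℂ) (t : ℂ) (i : Fin n) :
    Matrix.diagonal d + t • Matrix.single i i (1 : ℂ) =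
      Matrix.diagonal (d + t • Pi.single i 1) := by
  ext a b
  rcases eq_or_ne a b with rfl | hab
  · rcases eq_or_ne a i with rfl | hai
    · simp
    · simp [hai, Matrix.single_apply_of_ne, hai.symm]
  · have : ¬ (i = a ∧ i = b) := fun h => hab (h.1.symm.trans h.2)
    simp [hab, Matrix.single_apply_of_ne (h := this)]

/-- A single off-diagonal entry leaves a triangular matrix with the same diagonal. Hence the
off-diagonal first derivatives of σ_k vanish at a diagonal matrix. -/
lemma charpoly_diagonal_add_single {i j : Fin n} (hij : i ≠ j) (d : Fin n → ℂ) (t : ℂ) :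
    (Matrix.diagonal d + t • Matrix.single i j (1 : ℂ)).charpoly =
      (Matrix.diagonal d).charpoly := by
  have main : ∀ i j : Fin n, i < j →
      (Matrix.diagonal d + t • Matrix.single i j (1 : ℂ)).charpoly =
        (Matrix.diagonal d).charpoly := fun i j h => by
    rw [Matrix.charpoly_of_isUpperTriangular, Matrix.charpoly_diagonal]
    · refine Finset.prod_congr rfl fun a _ => ?_
      have : ¬ (i = a ∧ j = a) := fun h' => h.ne (h'.1.trans h'.2.symm)
      simp [Matrix.single_apply_of_ne (h := this)]
    · intro a b hab
      have hab' : b < a := hab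
      have : ¬ (i = a ∧ j = b) := fun h' => by
        rw [← h'.1, ← h'.2] at hab'; exact absurd h hab'.not_gt
      simp [Matrix.single_apply_of_ne (h := this), hab'.ne']
  rcases lt_or_gt_of_ne hij with h | h
  · exact main i j h
  · rw [← Matrix.charpoly_transpose]
    have : (Matrix.diagonal d + t • Matrix.single i j (1 : ℂ)).transpose =
        Matrix.diagonal d + t • Matrix.single j i (1 : ℂ) := by
      simp [Matrix.transpose_add]
    rw [this]
    exact main j i h

/-- The partial derivatives of `esymmPoly` at a diagonal matrix. -/
lemma eval_pderiv_esymmPoly {k : ℕ} (hk : k + 1 ≤ n) (d : Fin n → ℂ) (i j : Fin n) :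
    MvPolynomial.eval (fun s : Fin n × Fin n => Matrix.diagonal d s.1 s.2)
      (MvPolynomial.pderiv (i, j) (esymmPoly n (k + 1))) =
      if i = j then elem (Finset.univ.erase i) k d else 0 := by
  have h := hasFDerivAt_mvPolynomial_eval (𝕜 := ℂ) (esymmPoly n (k + 1))
    (a := fun s t => (Matrix.diagonal d + t • Matrix.single i j (1 : ℂ)) s.1 s.2)
    (a' := fun s => (1 : ℂ →L[ℂ] ℂ).smulRight (Matrix.single i j (1 : ℂ) s.1 s.2)) (z := 0)
    (fun s => by
      have : HasDerivAt (fun t : ℂ => Matrix.diagonal d s.1 s.2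
          + t * Matrix.single i j (1 : ℂ) s.1 s.2) (Matrix.single i j (1 : ℂ) s.1 s.2) 0 := by
        simpa using ((hasDerivAt_id (0 : ℂ)).mul_const _).const_add (Matrix.diagonal d s.1 s.2)
      exact this.hasFDerivAt)
  have h' := h.hasDerivAt
  simp only [eval_esymmPoly hk, zero_smul, add_zero] at h'
  have e : (∑ s : Fin n × Fin n, MvPolynomial.eval (fun s => Matrix.diagonal d s.1 s.2)
      (MvPolynomial.pderiv s (esymmPoly n (k + 1))) •
        (1 : ℂ →L[ℂ] ℂ).smulRight (Matrix.single i j (1 : ℂ) s.1 s.2)) 1 =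
      MvPolynomial.eval (fun s : Fin n × Fin n => Matrix.diagonal d s.1 s.2)
      (MvPolynomial.pderiv (i, j) (esymmPoly n (k + 1))) := by
    rw [sum_apply, Finset.sum_eq_single (i, j)]
    · simp
    · intro s _ hs
      have : ¬ (i = s.1 ∧ j = s.2) := fun h' => hs (Prod.ext h'.1.symm h'.2.symm)
      simp [Matrix.single_apply_of_ne (h := this)]
    · simp
  rw [e] at h'
  refine h'.unique ?_
  split_ifs with hij
  · subst hij
    simp only [diagonal_add_single, esymm_roots_charpoly_diagonal,
      elem_add_single (Finset.mem_univ i)]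
    simpa using ((hasDerivAt_id (0 : ℂ)).mul_const
      (elem (Finset.univ.erase i) k d)).const_add (elem Finset.univ (k + 1) d)
  · simp only [charpoly_diagonal_add_single hij]
    exact hasDerivAt_const _ _

lemma sigmaMat_one_diagonal (k : ℕ) (d : Fin n → ℂ) :
    sigmaMat k 1 (Matrix.diagonal d) = elem Finset.univ k d := by
  rw [sigmaMat, inv_one, one_mul, esymm_roots_charpoly_diagonal]

lemma sigmaD_one_diagonal (k : ℕ) (d : Fin n → ℂ) (p : Fin n) :
    sigmaD (k + 1) 1 (Matrix.diagonal d) p p = elem (Finset.univ.erase p) k d := by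
  unfold sigmaD
  simp only [diagonal_add_single, sigmaMat_one_diagonal, elem_add_single (Finset.mem_univ p)]
  refine HasDerivAt.deriv ?_
  simpa using ((hasDerivAt_id (0 : ℂ)).mul_const
      (elem (Finset.univ.erase p) k d)).const_add (elem Finset.univ (k + 1) d)

lemma sigmaDD_one_diagonal (k : ℕ) (d : Fin n → ℂ) {p q : Fin n} (hpq : q ≠ p) :
    sigmaDD (k + 2) 1 (Matrix.diagonal d) p p q q =
      elem ((Finset.univ.erase p).erase q) k d := by
  unfold sigmaDD
  simp only [diagonal_add_single, sigmaD_one_diagonal,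
    elem_add_single (Finset.mem_erase.2 ⟨hpq, Finset.mem_univ q⟩)]
  refine HasDerivAt.deriv ?_
  simpa using ((hasDerivAt_id (0 : ℂ)).mul_const
      (elem ((Finset.univ.erase p).erase q) k d)).const_add (elem (Finset.univ.erase p) (k + 1) d)

/-- The differential of `σ_k` of a matrix-valued function at a point where it is diagonal. -/
lemma fderiv_esymm_roots_charpoly {E : Type*} [NormedAddCommGroup E] [NormedSpace ℝ E] {k : ℕ}
    (hk : k + 1 ≤ n) {N : E → Matrix (Fin n) (Fin n) ℂ} {z : E} {d : Fin n → ℂ}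
    (hN : ∀ p q, DifferentiableAt ℝ (fun w => N w p q) z) (hd : N z = Matrix.diagonal d) (v : E) :
    fderiv ℝ (fun w => (N w).charpoly.roots.esymm (k + 1)) z v =
      ∑ p, elem (Finset.univ.erase p) k d * fderiv ℝ (fun w => N w p p) z v := by
  have h := hasFDerivAt_mvPolynomial_eval (𝕜 := ℝ) (esymmPoly n (k + 1))
    (a := fun s w => N w s.1 s.2) (fun s => (hN s.1 s.2).hasFDerivAt)
  simp only [eval_esymmPoly hk, hd] at h
  rw [h.fderiv, sum_apply, Fintype.sum_prod_type]
  refine Finset.sum_congr rfl fun p _ => ?_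
  rw [Finset.sum_eq_single p]
  · simp [eval_pderiv_esymmPoly hk]
  · intro q _ hq
    simp [eval_pderiv_esymmPoly hk, hq.symm]
  · simp

end Matrices

/-! ### Differentiating the inverse metric and g⁻¹W. -/

section Differentials

variable {n : ℕ} {E : Type*} [NormedAddCommGroup E] [NormedSpace ℝ E]

lemma differentiableAt_det {N : E → Matrix (Fin n) (Fin n) ℂ} {z : E}
    (hN : ∀ p q, DifferentiableAt ℝ (fun w => N w p q) z) :
    DifferentiableAt ℝ (fun w => (N w).det) z := by
  simp only [Matrix.det_apply']
  exact DifferentiableAt.fun_sum fun σ _ => DifferentiableAt.const_mul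
    (HasFDerivAt.finsetProd fun i _ => (hN (σ i) i).hasFDerivAt).differentiableAt _

lemma differentiableAt_inv_apply {g : E → Matrix (Fin n) (Fin n) ℂ} {z : E}
    (hg : ∀ p q, DifferentiableAt ℝ (fun w => g w p q) z) (h1 : (g z).det ≠ 0) (p q : Fin n) :
    DifferentiableAt ℝ (fun w => (g w)⁻¹ p q) z := by
  simp only [Matrix.inv_def, Ring.inverse_eq_inv', Matrix.smul_apply, smul_eq_mul,
    Matrix.adjugate_apply]
  refine ((differentiableAt_det hg).inv h1).fun_mul (differentiableAt_det fun a b => ?_)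
  simp only [Matrix.updateRow_apply]
  split_ifs
  · exact differentiableAt_const _
  · exact hg a b

lemma hasFDerivAt_mul_apply {M N : E → Matrix (Fin n) (Fin n) ℂ} {z : E}
    (hM : ∀ p q, DifferentiableAt ℝ (fun w => M w p q) z)
    (hN : ∀ p q, DifferentiableAt ℝ (fun w => N w p q) z) (p q : Fin n) :
    HasFDerivAt (fun w => (M w * N w) p q) (∑ r, (M z p r • fderiv ℝ (fun w => N w r q) z
      + N z r q • fderiv ℝ (fun w => M w p r) z)) z := by
  simp only [Matrix.mul_apply]
  exact HasFDerivAt.fun_sum fun r _ => (hM p r).hasFDerivAt.fun_mul (hN r q).hasFDerivAt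

variable {g W : E → Matrix (Fin n) (Fin n) ℂ} {z : E} {d : Fin n → ℂ}

/-- Differentiate g g⁻¹ = 1, which holds near z because g stays positive definite. -/
lemma fderiv_inv_apply (hpos : ∀ᶠ w in 𝓝 z, (g w).PosDef)
    (hg : ∀ p q, DifferentiableAt ℝ (fun w => g w p q) z) (h1 : g z = 1) (p q : Fin n) (v : E) :
    fderiv ℝ (fun w => (g w)⁻¹ p q) z v = -fderiv ℝ (fun w => g w p q) z v := by
  have hi := differentiableAt_inv_apply hg (by simp [h1])
  have h := hasFDerivAt_mul_apply hg hi p q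
  have hc : (fun w => (g w * (g w)⁻¹) p q) =ᶠ[𝓝 z] fun _ => (1 : Matrix (Fin n) (Fin n) ℂ) p q := by
    filter_upwards [hpos] with w hw
    rw [Matrix.mul_nonsing_inv _ ((Matrix.isUnit_iff_isUnit_det _).1 hw.isUnit)]
  have h0 := congrArg (fun L : E →L[ℝ] ℂ => L v) (h.unique
    ((hasFDerivAt_const ((1 : Matrix (Fin n) (Fin n) ℂ) p q) z).congr_of_eventuallyEq hc))
  simp only [h1, inv_one, sum_apply, add_apply, FunLike.coe_smul, Pi.smul_apply, smul_eq_mul,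
    Finset.sum_add_distrib, Matrix.one_apply, ite_mul, one_mul, zero_mul, Finset.sum_ite_eq,
    Finset.sum_ite_eq', Finset.mem_univ, if_true, zero_apply] at h0
  exact eq_neg_of_add_eq_zero_left h0

/-- The correction by d_p times the derivative of g_{p p̄} is the Christoffel term of the Chern
connection at a point where g is the identity. -/
lemma fderiv_inv_mul_apply (hpos : ∀ᶠ w in 𝓝 z, (g w).PosDef)
    (hg : ∀ p q, DifferentiableAt ℝ (fun w => g w p q) z)
    (hW : ∀ p q, DifferentiableAt ℝ (fun w => W w p q) z) (h1 : g z = 1)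
    (hd : W z = Matrix.diagonal d) (p : Fin n) (v : E) :
    fderiv ℝ (fun w => ((g w)⁻¹ * W w) p p) z v =
      fderiv ℝ (fun w => W w p p) z v - d p * fderiv ℝ (fun w => g w p p) z v := by
  have hi := differentiableAt_inv_apply hg (by simp [h1])
  rw [(hasFDerivAt_mul_apply hi hW p p).fderiv]
  simp only [h1, hd, inv_one, sum_apply, add_apply, FunLike.coe_smul, Pi.smul_apply, smul_eq_mul,
    Finset.sum_add_distrib, fderiv_inv_apply hpos hg h1]
  rw [Finset.sum_eq_single p, Finset.sum_eq_single p]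
  · simp; ring
  · intro r _ hr; simp [hr]
  · simp
  · intro r _ hr; simp [hr.symm]
  · simp

end Differentials

/-! ### Covariant derivatives in unitary coordinates. -/

section Chern

variable {n : ℕ} {g W : (Fin n → ℂ) → Matrix (Fin n) (Fin n) ℂ} {z : Fin n → ℂ} {l : Fin n → ℝ}

lemma covD_diagonal (h1 : g z = 1) (hd : W z = Matrix.diagonal fun i => (l i : ℂ)) (p j : Fin n) :
    covD g W p p j z =
      dz j (fun w => W w p p) z - l p * dz j (fun w => g w p p) z := by
  simp only [covD, chernGamma, h1, hd, inv_one, Matrix.one_apply, mul_ite, mul_one, mul_zero,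
    Finset.sum_ite_eq', Finset.mem_univ, if_true, Matrix.diagonal_apply]
  simp [mul_comm]

lemma covDbar_diagonal (h1 : g z = 1) (hd : W z = Matrix.diagonal fun i => (l i : ℂ))
    (p j : Fin n) :
    covDbar g W p p j z =
      dzbar j (fun w => W w p p) z - l p * conj (dz j (fun w => g w p p) z) := by
  simp only [covDbar, chernGamma, h1, hd, inv_one, Matrix.one_apply, mul_ite, mul_one, mul_zero,
    Finset.sum_ite_eq', Finset.mem_univ, if_true, Matrix.diagonal_apply]
  simp [mul_comm]

/-- A function that is real near z has real directional derivatives there. -/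
lemma conj_dz_of_real {f : (Fin n → ℂ) → ℂ} (hf : DifferentiableAt ℝ f z)
    (hr : ∀ᶠ w in 𝓝 z, conj (f w) = f w) (j : Fin n) : conj (dz j f z) = dzbar j f z := by
  have h : ∀ v, conj (fderiv ℝ f z v) = fderiv ℝ f z v := fun v => by
    have h2 : HasFDerivAt (fun w => conj (f w))
        ((Complex.conjCLE : ℂ →L[ℝ] ℂ).comp (fderiv ℝ f z)) z :=
      (Complex.conjCLE : ℂ →L[ℝ] ℂ).hasFDerivAt.comp z hf.hasFDerivAt
    have h3 := h2.unique (hf.hasFDerivAt.congr_of_eventuallyEq hr)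
    simpa using congrArg (fun L : (Fin n → ℂ) →L[ℝ] ℂ => L v) h3
  simp [dz, dzbar, h, map_ofNat]

/-- For a Hermitian tensor, `D_{j̄} ω_{p p̄}` is the conjugate of `D_j ω_{p p̄}`. -/
lemma covDbar_eq_conj_covD (hW : ∀ᶠ w in 𝓝 z, (W w).IsHermitian)
    (hWd : ∀ p q, DifferentiableAt ℝ (fun w => W w p q) z) (h1 : g z = 1)
    (hd : W z = Matrix.diagonal fun i => (l i : ℂ)) (p j : Fin n) :
    covDbar g W p p j z = conj (covD g W p p j z) := by
  rw [covDbar_diagonal h1 hd, covD_diagonal h1 hd, map_sub, map_mul, Complex.conj_ofReal,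
    conj_dz_of_real (hWd p p)]
  filter_upwards [hW] with w hw
  exact hw.apply p p

/-- `D_j σ_k = ∑ σ_k^{p p̄} D_j ω_{p p̄}` at a point where the metric is the identity and the tensor
is diagonal. -/
lemma dz_sigmaMat {k : ℕ} (hk : k + 1 ≤ n) (hpos : ∀ᶠ w in 𝓝 z, (g w).PosDef)
    (hg : ∀ p q, DifferentiableAt ℝ (fun w => g w p q) z)
    (hW : ∀ p q, DifferentiableAt ℝ (fun w => W w p q) z) (h1 : g z = 1)
    (hd : W z = Matrix.diagonal fun i => (l i : ℂ)) (j : Fin n) :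
    dz j (fun w => sigmaMat (k + 1) (g w) (W w)) z =
      ∑ p, ((elem (Finset.univ.erase p) k l : ℝ) : ℂ) * covD g W p p j z := by
  have hi := differentiableAt_inv_apply hg (by simp [h1])
  have hA : ∀ p q, DifferentiableAt ℝ (fun w => ((g w)⁻¹ * W w) p q) z := fun p q =>
    (hasFDerivAt_mul_apply hi hW p q).differentiableAt
  have h : ∀ v, fderiv ℝ (fun w => sigmaMat (k + 1) (g w) (W w)) z v = ∑ p,
      ((elem (Finset.univ.erase p) k l : ℝ) : ℂ) * (fderiv ℝ (fun w => W w p p) z v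
        - l p * fderiv ℝ (fun w => g w p p) z v) := fun v => by
    have := fderiv_esymm_roots_charpoly hk hA (d := fun i => (l i : ℂ))
      (by rw [h1, inv_one, one_mul, hd]) v
    simp only [elem_ofReal, fderiv_inv_mul_apply hpos hg hW h1 hd] at this
    exact this
  simp only [covD_diagonal h1 hd]
  rw [dz, h, h, Finset.mul_sum, ← Finset.sum_sub_distrib, Finset.sum_div]
  refine Finset.sum_congr rfl fun p _ => ?_
  rw [dz, dz]
  ring

end Chern

/-! ### Passage from real to complex directions. -/

/-- The coefficients are real and symmetric in p and q, so the imaginary part cancels when p and q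
are exchanged and the real part is a sum of two real forms. -/
lemma sum_elem_erase_erase_mul_conj (T : Finset ι) (k : ℕ) (l : ι → ℝ) (ξ : ι → ℂ) :
    ∑ p ∈ T, ∑ q ∈ T.erase p, ((elem ((T.erase p).erase q) k l : ℝ) : ℂ) * ξ p * conj (ξ q) =
      ((elemDD T (k + 2) l (fun i => (ξ i).re) + elemDD T (k + 2) l (fun i => (ξ i).im) : ℝ) : ℂ)
      := by
  apply Complex.ext
  · simp only [Complex.re_sum, Complex.ofReal_re, elemDD_succ, elemD_succ, Finset.mul_sum,
      ← Finset.sum_add_distrib]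
    refine Finset.sum_congr rfl fun p _ => Finset.sum_congr rfl fun q _ => ?_
    simp
    ring
  · simp only [Complex.im_sum, Complex.ofReal_im]
    have h : ∀ p q, (((elem ((T.erase p).erase q) k l : ℝ) : ℂ) * ξ p * conj (ξ q)).im =
        elem ((T.erase p).erase q) k l * ((ξ p).im * (ξ q).re)
          - elem ((T.erase p).erase q) k l * ((ξ p).re * (ξ q).im) := fun p q => by
      simp
      ring
    simp only [h, Finset.sum_sub_distrib]
    rw [sub_eq_zero, Finset.sum_comm' (s' := fun q => T.erase q) (t' := T)]
    · refine Finset.sum_congr rfl fun p _ => Finset.sum_congr rfl fun q _ => ?_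
      rw [Finset.erase_right_comm]
      ring
    · intro p q
      simp only [Finset.mem_erase]
      tauto

lemma norm_sum_ofReal_mul_sq (T : Finset ι) (c : ι → ℝ) (ξ : ι → ℂ) :
    ‖∑ p ∈ T, (c p : ℂ) * ξ p‖ ^ 2 =
      (∑ p ∈ T, (ξ p).re * c p) ^ 2 + (∑ p ∈ T, (ξ p).im * c p) ^ 2 := by
  rw [← Complex.normSq_eq_norm_sq, Complex.normSq_apply]
  simp [Complex.re_sum, Complex.im_sum, mul_comm, sq]

/-- The concavity inequality for complex directions. -/
lemma complex_concavity {κ : ℕ} {ε Λ : ℝ} {o : ι} {T : Finset ι} (ho : o ∉ T) {l : ι → ℝ}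
    (hf : 0 < elem (insert o T) (κ + 2) l)
    (h : ∀ ξ : ι → ℝ, (1 - ε) * (elem T (κ + 1) l * ξ o ^ 2 / Λ) ≤
      -elemDD (insert o T) (κ + 2) l ξ
        + 2 * (elemD (insert o T) (κ + 2) l ξ ^ 2 / elem (insert o T) (κ + 2) l)
        + (1 - ε) * ∑ i ∈ T, elem ((insert o T).erase i) (κ + 1) l * ξ i ^ 2 / Λ)
    (ξ : ι → ℂ) :
    (1 - (ε : ℂ)) * (((elem ((insert o T).erase o) (κ + 1) l : ℝ) : ℂ) * (‖ξ o‖ : ℂ) ^ 2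
        / ((Λ : ℂ) * ((elem (insert o T) (κ + 2) l : ℝ) : ℂ))) ≤
      -(∑ p ∈ insert o T, ∑ q ∈ (insert o T).erase p,
          ((elem (((insert o T).erase p).erase q) κ l : ℝ) : ℂ) * ξ p * conj (ξ q)
            / ((elem (insert o T) (κ + 2) l : ℝ) : ℂ))
        + ((2 : ℝ) : ℂ) * ((‖∑ p ∈ insert o T,
            ((elem ((insert o T).erase p) (κ + 1) l : ℝ) : ℂ) * ξ p‖ : ℂ) ^ 2
            / ((elem (insert o T) (κ + 2) l : ℝ) : ℂ) ^ 2)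
        + (1 - (ε : ℂ)) * ∑ i ∈ T, ((elem ((insert o T).erase i) (κ + 1) l : ℝ) : ℂ)
            * (‖ξ i‖ : ℂ) ^ 2 / ((Λ : ℂ) * ((elem (insert o T) (κ + 2) l : ℝ) : ℂ)) := by
  have h1 := h fun i => (ξ i).re
  have h2 := h fun i => (ξ i).im
  rw [Finset.erase_insert ho]
  simp only [← Finset.sum_div]
  rw [sum_elem_erase_erase_mul_conj]
  obtain ⟨f, hfe⟩ : ∃ f, f = elem (insert o T) (κ + 2) l := ⟨_, rfl⟩
  rw [← hfe] at hf h1 h2 ⊢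
  have e2 := norm_sum_ofReal_mul_sq (insert o T)
    (fun p => elem ((insert o T).erase p) (κ + 1) l) ξ
  rw [← elemD_succ (y := fun p => (ξ p).re), ← elemD_succ (y := fun p => (ξ p).im)] at e2
  have e3 : ∀ i, ‖ξ i‖ ^ 2 = (ξ i).re ^ 2 + (ξ i).im ^ 2 := fun i => by
    rw [← Complex.normSq_eq_norm_sq, Complex.normSq_apply]; ring
  rw [← Complex.ofReal_pow ‖∑ p ∈ insert o T, _‖, e2]
  simp only [← Complex.ofReal_pow ‖ξ _‖, e3]
  have hre : (1 - ε) * (elem T (κ + 1) l * ((ξ o).re ^ 2 + (ξ o).im ^ 2) / (Λ * f)) ≤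
      -((elemDD (insert o T) (κ + 2) l (fun i => (ξ i).re)
          + elemDD (insert o T) (κ + 2) l (fun i => (ξ i).im)) / f)
        + 2 * ((elemD (insert o T) (κ + 2) l (fun i => (ξ i).re) ^ 2
          + elemD (insert o T) (κ + 2) l (fun i => (ξ i).im) ^ 2) / f ^ 2)
        + (1 - ε) * ((∑ i ∈ T, elem ((insert o T).erase i) (κ + 1) l
            * ((ξ i).re ^ 2 + (ξ i).im ^ 2)) / (Λ * f)) := by
    -- Adds the inequalities for the real and imaginary parts and divides by f > 0.
    have h3 := mul_le_mul_of_nonneg_right (add_le_add h1 h2) (inv_pos.2 hf).le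
    simp only [mul_add, Finset.sum_add_distrib]
    rw [← Finset.sum_div, ← Finset.sum_div] at h3
    refine (le_of_eq ?_).trans (h3.trans (le_of_eq ?_))
    · rw [div_mul_eq_div_div, div_eq_mul_inv _ f]; ring
    · rw [div_mul_eq_div_div, sq f]
      simp only [div_eq_mul_inv, mul_inv]
      ring
  have := Complex.real_le_real.2 hre
  push_cast at this ⊢
  exact this

end HessianConcavity

/-! ### The modified concavity inequality. -/

open HessianConcavity in
theorem lemma1p4 (k : ℕ) (hk : 1 ≤ k) :
    ∃ K : ℝ, 0 < K ∧
      ∀ (n : ℕ) [NeZero n], k ≤ n →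
      ∀ A s₀ s₁ ε₀ : ℝ, 0 < A → 0 < s₀ → s₀ ≤ s₁ → 0 < ε₀ → ε₀ < 1 →
      ∃ L : ℝ, 0 < L ∧
        ∀ (z₀ : Fin n → ℂ) (g W : (Fin n → ℂ) → Matrix (Fin n) (Fin n) ℂ) (lam : Fin n → ℝ),
          -- `g` is a Hermitian metric and `W` a Hermitian tensor near `z₀`
          (∀ᶠ z in 𝓝 z₀, (g z).PosDef) →
          (∀ᶠ z in 𝓝 z₀, (W z).IsHermitian) →
          (∀ p q, DifferentiableAt ℝ (fun z => g z p q) z₀) →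
          (∀ p q, DifferentiableAt ℝ (fun z => W z p q) z₀) →
          -- at `z₀` the coordinates are unitary and `W` is diagonal
          g z₀ = 1 →
          W z₀ = Matrix.diagonal (fun i => (lam i : ℂ)) →
          lam ∈ gardingCone n k →
          Antitone lam →
          (∀ i, -A < lam i) →
          s₀ ≤ sigma k lam → sigma k lam ≤ s₁ →
          L ≤ lam 0 →
          ∀ j : Fin n,
            (1 - (ε₀ : ℂ)) *
                (sigmaD k (g z₀) (W z₀) 0 0 * (‖covD g W 0 0 j z₀‖ : ℂ) ^ 2
                  / ((lam 0 : ℂ) * (sigma k lam : ℂ)))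
              ≤ -(∑ p, ∑ q ∈ Finset.univ.erase p,
                    sigmaDD k (g z₀) (W z₀) p p q q * covD g W p p j z₀ * covDbar g W q q j z₀
                      / (sigma k lam : ℂ))
                + (K : ℂ) * ((‖dz j (fun z => sigmaMat k (g z) (W z)) z₀‖ : ℂ) ^ 2
                      / (sigma k lam : ℂ) ^ 2)
                + (1 - (ε₀ : ℂ)) * ∑ i ∈ Finset.univ.erase (0 : Fin n),
                    sigmaD k (g z₀) (W z₀) i i * (‖covD g W i i j z₀‖ : ℂ) ^ 2
                      / ((lam 0 : ℂ) * (sigma k lam : ℂ)) := by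
  -- K = 2 for every k: one copy of |D_j σ_k|²/σ_k² for the concavity of log σ_k, one for the error
  -- in the case of a small quotient.
  refine ⟨2, two_pos, fun n _ hkn A s₀ s₁ ε₀ hA hs₀ hs hε₀ hε₁ => ?_⟩
  have hs₁ : 0 < s₁ := hs₀.trans_le hs
  obtain ⟨κ, rfl | rfl⟩ : ∃ κ, k = 1 ∨ k = κ + 2 := ⟨k - 2, by omega⟩
  -- For k = 1, σ_1 ≥ λ_1 - n A exceeds s₁ once λ_1 ≥ s₁ + n A + 1, so there is nothing to prove.
  · refine ⟨s₁ + n * A + 1, by positivity, ?_⟩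
    intro z₀ g W lam _ _ _ _ _ _ _ _ hlA _ hf hL
    exfalso
    have h1 : sigma 1 lam = lam 0 + ∑ i ∈ Finset.univ.erase 0, lam i :=
      (elem_one _ _).trans (Finset.add_sum_erase _ _ (Finset.mem_univ 0)).symm
    have h2 : ∑ _i ∈ Finset.univ.erase (0 : Fin n), -A ≤ ∑ i ∈ Finset.univ.erase 0, lam i :=
      Finset.sum_le_sum fun i _ => (hlA i).le
    rw [Finset.sum_const, nsmul_eq_mul] at h2
    have h3 : ((Finset.univ.erase (0 : Fin n)).card : ℝ) ≤ n := by
      exact_mod_cast (Finset.card_le_univ _).trans (Fintype.card_fin n).le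
    have h4 := mul_le_mul_of_nonneg_right h3 hA.le
    linarith
  · obtain ⟨L, hL0, hL⟩ := exists_concavity (ι := Fin n) n κ hA hs₁ hε₀ hε₁
    refine ⟨L, hL0, ?_⟩
    intro z₀ g W lam hg hW hgd hWd hg1 hWl hcone hanti hlA _ hf hLl j
    have hins : insert 0 (Finset.univ.erase 0) = (Finset.univ : Finset (Fin n)) :=
      Finset.insert_erase (Finset.mem_univ 0)
    -- `InGarding` also asks for degree 0, where the function is 1.
    have hG : InGarding (Finset.univ : Finset (Fin n)) (κ + 2) lam := fun i hi => by
      rcases Nat.eq_zero_or_pos i with rfl | h0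
      · simp
      · exact hcone i h0 hi
    have key := complex_concavity (o := (0 : Fin n)) (T := Finset.univ.erase 0) (κ := κ)
      (l := lam) (Finset.notMem_erase _ _) (by rw [hins]; exact hG _ le_rfl)
      (hL 0 (Finset.univ.erase 0) lam (Finset.notMem_erase _ _)
        ((Finset.card_le_univ _).trans (Fintype.card_fin n).le) (by rwa [hins])
        (fun i _ => hanti (Fin.zero_le i)) (fun i _ => hlA i) (by rw [hins]; exact hf) hLl)
      fun p => covD g W p p j z₀
    rw [hins] at key
    rw [dz_sigmaMat hkn hg hgd hWd hg1 hWl]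
    simp only [covDbar_eq_conj_covD hW hWd hg1 hWl]
    have hD : ∀ p, sigmaD (κ + 2) (g z₀) (W z₀) p p =
        ((elem (Finset.univ.erase p) (κ + 1) lam : ℝ) : ℂ) := fun p => by
      rw [hg1, hWl, sigmaD_one_diagonal, elem_ofReal]
    have hDD : ∀ p, ∀ q ∈ Finset.univ.erase p, sigmaDD (κ + 2) (g z₀) (W z₀) p p q q =
        ((elem ((Finset.univ.erase p).erase q) κ lam : ℝ) : ℂ) := fun p q hq => by
      rw [hg1, hWl, sigmaDD_one_diagonal _ _ (Finset.ne_of_mem_erase hq), elem_ofReal]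
    have hsum := Finset.sum_congr (rfl : (Finset.univ : Finset (Fin n)) = Finset.univ)
      fun p _ => Finset.sum_congr (rfl : Finset.univ.erase p = Finset.univ.erase p) fun q hq =>
        congrArg (fun c => c * covD g W p p j z₀ * conj (covD g W q q j z₀)
          / (sigma (κ + 2) lam : ℂ)) (hDD p q hq)
    simp only [hD]
    rw [hsum]
    exact key
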